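/- **Setting.** Let $\Omega=[0,1]^2$. For $\lambda>0$ put $N=\lfloor 1/\lambda\rfloor$, so that $\{i\in\mathbb Z^2:\lambda i\in\Omega\}=\{0,\dots,N\}^2=:Z_\lambda$, and let $R^1_\lambda$ (resp. $R^2_\lambda$) be the set of $i\in Z_\lambda$ with $i+2e_1\in Z_\lambda$ (resp. $i+e_2\in Z_\lambda$). For a finite set $Q\subset\mathbb S^2$ let $M_Q=\bigcup_{q\in Q}(\mathbb S^2\cap q^\perp)$. An admissible spin field is a map $u:Z_\lambda\to M_Q$ with $(u^{(1,m)},u^{(0,m)})=(u^{(N,m)},u^{(N-1,m)})$ for all $m=0,\dots,N$. For $\delta>0$ and $J_2>0$ its energy is $$H(u)=\frac12\Big(\sum_{i\in R^1_\lambda}\lambda^2\big|u^i-2(1-\delta)u^{i+e_1}+u^{i+2e_1}\big|^2+J_2\sum_{i\in R^2_\lambda}\lambda^2|u^{i+e_2}-u^i|^2\Big),$$ and its chirality $T(u)\in L^1(\Omega;\mathbb R^3)$ is the function equal to $z^i=\frac{u^i\times u^{i+e_1}}{\sqrt{2\delta}}$ on $\Omega\cap\lambda(i+[0,1)^2)$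 for $i\in Z_\lambda$, where $z^{(N,m)}:=z^{(N-1,m)}$. For $z\in L^1(\Omega;\mathbb R^3)$ the constrained energy is the infimum of $H(u)$ over all admissible spin fields $u$ with $T(u)=z$ a.e., and $+\infty$ if there are none. A function $z$ belongs to $BV_{\rm pc}(\Omega;K)$ if $z\in SBV((0,1)^2;\mathbb R^3)$, $z\in K$ a.e., and $z$ is a.e. constant on each element of a Caccioppoli partition of $(0,1)^2$, that is, a countable measurable partition $\{E_\alpha\}$ up to a null set with $\sum_\alpha P(E_\alpha;(0,1)^2)<\infty$. $J_z\subset(0,1)^2$ denotes the approximate jump set of $z$. **Theorem.** Let $\lambda_n,\delta_n>0$ with $\lambda_n\to0$, $\delta_n\to0$, let $J_{2,n}\in\mathbb R$, let $k_n\ge1$ be integers and let $Q_{k_n}\subset\mathbb S^2$ be sets of exactly $k_n$ points which converge in the sense of Kuratowski to a set $\overline Q$. Assume $$k_n\delta_n^{1/4}\to0,\qquad \frac{\lambda_n}{\sqrt{\delta_n}}\to0,\qquad J_{2,n}\frac{\lambda_n}{\sqrt{\delta_n}}\ge c>0\ \text{ for all } n .$$ Let $H_n^k:L^1(\Omega;\mathbb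 R^3)\to[0,+\infty]$ be the constrained energy with parameters $\lambda_n,\delta_n,J_{2,n},Q_{k_n}$. Then the functionals $\dfrac{H_n^k}{\sqrt2\,\lambda_n\delta_n^{3/2}}$ $\Gamma$-converge, with respect to the strong $L^1(\Omega;\mathbb R^3)$ topology, to $$H(z)=\begin{cases}\dfrac83\,\mathcal H^1(J_z)&\text{if } z\in BV_{\rm pc}\big(\Omega;\overline Q\cup(-\overline Q)\big)\text{ and } z \text{ does not depend on } y,\\[2mm]+\infty&\text{otherwise,}\end{cases}$$ and $H(z)<+\infty$ exactly when $z\in BV_{\rm pc}(\Omega;\overline Q\cup(-\overline Q))$ and $z$ does not depend on $y$. (If the sets $Q_{k_n}$ are symmetric under $q\mapsto-q$, then $\overline Q\cup(-\overline Q)=\overline Q$.) -/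

import Mathlib

open MeasureTheory Filter Topology Set
open scoped ENNReal ContDiff

noncomputable section

/-! ### Gamma-convergence and Kuratowski convergence -/

/-- Sequential Γ-convergence of functionals with values in `[0, +∞]` on a metric space. -/
def GammaConverges {X : Type*} [PseudoMetricSpace X] (F : ℕ → X → ℝ≥0∞) (G : X → ℝ≥0∞) : Prop :=
  (∀ (x : X) (xs : ℕ → X), Tendsto xs atTop (𝓝 x) →
      G x ≤ liminf (fun n => F n (xs n)) atTop) ∧
  (∀ x : X, ∃ xs : ℕ → X, Tendsto xs atTop (𝓝 x) ∧
      limsup (fun n => F n (xs n)) atTop ≤ G x)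

/-- Kuratowski convergence of a sequence of (nonempty) sets. -/
def KuratowskiConverges {X : Type*} [TopologicalSpace X] (S : ℕ → Set X) (L : Set X) : Prop :=
  (∀ x : ℕ → X, (∀ n, x n ∈ S n) → ∀ a, MapClusterPt a atTop x → a ∈ L) ∧
  (∀ a ∈ L, ∃ x : ℕ → X, (∀ n, x n ∈ S n) ∧ Tendsto x atTop (𝓝 a))

/-! ### Functions of bounded variation on an open set of `ℝ^d` -/

/-- The `j`-th partial derivative of a scalar function on `ℝ^d`. -/
def partialDeriv {d : ℕ} (j : Fin d) (φ : EuclideanSpace ℝ (Fin d) → ℝ)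
    (x : EuclideanSpace ℝ (Fin d)) : ℝ :=
  fderiv ℝ φ x (EuclideanSpace.single j 1)

/-- The divergence of a vector field on `ℝ^d`. -/
def divergence {d : ℕ} (φ : EuclideanSpace ℝ (Fin d) → EuclideanSpace ℝ (Fin d))
    (x : EuclideanSpace ℝ (Fin d)) : ℝ :=
  ∑ j, partialDeriv j (fun y => φ y j) x

/-- The perimeter `P(A; Ω)` of `A` relative to the open set `Ω`. -/
def perimeter {d : ℕ} (A Ω : Set (EuclideanSpace ℝ (Fin d))) : ℝ≥0∞ :=
  ⨆ (φ : EuclideanSpace ℝ (Fin d) → EuclideanSpace ℝ (Fin d))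
    (_ : ContDiff ℝ 1 φ ∧ HasCompactSupport φ ∧ tsupport φ ⊆ Ω ∧ ∀ x, ‖φ x‖ ≤ 1),
    ENNReal.ofReal (∫ x in A, divergence φ x)

/-- `Du = σ μ` is the polar decomposition of the distributional gradient of `u` on `Ω`:
`μ = |Du|` is a finite measure on `Ω`, the matrix field `σ` has Frobenius norm one `μ`-almost
everywhere, and `∫_Ω u_i ∂_j φ dx = - ∫ φ σ_{ij} dμ` for all test functions `φ` on `Ω`. -/
structure IsGradientMeasure {d m : ℕ} (Ω : Set (EuclideanSpace ℝ (Fin d)))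
    (u : EuclideanSpace ℝ (Fin d) → EuclideanSpace ℝ (Fin m))
    (μ : Measure (EuclideanSpace ℝ (Fin d)))
    (σ : EuclideanSpace ℝ (Fin d) → Fin m → Fin d → ℝ) : Prop where
  finite : IsFiniteMeasure μ
  concentrated : μ Ωᶜ = 0
  measurable : Measurable σ
  norm_eq_one : ∀ᵐ x ∂μ, ∑ i, ∑ j, σ x i j ^ 2 = 1
  integral_eq : ∀ (i : Fin m) (j : Fin d) (φ : EuclideanSpace ℝ (Fin d) → ℝ),
    ContDiff ℝ ∞ φ → HasCompactSupport φ → tsupport φ ⊆ Ω →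
      ∫ x in Ω, u x i * partialDeriv j φ x = - ∫ x, φ x * σ x i j ∂μ

/-- The approximate jump set `J_u` of `u` in the open set `Ω`: the points `x` at which `u` has
distinct one-sided approximate limits `a`, `b` on the two half balls cut by some direction `ν`. -/
def jumpSet {d m : ℕ} (Ω : Set (EuclideanSpace ℝ (Fin d)))
    (u : EuclideanSpace ℝ (Fin d) → EuclideanSpace ℝ (Fin m)) :
    Set (EuclideanSpace ℝ (Fin d)) :=
  {x | x ∈ Ω ∧ ∃ (a b : EuclideanSpace ℝ (Fin m)) (ν : EuclideanSpace ℝ (Fin d)),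
    a ≠ b ∧ ‖ν‖ = 1 ∧
    Tendsto (fun r : ℝ => ⨍ y in {y | y ∈ Metric.ball x r ∧ 0 < inner ℝ (y - x) ν}, ‖u y - a‖)
      (𝓝[>] 0) (𝓝 0) ∧
    Tendsto (fun r : ℝ => ⨍ y in {y | y ∈ Metric.ball x r ∧ inner ℝ (y - x) ν < 0}, ‖u y - b‖)
      (𝓝[>] 0) (𝓝 0)}

/-- `u ∈ SBV(Ω; ℝ^m)`: `u ∈ L¹(Ω)`, `Du` is a finite measure, and `|D^s u|(Ω \ J_u) = 0`. -/
def IsSBV {d m : ℕ} (Ω : Set (EuclideanSpace ℝ (Fin d)))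
    (u : EuclideanSpace ℝ (Fin d) → EuclideanSpace ℝ (Fin m)) : Prop :=
  IntegrableOn u Ω ∧
  ∃ (μ : Measure (EuclideanSpace ℝ (Fin d)))
    (σ : EuclideanSpace ℝ (Fin d) → Fin m → Fin d → ℝ),
    IsGradientMeasure Ω u μ σ ∧ (μ.singularPart volume) (Ω \ jumpSet Ω u) = 0

/-- A Caccioppoli partition of `Ω`: a countable partition, up to a null set, of finite total
perimeter (some of the sets may be empty). -/
structure IsCaccioppoliPartition {d : ℕ} (Ω : Set (EuclideanSpace ℝ (Fin d)))
    (P : ℕ → Set (EuclideanSpace ℝ (Fin d))) : Prop where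
  measurableSet : ∀ α, MeasurableSet (P α)
  subset : ∀ α, P α ⊆ Ω
  disjoint : Pairwise fun α β => Disjoint (P α) (P β)
  null_compl : volume (Ω \ ⋃ α, P α) = 0
  perimeter_lt_top : ∑' α, perimeter (P α) Ω < ⊤

/-- `u ∈ BV_pc(Ω; K)`: `u` is an `SBV` function with values in `K` that is constant on each element
of some Caccioppoli partition of `Ω`. -/
def IsBVpc {d m : ℕ} (Ω : Set (EuclideanSpace ℝ (Fin d))) (K : Set (EuclideanSpace ℝ (Fin m)))
    (u : EuclideanSpace ℝ (Fin d) → EuclideanSpace ℝ (Fin m)) : Prop :=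
  IsSBV Ω u ∧ (∀ᵐ x ∂volume.restrict Ω, u x ∈ K) ∧
  ∃ P : ℕ → Set (EuclideanSpace ℝ (Fin d)), IsCaccioppoliPartition Ω P ∧
    ∀ α, ∃ c, ∀ᵐ x ∂volume.restrict (P α), u x = c

/-! ### The spin model -/

/-- The domain `Ω = [0,1]²`. -/
def unitSquare : Set (EuclideanSpace ℝ (Fin 2)) := {x | ∀ j, x j ∈ Icc (0 : ℝ) 1}

/-- The interior `(0,1)²` of `Ω`, on which the notions from the theory of `BV` functions are read. -/
def openUnitSquare : Set (EuclideanSpace ℝ (Fin 2)) := {x | ∀ j, x j ∈ Ioo (0 : ℝ) 1}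

/-- The space `L¹(Ω; ℝ³)`. -/
abbrev L1Square : Type :=
  Lp (EuclideanSpace ℝ (Fin 3)) 1 (volume.restrict unitSquare)

/-- The vector product in `ℝ³`. -/
def cross3 (v w : EuclideanSpace ℝ (Fin 3)) : EuclideanSpace ℝ (Fin 3) :=
  WithLp.toLp 2 (crossProduct v.ofLp w.ofLp)

/-- The set of all `i ∈ ℤ²` with `lam • i ∈ [0,1]²`. -/
def lattice (lam : ℝ) : Finset (ℤ × ℤ) :=
  Finset.Icc 0 ⌊1 / lam⌋ ×ˢ Finset.Icc 0 ⌊1 / lam⌋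

theorem mem_lattice {lam : ℝ} (h : 0 < lam) (i : ℤ × ℤ) :
    i ∈ lattice lam ↔ !₂[lam * (i.1 : ℝ), lam * (i.2 : ℝ)] ∈ unitSquare := by
  have key : ∀ a : ℤ, (0 ≤ a ∧ a ≤ ⌊1 / lam⌋) ↔ (0 ≤ lam * (a : ℝ) ∧ lam * (a : ℝ) ≤ 1) := by
    intro a
    rw [Int.le_floor, le_div_iff₀ h, mul_comm (a : ℝ) lam, mul_nonneg_iff_of_pos_left h,
      Int.cast_nonneg_iff]
  simp only [lattice, unitSquare, Finset.mem_product, Finset.mem_Icc, key, mem_ofPred_eq,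
    Fin.forall_fin_two, mem_Icc]
  simp

/-- The set `R¹` of the lattice points `i` with `i + 2e₁` in the lattice. -/
def latticeR1 (lam : ℝ) : Finset (ℤ × ℤ) :=
  (lattice lam).filter fun i => (i.1 + 2, i.2) ∈ lattice lam

/-- The set `R²` of the lattice points `i` with `i + e₂` in the lattice. -/
def latticeR2 (lam : ℝ) : Finset (ℤ × ℤ) :=
  (lattice lam).filter fun i => (i.1, i.2 + 1) ∈ lattice lam

/-- The set `M` of the unit vectors that are orthogonal to some `q ∈ Q`, a union of great circles. -/
def circleUnion (Q : Set (EuclideanSpace ℝ (Fin 3))) : Set (EuclideanSpace ℝ (Fin 3)) :=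
  {v | ‖v‖ = 1 ∧ ∃ q ∈ Q, inner ℝ v q = 0}

/-- Spin fields on the lattice with values in `M` that satisfy the boundary condition
`(u^{(1,m)}, u^{(0,m)}) = (u^{([1/lam],m)}, u^{([1/lam]-1,m)})` on every row. Only the values at
lattice points matter. -/
structure IsAdmissibleSpin (lam : ℝ) (M : Set (EuclideanSpace ℝ (Fin 3)))
    (u : ℤ × ℤ → EuclideanSpace ℝ (Fin 3)) : Prop where
  mem : ∀ i ∈ lattice lam, u i ∈ M
  boundary : ∀ m : ℤ, 0 ≤ m → m ≤ ⌊1 / lam⌋ →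
    inner ℝ (u (1, m)) (u (0, m)) = inner ℝ (u (⌊1 / lam⌋, m)) (u (⌊1 / lam⌋ - 1, m))

/-- The renormalized energy `H_n(u)` of a spin field. -/
def spinEnergy (lam δ J₂ : ℝ) (u : ℤ × ℤ → EuclideanSpace ℝ (Fin 3)) : ℝ :=
  (1 / 2) *
    (∑ i ∈ latticeR1 lam,
        lam ^ 2 * ‖u i - (2 * (1 - δ)) • u (i.1 + 1, i.2) + u (i.1 + 2, i.2)‖ ^ 2 +
      J₂ * ∑ i ∈ latticeR2 lam, lam ^ 2 * ‖u (i.1, i.2 + 1) - u i‖ ^ 2)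

/-- The chirality `z^i = (u^i × u^{i+e₁}) / √(2δ)` at a lattice point. In the last column, where
`i + e₁` leaves the lattice, it takes the value of the column before. -/
def chirality (lam δ : ℝ) (u : ℤ × ℤ → EuclideanSpace ℝ (Fin 3)) (i : ℤ × ℤ) :
    EuclideanSpace ℝ (Fin 3) :=
  (√(2 * δ))⁻¹ •
    cross3 (u (min i.1 (⌊1 / lam⌋ - 1), i.2)) (u (min i.1 (⌊1 / lam⌋ - 1) + 1, i.2))

/-- `T_n(u)`: the piecewise constant interpolation of the chirality, equal to `z^i` on the cell
`lam • (i + [0,1)²)`. -/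
def chiralityField (lam δ : ℝ) (u : ℤ × ℤ → EuclideanSpace ℝ (Fin 3))
    (x : EuclideanSpace ℝ (Fin 2)) : EuclideanSpace ℝ (Fin 3) :=
  chirality lam δ u (⌊x 0 / lam⌋, ⌊x 1 / lam⌋)

/-- The constrained energy `H_n^k` on `L¹(Ω; ℝ³)`: the infimum of the energies of the spin fields
with values in the circles orthogonal to the points of `Q` and with chirality `z`, and `+∞` if there
is no such spin field. -/
def constrainedEnergy (lam δ J₂ : ℝ) (Q : Set (EuclideanSpace ℝ (Fin 3))) (z : L1Square) : ℝ≥0∞ :=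
  ⨅ (u : ℤ × ℤ → EuclideanSpace ℝ (Fin 3)) (_ : IsAdmissibleSpin lam (circleUnion Q) u)
    (_ : ⇑z =ᵐ[volume.restrict unitSquare] chiralityField lam δ u),
    ENNReal.ofReal (spinEnergy lam δ J₂ u)

/-- The function `z` of the variables `(x, y)` does not depend on `y`. -/
def IndependentOfY (z : L1Square) : Prop :=
  ∃ ζ : ℝ → EuclideanSpace ℝ (Fin 3), ∀ᵐ p ∂volume.restrict unitSquare, z p = ζ (p 0)

open Classical in
/-- The limit functional: `(8/3) H¹(J_z)` if `z ∈ BV_pc(Ω; K)` does not depend on `y`, and `+∞`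
otherwise. -/
def limitEnergy (K : Set (EuclideanSpace ℝ (Fin 3))) (z : L1Square) : ℝ≥0∞ :=
  if IsBVpc openUnitSquare K z ∧ IndependentOfY z then
    (8 / 3) * Measure.hausdorffMeasure 1 (jumpSet openUnitSquare z)
  else ⊤

end

noncomputable section

/-! Put h = √(2δ), so that 2(1 - δ) = 2 - h². For unit vectors the square |a - (2 - h²)b + c|²
splits into its part along b and its part orthogonal to b (`norm_sub_smul_add_sq`). With the
chirality z and the rescaled step length w = |u^{i+e₁} - u^i| / h, a row has the energy Σ |z_{i+1} -
z_i|² / h + (h/4)(2 - w_i² - w_{i+1}²)². Since |z| ≈ w, this is a discrete Modica–Mortola functional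
with wells at |z| = 1 and potential 2w - 2w³/3; going from |z| = 1 to 0 and back costs 2 · 4/3 =
8/3.

A vector field z could change its direction for free by turning with |z| = 1; the constraint forbids
this. Among k + 1 consecutive spins two lie on the same circle, so on each window of length k the
chirality is close to the line of one axis (`exists_line_of_window`). As long as |z| ≥ η, the
directions z/|z| are therefore covered by 2k balls about ±q. Grouping the windows by their axis,
Cauchy–Schwarz bounds the sum of the radii by a multiple of k√h + k²h, which tends to 0 because
kδ^{1/4} → 0. A direction that moves in small steps cannot travel further than these balls allow
(`norm_direction_sub_le`). Hence z comes close to 0 at each jump, and the jumps are counted in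
`IsRowSequence.card_le_of_subset_singularSet`.

The bound on J₂ makes any two rows of a field differ by O(h) in mean square. Two rows turning about
different axes on an interval would drift apart by more, as λ/h → 0, so all rows have the same limit
(`card_mul_norm_sub_sq_le`, `IsRowSequence.ae_eq`). Fatou's lemma in y provides a row with nearly
the mean energy, and this row gives the lower bound (`IsFieldSequence.limit`).

The limit domain is made of step functions of x: each singular point uses up a fixed amount of the
perimeter of the partition (`finite_singularSet_of_partition`), and conversely finitely many jumps
give an SBV function whose jump set consists of as many unit segments (`isBVpc_of_finite`,
`hausdorffMeasure_jumpSet`).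

Recovery fields are constant in y, so J₂ plays no role. Each row moves on one circle between two
jumps, with a discrete tanh profile that starts and ends at rest, and changes circle at a common
point of two great circles while at rest. A scale factor near 1 adjusts the total angle so that this
point is hit (`exists_bridge`); the pieces are chained in `exists_recovery_tail`. -/

/-- Three-dimensional Euclidean space. -/
abbrev Space3 : Type := EuclideanSpace ℝ (Fin 3)

/-! ### The vector product -/

theorem inner_eq_three (v w : Space3) :
    inner ℝ v w = v 0 * w 0 + v 1 * w 1 + v 2 * w 2 := by
  simp only [PiLp.inner_apply, Fin.sum_univ_three, RCLike.inner_apply, conj_trivial]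
  ring

theorem norm_sq_eq_three (v : Space3) : ‖v‖ ^ 2 = v 0 ^ 2 + v 1 ^ 2 + v 2 ^ 2 := by
  rw [EuclideanSpace.norm_sq_eq, Fin.sum_univ_three]
  simp

theorem cross3_zero (v w : Space3) : cross3 v w 0 = v 1 * w 2 - v 2 * w 1 := by
  simp [cross3, cross_apply]

theorem cross3_one (v w : Space3) : cross3 v w 1 = v 2 * w 0 - v 0 * w 2 := by
  simp [cross3, cross_apply]

theorem cross3_two (v w : Space3) : cross3 v w 2 = v 0 * w 1 - v 1 * w 0 := by
  simp [cross3, cross_apply]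

theorem space3_ext {v w : Space3} (h0 : v 0 = w 0) (h1 : v 1 = w 1) (h2 : v 2 = w 2) : v = w := by
  ext i
  fin_cases i
  · exact h0
  · exact h1
  · exact h2

theorem cross3_add_right (u v w : Space3) : cross3 u (v + w) = cross3 u v + cross3 u w := by
  apply space3_ext <;> simp only [cross3_zero, cross3_one, cross3_two, PiLp.add_apply] <;> ring

theorem cross3_add_left (u v w : Space3) : cross3 (u + v) w = cross3 u w + cross3 v w := by
  apply space3_ext <;> simp only [cross3_zero, cross3_one, cross3_two, PiLp.add_apply] <;> ring

theorem cross3_sub_right (u v w : Space3) : cross3 u (v - w) = cross3 u v - cross3 u w := by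
  apply space3_ext <;> simp only [cross3_zero, cross3_one, cross3_two, PiLp.sub_apply] <;> ring

theorem cross3_sub_left (u v w : Space3) : cross3 (u - v) w = cross3 u w - cross3 v w := by
  apply space3_ext <;> simp only [cross3_zero, cross3_one, cross3_two, PiLp.sub_apply] <;> ring

theorem cross3_smul_right (c : ℝ) (v w : Space3) : cross3 v (c • w) = c • cross3 v w := by
  apply space3_ext <;>
    simp only [cross3_zero, cross3_one, cross3_two, PiLp.smul_apply, smul_eq_mul] <;> ring

theorem cross3_smul_left (c : ℝ) (v w : Space3) : cross3 (c • v) w = c • cross3 v w := by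
  apply space3_ext <;>
    simp only [cross3_zero, cross3_one, cross3_two, PiLp.smul_apply, smul_eq_mul] <;> ring

theorem cross3_self (v : Space3) : cross3 v v = 0 := by
  apply space3_ext <;> simp only [cross3_zero, cross3_one, cross3_two, PiLp.zero_apply] <;> ring

theorem cross3_comm (v w : Space3) : cross3 v w = -cross3 w v := by
  apply space3_ext <;> simp only [cross3_zero, cross3_one, cross3_two, PiLp.neg_apply] <;> ring

theorem norm_cross3_sq (v w : Space3) :
    ‖cross3 v w‖ ^ 2 = ‖v‖ ^ 2 * ‖w‖ ^ 2 - inner ℝ v w ^ 2 := by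
  simp only [norm_sq_eq_three, inner_eq_three, cross3_zero, cross3_one, cross3_two]
  ring

theorem norm_cross3_le (v w : Space3) : ‖cross3 v w‖ ≤ ‖v‖ * ‖w‖ := by
  refine abs_le_of_sq_le_sq' ?_ (by positivity) |>.2
  rw [norm_cross3_sq, mul_pow]
  nlinarith [sq_nonneg (inner ℝ v w)]

theorem inner_cross3_left (v w : Space3) : inner ℝ v (cross3 v w) = 0 := by
  simp only [inner_eq_three, cross3_zero, cross3_one, cross3_two]
  ring

theorem inner_cross3_right (v w : Space3) : inner ℝ w (cross3 v w) = 0 := by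
  simp only [inner_eq_three, cross3_zero, cross3_one, cross3_two]
  ring

theorem cross3_cross3_left (v w : Space3) :
    cross3 (cross3 v w) v = ‖v‖ ^ 2 • w - inner ℝ v w • v := by
  apply space3_ext <;>
    simp only [cross3_zero, cross3_one, cross3_two, PiLp.sub_apply, PiLp.smul_apply, smul_eq_mul,
      inner_eq_three, norm_sq_eq_three] <;> ring

/-- The vector product of two vectors orthogonal to a unit vector is a multiple of it. -/
theorem cross3_eq_smul_of_inner_eq_zero {v w q : Space3} (hq : ‖q‖ = 1)
    (hv : inner ℝ v q = 0) (hw : inner ℝ w q = 0) :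
    cross3 v w = inner ℝ q (cross3 v w) • q := by
  have hq2 : q 0 ^ 2 + q 1 ^ 2 + q 2 ^ 2 = 1 := by rw [← norm_sq_eq_three, hq]; norm_num
  rw [inner_eq_three] at hv hw
  apply space3_ext <;>
    simp only [cross3_zero, cross3_one, cross3_two, PiLp.smul_apply, smul_eq_mul, inner_eq_three]
  -- As |q| = 1, v × w - ⟨q, v × w⟩ q = q × ((v × w) × q) = ⟨v, q⟩ q × w + ⟨w, q⟩ v × q, and both
  -- inner products vanish.
  · linear_combination (-(v 1 * w 2 - v 2 * w 1)) * hq2 +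
      (-(q 2 * w 1 - q 1 * w 2)) * hv + (-(q 1 * v 2 - q 2 * v 1)) * hw
  · linear_combination (-(v 2 * w 0 - v 0 * w 2)) * hq2 +
      (-(q 0 * w 2 - q 2 * w 0)) * hv + (-(q 2 * v 0 - q 0 * v 2)) * hw
  · linear_combination (-(v 0 * w 1 - v 1 * w 0)) * hq2 +
      (-(q 1 * w 0 - q 0 * w 1)) * hv + (-(q 0 * v 1 - q 1 * v 0)) * hw

/-! ### The energy of a triple of spins -/

/-- Pythagoras along the unit vector `b`: the map x ↦ b × x kills `b` and is an isometry on its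
orthogonal complement, so the orthogonal part becomes an increment of the chirality. -/
theorem norm_sub_smul_add_sq {a b c : Space3} (hb : ‖b‖ = 1) (s : ℝ) :
    ‖a - s • b + c‖ ^ 2 =
      ‖cross3 b c - cross3 a b‖ ^ 2 + (inner ℝ a b + inner ℝ b c - s) ^ 2 := by
  have hb2 : b 0 ^ 2 + b 1 ^ 2 + b 2 ^ 2 = 1 := by rw [← norm_sq_eq_three, hb]; norm_num
  have key : ‖cross3 b (a - s • b + c)‖ ^ 2 =
      ‖a - s • b + c‖ ^ 2 - inner ℝ b (a - s • b + c) ^ 2 := by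
    rw [norm_cross3_sq, hb]; ring
  have h1 : cross3 b (a - s • b + c) = cross3 b c - cross3 a b := by
    rw [cross3_add_right, cross3_sub_right, cross3_smul_right, cross3_self, cross3_comm a b]
    simp only [smul_zero]; abel
  have h2 : inner ℝ b (a - s • b + c) = inner ℝ a b + inner ℝ b c - s := by
    rw [inner_add_right, inner_sub_right, inner_smul_right, real_inner_self_eq_norm_sq, hb,
      real_inner_comm]
    ring
  rw [h1, h2] at key
  linarith

theorem norm_sub_sq_of_unit {a b : Space3} (ha : ‖a‖ = 1) (hb : ‖b‖ = 1) :
    ‖b - a‖ ^ 2 = 2 - 2 * inner ℝ a b := by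
  rw [norm_sub_sq_real, ha, hb, real_inner_comm]
  ring

/-- The potential of the Modica-Mortola functional, up to a constant. -/
def mmPotential (w : ℝ) : ℝ := 2 * w - 2 / 3 * w ^ 3

/-! ### Rows of spins -/

/-- The normalized energy of a row of spins. -/
def rowEnergy (h : ℝ) (N : ℕ) (v : ℕ → Space3) : ℝ :=
  ∑ i ∈ Finset.range (N - 1), ‖v i - (2 - h ^ 2) • v (i + 1) + v (i + 2)‖ ^ 2 / h ^ 3

/-- The chirality of a row of spins. -/
def rowChir (h : ℝ) (v : ℕ → Space3) (i : ℕ) : Space3 := h⁻¹ • cross3 (v i) (v (i + 1))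

/-- The normalized length of the steps of a row of spins. -/
def rowStep (h : ℝ) (v : ℕ → Space3) (i : ℕ) : ℝ := ‖v (i + 1) - v i‖ / h

theorem rowStep_nonneg {h : ℝ} (hh : 0 < h) (v : ℕ → Space3) (i : ℕ) : 0 ≤ rowStep h v i := by
  unfold rowStep; positivity

theorem inner_eq_of_rowStep {h : ℝ} (hh : 0 < h) {v : ℕ → Space3} {i : ℕ}
    (h0 : ‖v i‖ = 1) (h1 : ‖v (i + 1)‖ = 1) :
    inner ℝ (v i) (v (i + 1)) = 1 - h ^ 2 * rowStep h v i ^ 2 / 2 := by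
  have := norm_sub_sq_of_unit h0 h1
  unfold rowStep
  rw [div_pow, this]
  field_simp
  ring

/-- A step of angle θ has h|z| = sin θ and hw = 2 sin(θ/2), so |z| and w differ by the factor
cos(θ/2). -/
theorem norm_rowChir_sq {h : ℝ} (hh : 0 < h) {v : ℕ → Space3} {i : ℕ}
    (h0 : ‖v i‖ = 1) (h1 : ‖v (i + 1)‖ = 1) :
    ‖rowChir h v i‖ ^ 2 = rowStep h v i ^ 2 * (1 - h ^ 2 * rowStep h v i ^ 2 / 4) := by
  unfold rowChir
  rw [norm_smul, mul_pow, norm_cross3_sq, h0, h1, inner_eq_of_rowStep hh h0 h1, norm_inv,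
    Real.norm_of_nonneg hh.le]
  field_simp
  ring

theorem norm_rowChir_le {h : ℝ} (hh : 0 < h) {v : ℕ → Space3} {i : ℕ}
    (h0 : ‖v i‖ = 1) (h1 : ‖v (i + 1)‖ = 1) : ‖rowChir h v i‖ ≤ rowStep h v i := by
  refine abs_le_of_sq_le_sq' ?_ (rowStep_nonneg hh v i) |>.2
  rw [norm_rowChir_sq hh h0 h1]
  nlinarith [sq_nonneg (rowStep h v i), sq_nonneg (h * rowStep h v i * rowStep h v i)]

/-- The Modica–Mortola density. The gradient term sees the chirality, but the well term sees the
step lengths; `abs_rowStep_sub_le` connects the two. -/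
theorem tripleEnergy_eq {h : ℝ} (hh : 0 < h) {v : ℕ → Space3} {i : ℕ}
    (h0 : ‖v i‖ = 1) (h1 : ‖v (i + 1)‖ = 1) (h2 : ‖v (i + 2)‖ = 1) :
    ‖v i - (2 - h ^ 2) • v (i + 1) + v (i + 2)‖ ^ 2 / h ^ 3 =
      ‖rowChir h v (i + 1) - rowChir h v i‖ ^ 2 / h +
        h / 4 * (2 - rowStep h v i ^ 2 - rowStep h v (i + 1) ^ 2) ^ 2 := by
  have e : rowChir h v (i + 1) - rowChir h v i =
      h⁻¹ • (cross3 (v (i + 1)) (v (i + 2)) - cross3 (v i) (v (i + 1))) := by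
    unfold rowChir; rw [smul_sub]
  rw [norm_sub_smul_add_sq h1, inner_eq_of_rowStep hh h0 h1,
    inner_eq_of_rowStep (i := i + 1) hh h1 h2, e, norm_smul, norm_inv, Real.norm_of_nonneg hh.le]
  field_simp
  ring

/-- From g² = w²(1 - h²w²/4) for g = |z| one gets g'² - g² = (w'² - w²)(1 - h²(w² + w'²)/4). It
remains to divide by w + w' ≥ g + g'. -/
theorem abs_rowStep_sub_le {h : ℝ} (hh : 0 < h) {v : ℕ → Space3} {i : ℕ}
    (h0 : ‖v i‖ = 1) (h1 : ‖v (i + 1)‖ = 1) (h2 : ‖v (i + 2)‖ = 1) :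
    (1 - h ^ 2 * (rowStep h v i ^ 2 + rowStep h v (i + 1) ^ 2) / 4) *
      |rowStep h v (i + 1) - rowStep h v i| ≤ ‖rowChir h v (i + 1) - rowChir h v i‖ := by
  have hz := norm_rowChir_sq hh h0 h1
  have hz' := norm_rowChir_sq (i := i + 1) hh h1 h2
  have hl := norm_rowChir_le hh h0 h1
  have hl' := norm_rowChir_le (i := i + 1) hh h1 h2
  have hd : |‖rowChir h v (i + 1)‖ - ‖rowChir h v i‖| ≤
    ‖rowChir h v (i + 1) - rowChir h v i‖ := abs_norm_sub_norm_le _ _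
  have hn := norm_nonneg (rowChir h v (i + 1) - rowChir h v i)
  have hw := rowStep_nonneg hh v i
  have hw' := rowStep_nonneg hh v (i + 1)
  have g0 := norm_nonneg (rowChir h v i)
  have g1 := norm_nonneg (rowChir h v (i + 1))
  set w := rowStep h v i
  set w' := rowStep h v (i + 1)
  set g := ‖rowChir h v i‖
  set g' := ‖rowChir h v (i + 1)‖
  set D := ‖rowChir h v (i + 1) - rowChir h v i‖
  set c := 1 - h ^ 2 * (w ^ 2 + w' ^ 2) / 4
  rcases (add_nonneg hw hw').eq_or_lt with h0 | hpos
  · have e1 : w = 0 := by linarith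
    have e2 : w' = 0 := by linarith
    simp [e1, e2, hn]
  · have key : |w' - w| * (w' + w) * c = (w' + w) * (c * |w' - w|) := by ring
    have h3 : c * |w' - w| * (w + w') ≤ |g' - g| * (g + g') := by
      have a1 : |c * (w' - w) * (w + w')| = |(g' - g) * (g + g')| := by
        congr 1
        simp only [c]
        linear_combination hz - hz'
      rw [abs_mul (g' - g), abs_of_nonneg (add_nonneg g0 g1)] at a1
      rw [← a1, abs_mul, abs_mul, abs_of_nonneg hpos.le]
      gcongr
      exact le_abs_self c
    have h4 : c * |w' - w| * (w + w') ≤ D * (w + w') :=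
      h3.trans (mul_le_mul hd (by linarith) (by positivity) hn)
    exact le_of_mul_le_mul_right h4 hpos

/-- The trapezoidal rule for the integral of 2(1 - w²): its value is the product that Young's
inequality extracts from the energy, and its error is cubic. -/
theorem abs_mmPotential_sub_le {w w' : ℝ} :
    |mmPotential w' - mmPotential w| ≤
      |w' - w| * |2 - w ^ 2 - w' ^ 2| + |w' - w| ^ 3 / 3 := by
  have : mmPotential w' - mmPotential w =
      (w' - w) * (2 - w ^ 2 - w' ^ 2) + (w' - w) ^ 3 / 3 := by
    unfold mmPotential; ring
  rw [this]
  refine (abs_add_le _ _).trans ?_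
  rw [abs_mul, abs_div, abs_pow]
  norm_num

/-! ### Estimates on rows of bounded energy -/

section RowEstimates

variable {h B : ℝ} {N : ℕ} {v : ℕ → Space3}

theorem rowEnergy_eq (hh : 0 < h) (hv : ∀ i ≤ N, ‖v i‖ = 1) :
    rowEnergy h N v = ∑ i ∈ Finset.range (N - 1),
      (‖rowChir h v (i + 1) - rowChir h v i‖ ^ 2 / h +
        h / 4 * (2 - rowStep h v i ^ 2 - rowStep h v (i + 1) ^ 2) ^ 2) := by
  unfold rowEnergy
  refine Finset.sum_congr rfl fun i hi => ?_
  rw [Finset.mem_range] at hi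
  exact tripleEnergy_eq hh (hv _ (by omega)) (hv _ (by omega)) (hv _ (by omega))

theorem rowEnergy_nonneg (hh : 0 < h) : 0 ≤ rowEnergy h N v := by
  unfold rowEnergy; positivity

theorem sum_norm_rowChir_sub_sq_le (hh : 0 < h) (hv : ∀ i ≤ N, ‖v i‖ = 1)
    (hB : rowEnergy h N v ≤ B) :
    ∑ i ∈ Finset.range (N - 1), ‖rowChir h v (i + 1) - rowChir h v i‖ ^ 2 ≤ h * B := by
  rw [rowEnergy_eq hh hv, Finset.sum_add_distrib, ← Finset.sum_div] at hB
  have : 0 ≤ ∑ i ∈ Finset.range (N - 1),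
    h / 4 * (2 - rowStep h v i ^ 2 - rowStep h v (i + 1) ^ 2) ^ 2 := by positivity
  have h2 := le_of_add_le_of_nonneg_left hB this
  rwa [div_le_iff₀' hh] at h2

theorem sum_potential_le (hh : 0 < h) (hv : ∀ i ≤ N, ‖v i‖ = 1)
    (hB : rowEnergy h N v ≤ B) :
    ∑ i ∈ Finset.range (N - 1), (2 - rowStep h v i ^ 2 - rowStep h v (i + 1) ^ 2) ^ 2 ≤
      4 * B / h := by
  rw [rowEnergy_eq hh hv, Finset.sum_add_distrib, ← Finset.mul_sum] at hB
  have : 0 ≤ ∑ i ∈ Finset.range (N - 1),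
    ‖rowChir h v (i + 1) - rowChir h v i‖ ^ 2 / h := by positivity
  have h2 := le_of_add_le_of_nonneg_right hB this
  rw [le_div_iff₀ hh]
  linarith

theorem norm_rowChir_sub_sq_le (hh : 0 < h) (hv : ∀ i ≤ N, ‖v i‖ = 1)
    (hB : rowEnergy h N v ≤ B) {i : ℕ} (hi : i < N - 1) :
    ‖rowChir h v (i + 1) - rowChir h v i‖ ^ 2 ≤ h * B :=
  (Finset.single_le_sum (f := fun i => ‖rowChir h v (i + 1) - rowChir h v i‖ ^ 2)
    (fun _ _ => by positivity) (Finset.mem_range.2 hi)).trans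
    (sum_norm_rowChir_sub_sq_le hh hv hB)

theorem potential_le (hh : 0 < h) (hv : ∀ i ≤ N, ‖v i‖ = 1)
    (hB : rowEnergy h N v ≤ B) {i : ℕ} (hi : i < N - 1) :
    (2 - rowStep h v i ^ 2 - rowStep h v (i + 1) ^ 2) ^ 2 ≤ 4 * B / h :=
  (Finset.single_le_sum
    (f := fun i => (2 - rowStep h v i ^ 2 - rowStep h v (i + 1) ^ 2) ^ 2)
    (fun _ _ => by positivity) (Finset.mem_range.2 hi)).trans (sum_potential_le hh hv hB)

/-- The square of the spin increments is uniformly small on rows of bounded energy. -/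
theorem sq_mul_rowStep_le (hh : 0 < h) (hv : ∀ i ≤ N, ‖v i‖ = 1)
    (hB : rowEnergy h N v ≤ B) {i : ℕ} (hi : i < N - 1) :
    h ^ 2 * (rowStep h v i ^ 2 + rowStep h v (i + 1) ^ 2) ≤ 2 * h ^ 2 + 2 * h * √(B * h) := by
  have h1 := potential_le hh hv hB hi
  set x := rowStep h v i ^ 2 + rowStep h v (i + 1) ^ 2
  have hB0 : 0 ≤ B := (rowEnergy_nonneg hh).trans hB
  have h2 : x - 2 ≤ √(4 * B / h) := by
    apply Real.le_sqrt_of_sq_le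
    calc _ = (2 - rowStep h v i ^ 2 - rowStep h v (i + 1) ^ 2) ^ 2 := by ring
      _ ≤ _ := h1
  have h3 : √(4 * B / h) * h = 2 * √(B * h) := by
    have e : 4 * B / h = (2 / h) ^ 2 * (B * h) := by field_simp; ring
    rw [e, Real.sqrt_mul (by positivity), Real.sqrt_sq (by positivity)]
    field_simp
  nlinarith [mul_le_mul_of_nonneg_left h2 (by positivity : (0:ℝ) ≤ h ^ 2)]

end RowEstimates

/-- The variation of the potential along a row is bounded by the energy, up to a small error. -/
theorem exists_sum_mmPotential_le {B ε : ℝ} (hε : 0 < ε) :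
    ∃ h₀ : ℝ, 0 < h₀ ∧ ∀ h : ℝ, 0 < h → h < h₀ → ∀ (N : ℕ) (v : ℕ → Space3),
      (∀ i ≤ N, ‖v i‖ = 1) → rowEnergy h N v ≤ B →
      ∑ i ∈ Finset.range (N - 1),
        |mmPotential (rowStep h v (i + 1)) - mmPotential (rowStep h v i)| ≤
          rowEnergy h N v + ε := by
  -- Three smallness conditions on h: the number η, which bounds h²(w² + w'²)/4, is below 1/2; the
  -- total error is below ε; its cubic part is below 1.
  have t1 : Tendsto (fun h : ℝ => (2 * h ^ 2 + 2 * h * √(B * h)) / 4) (𝓝 0) (𝓝 0) := by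
    have : Continuous fun h : ℝ => (2 * h ^ 2 + 2 * h * √(B * h)) / 4 := by fun_prop
    simpa using this.tendsto 0
  have t2 : Tendsto (fun h : ℝ => 8 / 3 * (√(h * B) * (h * B)) +
      2 * (B + 1) * ((2 * h ^ 2 + 2 * h * √(B * h)) / 4)) (𝓝 0) (𝓝 0) := by
    have : Continuous fun h : ℝ => 8 / 3 * (√(h * B) * (h * B)) +
      2 * (B + 1) * ((2 * h ^ 2 + 2 * h * √(B * h)) / 4) := by fun_prop
    simpa using this.tendsto 0
  have t3 : Tendsto (fun h : ℝ => 8 / 3 * (√(h * B) * (h * B))) (𝓝 0) (𝓝 0) := by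
    have : Continuous fun h : ℝ => 8 / 3 * (√(h * B) * (h * B)) := by fun_prop
    simpa using this.tendsto 0
  obtain ⟨h₀, h₀pos, hh₀⟩ := Metric.eventually_nhds_iff.1
    ((t1.eventually (gt_mem_nhds (show (0:ℝ) < 1 / 2 by norm_num))).and
      ((t2.eventually (gt_mem_nhds hε)).and
        (t3.eventually (gt_mem_nhds (show (0:ℝ) < 1 by norm_num)))))
  refine ⟨h₀, h₀pos, fun h hh hlt N v hv hB => ?_⟩
  obtain ⟨e1, e2, e3⟩ := hh₀ (y := h) (by rw [Real.dist_eq, sub_zero, abs_of_pos hh]; exact hlt)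
  set η := (2 * h ^ 2 + 2 * h * √(B * h)) / 4
  have hη0 : 0 ≤ η := by positivity
  have hB0 : 0 ≤ B := (rowEnergy_nonneg hh).trans hB
  have step : ∀ i ∈ Finset.range (N - 1),
      (1 - η) * |mmPotential (rowStep h v (i + 1)) - mmPotential (rowStep h v i)| ≤
        (‖rowChir h v (i + 1) - rowChir h v i‖ ^ 2 / h +
        h / 4 * (2 - rowStep h v i ^ 2 - rowStep h v (i + 1) ^ 2) ^ 2) +
        8 / 3 * (√(h * B) * ‖rowChir h v (i + 1) - rowChir h v i‖ ^ 2) := by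
    intro i hi
    rw [Finset.mem_range] at hi
    have a1 := abs_rowStep_sub_le hh (hv i (by omega)) (hv (i + 1) (by omega))
      (hv (i + 2) (by omega))
    have a2 := sq_mul_rowStep_le hh hv hB hi
    have a3 := norm_rowChir_sub_sq_le hh hv hB hi
    have a4 := abs_mmPotential_sub_le (w := rowStep h v i) (w' := rowStep h v (i + 1))
    have a5 : ‖rowChir h v (i + 1) - rowChir h v i‖ ≤ √(h * B) := Real.le_sqrt_of_sq_le a3
    have d0 := norm_nonneg (rowChir h v (i + 1) - rowChir h v i)
    set D := ‖rowChir h v (i + 1) - rowChir h v i‖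
    set w := rowStep h v i
    set w' := rowStep h v (i + 1)
    have x0 := abs_nonneg (w' - w)
    have y0 := abs_nonneg (2 - w ^ 2 - w' ^ 2)
    set x := |w' - w|
    have b1 : (1 - η) * x ≤ D := by
      refine le_trans (mul_le_mul_of_nonneg_right ?_ x0) a1
      simp only [η]
      linarith
    have b2 : x ≤ 2 * D := by nlinarith
    -- The Modica–Mortola trick: Young's inequality with weight h.
    have b3 : D * |2 - w ^ 2 - w' ^ 2| ≤ D ^ 2 / h + h / 4 * (2 - w ^ 2 - w' ^ 2) ^ 2 := by
      rw [← sq_abs (2 - w ^ 2 - w' ^ 2)]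
      have : 0 ≤ (D - h / 2 * |2 - w ^ 2 - w' ^ 2|) ^ 2 / h := by positivity
      have e : (D - h / 2 * |2 - w ^ 2 - w' ^ 2|) ^ 2 / h = D ^ 2 / h +
        h / 4 * |2 - w ^ 2 - w' ^ 2| ^ 2 - D * |2 - w ^ 2 - w' ^ 2| := by field_simp; ring
      linarith
    -- One factor of the cube is at most 2√(hB) uniformly, and the squares sum to at most hB; so the
    -- cubic errors vanish with h.
    have b4 : x ^ 3 ≤ 8 * (√(h * B) * D ^ 2) := by
      have : x ^ 3 ≤ (2 * D) ^ 3 := by gcongr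
      nlinarith [mul_le_mul_of_nonneg_right a5 (sq_nonneg D)]
    have b5 : (1 - η) * (x ^ 3 / 3) ≤ x ^ 3 / 3 := by
      have : 0 ≤ x ^ 3 / 3 := by positivity
      nlinarith
    calc (1 - η) * |mmPotential w' - mmPotential w|
        ≤ (1 - η) * (x * |2 - w ^ 2 - w' ^ 2| + x ^ 3 / 3) := by
          apply mul_le_mul_of_nonneg_left a4; linarith
      _ = ((1 - η) * x) * |2 - w ^ 2 - w' ^ 2| + (1 - η) * (x ^ 3 / 3) := by ring
      _ ≤ D * |2 - w ^ 2 - w' ^ 2| + (1 - η) * (x ^ 3 / 3) := by gcongr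
      _ ≤ _ := by linarith
  have s1 := Finset.sum_le_sum step
  rw [← Finset.mul_sum, Finset.sum_add_distrib, ← rowEnergy_eq hh hv, ← Finset.mul_sum,
    ← Finset.mul_sum] at s1
  have s2 := sum_norm_rowChir_sub_sq_le hh hv hB
  set V := ∑ i ∈ Finset.range (N - 1),
    |mmPotential (rowStep h v (i + 1)) - mmPotential (rowStep h v i)|
  have s3 : √(h * B) * ∑ i ∈ Finset.range (N - 1),
      ‖rowChir h v (i + 1) - rowChir h v i‖ ^ 2 ≤ √(h * B) * (h * B) := by gcongr
  have V0 : 0 ≤ V := by positivity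
  -- A crude bound from 1 - η > 1/2, used to absorb the term ηV.
  have s4 : V ≤ 2 * (B + 1) := by nlinarith
  nlinarith

/-- The steps of a row of bounded energy are bounded. -/
theorem exists_rowStep_le {B : ℝ} (hB0 : 0 ≤ B) :
    ∃ h₀ : ℝ, 0 < h₀ ∧ ∀ h : ℝ, 0 < h → h < h₀ → ∀ (N : ℕ) (v : ℕ → Space3),
      (∀ i ≤ N, ‖v i‖ = 1) → rowEnergy h N v ≤ B → 4 * B < ((N - 1 : ℕ) : ℝ) * h →
      ∀ i < N, rowStep h v i ≤ B + 3 := by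
  obtain ⟨h₀, h₀pos, H⟩ := exists_sum_mmPotential_le (B := B) one_pos
  refine ⟨h₀, h₀pos, fun h hh hlt N v hv hB hN i hi => ?_⟩
  have hV := (H h hh hlt N v hv hB).trans (add_le_add_left hB 1)
  have hN1 : 0 < N - 1 := by
    by_contra hc
    have : N - 1 = 0 := by omega
    rw [this] at hN
    simp at hN; linarith
  -- If every square exceeded 3, each of the N - 1 potential terms would be at least 1, against a
  -- total of at most 4B/h. This is where the row has to be long.
  obtain ⟨j, hj, hwj⟩ : ∃ j < N - 1, rowStep h v j ^ 2 ≤ 3 := by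
    by_contra! hc
    have h1 := sum_potential_le hh hv hB
    have h2 : ∑ i ∈ Finset.range (N - 1), (1 : ℝ) ≤
        ∑ i ∈ Finset.range (N - 1), (2 - rowStep h v i ^ 2 - rowStep h v (i + 1) ^ 2) ^ 2 := by
      refine Finset.sum_le_sum fun i hi => ?_
      have := hc i (Finset.mem_range.1 hi)
      nlinarith [sq_nonneg (rowStep h v (i + 1))]
    have h3 := h2.trans h1
    rw [le_div_iff₀ hh] at h3
    simp at h3
    linarith
  have tele : ∀ a b : ℕ, a ≤ b → b ≤ N - 1 →
      |mmPotential (rowStep h v b) - mmPotential (rowStep h v a)| ≤ B + 1 := by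
    intro a b hab hb
    refine le_trans ?_ hV
    rw [← Finset.sum_Ico_sub (fun i => mmPotential (rowStep h v i)) hab]
    refine (Finset.abs_sum_le_sum_abs _ _).trans ?_
    refine Finset.sum_le_sum_of_subset_of_nonneg ?_ fun _ _ _ => abs_nonneg _
    intro x hx
    rw [Finset.mem_Ico] at hx
    rw [Finset.mem_range]
    omega
  have hd : |mmPotential (rowStep h v i) - mmPotential (rowStep h v j)| ≤ B + 1 := by
    rcases le_total i j with hij | hij
    · rw [abs_sub_comm]; exact tele i j hij (by omega)
    · exact tele j i hij (by omega)
  have w0 := rowStep_nonneg hh v j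
  have w0' := rowStep_nonneg hh v i
  have p0 : 0 ≤ mmPotential (rowStep h v j) := by
    unfold mmPotential; nlinarith
  have p1 : -(B + 1) ≤ mmPotential (rowStep h v i) := by
    have := (abs_le.1 hd).1; linarith
  -- The potential is nonnegative at `j` and varies by at most B + 1, whereas 2w - 2w³/3 is below
  -- -(B + 1) once w > B + 3.
  by_contra! hc
  unfold mmPotential at p1
  nlinarith [mul_le_mul_of_nonneg_left (show (9:ℝ) ≤ rowStep h v i ^ 2 by nlinarith) w0']


/-! ### Windows of k + 1 spins and the direction of the chirality -/

section Window

variable {h R : ℝ} {N k : ℕ} {v : ℕ → Space3} {Q : Finset Space3}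

theorem norm_rowChir_sub_le_sum {a b i j : ℕ} (hi : a ≤ i) (hi' : i ≤ b) (hj : a ≤ j) (hj' : j ≤ b) :
    ‖rowChir h v i - rowChir h v j‖ ≤
      ∑ l ∈ Finset.Ico a b, ‖rowChir h v (l + 1) - rowChir h v l‖ := by
  have key : ∀ i j : ℕ, a ≤ i → i ≤ j → j ≤ b → ‖rowChir h v j - rowChir h v i‖ ≤
      ∑ l ∈ Finset.Ico a b, ‖rowChir h v (l + 1) - rowChir h v l‖ := by
    intro i j hi hij hj
    rw [← Finset.sum_Ico_sub (fun i => rowChir h v i) hij]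
    refine (norm_sum_le _ _).trans ?_
    exact Finset.sum_le_sum_of_subset_of_nonneg (Finset.Ico_subset_Ico hi hj)
      fun _ _ _ => norm_nonneg _
  rcases le_total i j with hij | hij
  · rw [norm_sub_rev]; exact key i j hi hij hj'
  · exact key j i hj hij hi'

/-- Among `k + 1` consecutive spins two lie on the same of `k` circles, and so the chirality in this
window is close to the axis of the circle. -/
theorem exists_line_of_window (hh : 0 < h) (hR0 : 0 ≤ R) (hQk : Q.card = k)
    (hQ : ∀ q ∈ Q, ‖q‖ = 1) (hc : ∀ i ≤ N, ∃ q ∈ Q, inner ℝ (v i) q = 0)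
    (hR : ∀ i < N, rowStep h v i ≤ R) {a : ℕ} (ha : a + k ≤ N) :
    ∃ q ∈ Q, ∃ t : ℝ, ∀ i, a ≤ i → i ≤ a + k → ‖rowChir h v i - t • q‖ ≤
      ∑ l ∈ Finset.Ico a (a + k), ‖rowChir h v (l + 1) - rowChir h v l‖ + k * (h * R ^ 2) := by
  choose! f hfQ hf using hc
  obtain ⟨x, hx, y, hy, hxy, hfxy⟩ := Finset.exists_ne_map_eq_of_card_lt_of_maps_to
    (s := Finset.Icc a (a + k)) (t := Q) (f := f) (by rw [Nat.card_Icc, hQk]; omega)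
    (fun i hi => hfQ i (by have := (Finset.mem_Icc.1 hi).2; omega))
  obtain ⟨i', j', hlt, hi', hj', hq⟩ : ∃ i' j' : ℕ, i' < j' ∧ a ≤ i' ∧ j' ≤ a + k ∧
      f i' = f j' := by
    rw [Finset.mem_Icc] at hx hy
    rcases lt_or_gt_of_ne hxy with hl | hl
    · exact ⟨x, y, hl, hx.1, hy.2, hfxy⟩
    · exact ⟨y, x, hl, hy.1, hx.2, hfxy.symm⟩
  have hu1 := hQ _ (hfQ i' (by omega))
  -- Both spins are orthogonal to the axis, so v_{i'} × v_{j'} is a multiple τ of it. Telescoped,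
  -- the same product is h Σ z_l up to products of two small differences of spins.
  have hcr := cross3_eq_smul_of_inner_eq_zero hu1 (hf i' (by omega))
    (hq ▸ hf j' (by omega) : inner ℝ (v j') (f i') = 0)
  set q := f i'
  set τ := inner ℝ q (cross3 (v i') (v j'))
  set m : ℝ := ((j' - i' : ℕ) : ℝ)
  have hm : 0 < m := by simp only [m]; exact_mod_cast (by omega : 0 < j' - i')
  have hmk : m ≤ k := by simp only [m]; exact_mod_cast (by omega : j' - i' ≤ k)
  have hstep : ∀ l < N, ‖v (l + 1) - v l‖ ≤ h * R := by
    intro l hl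
    have := hR l hl
    unfold rowStep at this
    rw [div_le_iff₀ hh] at this
    linarith
  have hdist : ∀ l, i' ≤ l → l ≤ j' → ‖v i' - v l‖ ≤ m * (h * R) := by
    intro l h1 h2
    rw [norm_sub_rev, ← Finset.sum_Ico_sub v h1]
    refine (norm_sum_le _ _).trans ?_
    refine (Finset.sum_le_card_nsmul _ _ (h * R) fun x hx => hstep x ?_).trans ?_
    · have := (Finset.mem_Ico.1 hx).2; omega
    · rw [nsmul_eq_mul, Nat.card_Ico]
      have : ((l - i' : ℕ) : ℝ) ≤ m := by
        simp only [m]; exact_mod_cast (by omega : l - i' ≤ j' - i')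
      have : 0 ≤ h * R := by positivity
      gcongr
  have herr : ‖h • ∑ l ∈ Finset.Ico i' j', rowChir h v l - τ • q‖ ≤ m * (m * (h * R) * (h * R)) := by
    have e : h • ∑ l ∈ Finset.Ico i' j', rowChir h v l - τ • q =
        -∑ l ∈ Finset.Ico i' j', cross3 (v i' - v l) (v (l + 1) - v l) := by
      have e1 : cross3 (v i') (v j') =
          ∑ l ∈ Finset.Ico i' j', cross3 (v i') (v (l + 1) - v l) := by
        have := Finset.sum_Ico_sub (fun l => cross3 (v i') (v l)) hlt.le
        simp only [cross3_self, sub_zero] at this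
        rw [← this]
        refine Finset.sum_congr rfl fun l _ => ?_
        rw [cross3_sub_right]
      rw [← hcr, e1, Finset.smul_sum, ← Finset.sum_sub_distrib, ← Finset.sum_neg_distrib]
      refine Finset.sum_congr rfl fun l _ => ?_
      unfold rowChir
      rw [smul_smul, mul_inv_cancel₀ hh.ne', one_smul, cross3_sub_left, cross3_sub_right (v l),
        cross3_self]
      abel
    rw [e, norm_neg]
    refine (norm_sum_le _ _).trans ?_
    refine (Finset.sum_le_card_nsmul _ _ (m * (h * R) * (h * R)) fun l hl => ?_).trans ?_
    · rw [Finset.mem_Ico] at hl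
      refine (norm_cross3_le _ _).trans ?_
      gcongr
      · exact hdist l hl.1 hl.2.le
      · exact hstep l (by omega)
    · rw [nsmul_eq_mul, Nat.card_Ico]
  -- The multiple comes from m h z_i ≈ h Σ z_l ≈ τ q.
  refine ⟨q, hfQ i' (by omega), τ / (m * h), fun i hi1 hi2 => ?_⟩
  have hs : ‖m • rowChir h v i - ∑ l ∈ Finset.Ico i' j', rowChir h v l‖ ≤
      m * ∑ l ∈ Finset.Ico a (a + k), ‖rowChir h v (l + 1) - rowChir h v l‖ := by
    have e : m • rowChir h v i - ∑ l ∈ Finset.Ico i' j', rowChir h v l =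
        ∑ l ∈ Finset.Ico i' j', (rowChir h v i - rowChir h v l) := by
      rw [Finset.sum_sub_distrib, Finset.sum_const, Nat.card_Ico]
      congr 1
      simp only [m]
      exact Nat.cast_smul_eq_nsmul ℝ _ _
    rw [e]
    refine (norm_sum_le _ _).trans ?_
    refine (Finset.sum_le_card_nsmul _ _
      (∑ l ∈ Finset.Ico a (a + k), ‖rowChir h v (l + 1) - rowChir h v l‖) fun l hl => ?_).trans
      (le_of_eq ?_)
    · rw [Finset.mem_Ico] at hl
      exact norm_rowChir_sub_le_sum hi1 hi2 (by omega) (by omega)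
    · rw [nsmul_eq_mul, Nat.card_Ico]
  set s := ∑ l ∈ Finset.Ico a (a + k), ‖rowChir h v (l + 1) - rowChir h v l‖
  have e2 : (m * h) • (rowChir h v i - (τ / (m * h)) • q) =
      h • (m • rowChir h v i - ∑ l ∈ Finset.Ico i' j', rowChir h v l) +
        (h • ∑ l ∈ Finset.Ico i' j', rowChir h v l - τ • q) := by
    rw [smul_sub, smul_sub, smul_smul, smul_smul, mul_div_cancel₀ _ (by positivity : m * h ≠ 0),
      mul_comm m h]
    abel
  have e3 : (m * h) * ‖rowChir h v i - (τ / (m * h)) • q‖ ≤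
      h * (m * s) + m * (m * (h * R) * (h * R)) := by
    have e5 : (m * h) * ‖rowChir h v i - (τ / (m * h)) • q‖ =
        ‖(m * h) • (rowChir h v i - (τ / (m * h)) • q)‖ := by
      rw [norm_smul, Real.norm_of_nonneg (by positivity : 0 ≤ m * h)]
    rw [e5, e2]
    refine (norm_add_le _ _).trans (add_le_add ?_ herr)
    rw [norm_smul, Real.norm_of_nonneg hh.le]
    gcongr
  have e4 : h * (m * s) + m * (m * (h * R) * (h * R)) = (m * h) * (s + m * (h * R ^ 2)) := by ring
  rw [e4] at e3
  refine (le_of_mul_le_mul_left e3 (by positivity)).trans ?_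
  gcongr

/-- A discrete intermediate value property. It produces two neighbouring indices, which always lie
in one common closed window. -/
theorem exists_crossing {f : ℕ → ℝ} {a b : ℕ} (hab : a < b) {y : ℝ} (hy : f b ≤ y) (hy' : y ≤ f a) :
    ∃ i, a ≤ i ∧ i < b ∧ f (i + 1) ≤ y ∧ y ≤ f i := by
  by_contra! hc
  have : ∀ n, a + 1 ≤ n → n ≤ b → y < f n := by
    intro n hn
    induction n, hn using Nat.le_induction with
    | base =>
      intro _
      by_contra! h2
      exact absurd hy' (not_le.2 (hc a le_rfl hab h2))
    | succ n hn ih =>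
      intro hnb
      by_contra! h2
      exact absurd (ih (by omega)).le (not_le.2 (hc n (by omega) (by omega) h2))
  exact absurd (this b hab le_rfl) (not_lt.2 hy)

/-- Replacing |t| by |z| costs another ρ, since the two lengths differ by at most ρ; normalizing
then divides by |z| ≥ η. -/
theorem norm_inv_smul_sub_le {z q : Space3} {t ρ η : ℝ} (hq : ‖q‖ = 1) (hη : 0 < η)
    (hz : η ≤ ‖z‖) (hρ : ‖z - t • q‖ ≤ ρ) :
    ‖‖z‖⁻¹ • z - (if 0 ≤ t then 1 else -1 : ℝ) • q‖ ≤ 2 * ρ / η := by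
  have hz0 : 0 < ‖z‖ := hη.trans_le hz
  set s : ℝ := if 0 ≤ t then 1 else -1 with hs
  have hst : s * |t| = t := by
    rw [hs]; split_ifs with h
    · rw [abs_of_nonneg h, one_mul]
    · rw [abs_of_neg (not_le.1 h)]; ring
  have hs1 : |s| = 1 := by rw [hs]; split_ifs <;> simp
  have h1 : abs (‖z‖ - |t|) ≤ ρ := by
    have := abs_norm_sub_norm_le z (t • q)
    rw [norm_smul, hq, mul_one, Real.norm_eq_abs] at this
    exact this.trans hρ
  have h2 : ‖z - (‖z‖ * s) • q‖ ≤ 2 * ρ := by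
    have e : z - (‖z‖ * s) • q = (z - t • q) + (s * (|t| - ‖z‖)) • q := by
      rw [mul_sub, hst, sub_smul, mul_comm ‖z‖ s]; abel
    rw [e]
    refine (norm_add_le _ _).trans ?_
    rw [norm_smul, hq, mul_one, Real.norm_eq_abs, abs_mul, hs1, one_mul, abs_sub_comm]
    linarith
  have e : ‖z‖⁻¹ • z - s • q = ‖z‖⁻¹ • (z - (‖z‖ * s) • q) := by
    rw [smul_sub, smul_smul, ← mul_assoc, inv_mul_cancel₀ hz0.ne', one_mul]
  rw [e, norm_smul, norm_inv, norm_norm, ← div_eq_inv_mul]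
  have : 0 ≤ ρ := (norm_nonneg _).trans hρ
  gcongr

/-- While the chirality stays away from zero, its direction hardly changes. -/
theorem norm_direction_sub_le (hh : 0 < h) (hR0 : 0 ≤ R) (hQk : Q.card = k) (hk : 0 < k)
    (hQ : ∀ q ∈ Q, ‖q‖ = 1) (hc : ∀ i ≤ N, ∃ q ∈ Q, inner ℝ (v i) q = 0)
    (hR : ∀ i < N, rowStep h v i ≤ R) {S η : ℝ} (hη : 0 < η)
    (hS : ∑ i ∈ Finset.range (N - 1), ‖rowChir h v (i + 1) - rowChir h v i‖ ^ 2 ≤ S)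
    {a b : ℕ} (hab : a ≤ b) (hb : b + k ≤ N)
    (hz : ∀ i, a ≤ i → i ≤ b → η ≤ ‖rowChir h v i‖) :
    ‖‖rowChir h v a‖⁻¹ • rowChir h v a - ‖rowChir h v b‖⁻¹ • rowChir h v b‖ ≤
      8 / η * (k * √S + k ^ 2 * (h * R ^ 2)) := by
  have hS0 : 0 ≤ S := le_trans (by positivity) hS
  rcases hab.eq_or_lt with rfl | hlt
  · rw [sub_self, norm_zero]; positivity
  -- The windows [jk, jk + k] tile the row and share their end points; the index i belongs to the
  -- window with number `i / k`.
  have win : ∀ j : ℕ, j * k + k ≤ N → ∃ q, ∃ t : ℝ, q ∈ Q ∧ ∀ i, j * k ≤ i → i ≤ j * k + k →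
      ‖rowChir h v i - t • q‖ ≤ ∑ l ∈ Finset.Ico (j * k) (j * k + k),
        ‖rowChir h v (l + 1) - rowChir h v l‖ + k * (h * R ^ 2) := by
    intro j hj
    obtain ⟨q, hq, t, ht⟩ := exists_line_of_window hh hR0 hQk hQ hc hR hj
    exact ⟨q, t, hq, ht⟩
  choose! κ t hκQ hκ using win
  set D : ℕ → ℝ := fun i => ‖rowChir h v (i + 1) - rowChir h v i‖
  -- `M q` bounds the oscillation of the chirality in every window with axis q at once. There are
  -- many windows but only k axes, so grouping by the axis makes the final sum independent of the
  -- length of the row.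
  set M : Space3 → ℝ := fun q =>
    √(k * ∑ i ∈ Finset.range (N - 1) with κ (i / k) = q, D i ^ 2)
  have hMsum : ∑ q ∈ Q, M q ≤ k * √S := by
    have h1 : (∑ q ∈ Q, M q) ^ 2 ≤ k * (k * S) := by
      refine sq_sum_le_card_mul_sum_sq.trans ?_
      rw [hQk]
      gcongr
      have e : ∀ q ∈ Q, M q ^ 2 =
          k * ∑ i ∈ Finset.range (N - 1) with κ (i / k) = q, D i ^ 2 := fun q _ =>
        Real.sq_sqrt (by positivity)
      rw [Finset.sum_congr rfl e, ← Finset.mul_sum, Finset.sum_fiberwise_eq_sum_filter]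
      gcongr
      refine le_trans ?_ hS
      exact Finset.sum_le_sum_of_subset_of_nonneg (Finset.filter_subset _ _)
        fun _ _ _ => by positivity
    have h2 := Real.le_sqrt_of_sq_le h1
    rwa [← mul_assoc, Real.sqrt_mul (by positivity), Real.sqrt_mul_self (by positivity)] at h2
  set E := ‖rowChir h v a‖⁻¹ • rowChir h v a - ‖rowChir h v b‖⁻¹ • rowChir h v b with hE
  -- Only the component of the direction along E, the difference of the two end directions, is
  -- followed; it drops by |E|² from `a` to `b`.
  set f : ℕ → ℝ := fun i => inner ℝ (‖rowChir h v i‖⁻¹ • rowChir h v i) E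
  set r : Space3 → ℝ := fun q => 2 * (M q + k * (h * R ^ 2)) / η * ‖E‖
  have hfab : f a - f b = ‖E‖ ^ 2 := by
    simp only [f]
    rw [← inner_sub_left, ← hE, real_inner_self_eq_norm_sq]
  -- Every value in between is bracketed by two neighbours of one window, both within `r q` of the
  -- same centre ±⟨q, E⟩. So 2k intervals of total length Σ 4 r(q) cover an interval of length |E|².
  have cover : Icc (f b) (f a) ⊆ ⋃ q ∈ Q, (Metric.closedBall (inner ℝ q E) (r q) ∪
      Metric.closedBall (-inner ℝ q E) (r q)) := by
    rintro y ⟨hy, hy'⟩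
    obtain ⟨i, hai, hib, hy1, hy2⟩ := exists_crossing hlt hy hy'
    set j := i / k
    have hj1 : j * k ≤ i := Nat.div_mul_le_self i k
    have hj2 : i < j * k + k := by
      have := Nat.lt_div_mul_add (a := i) hk
      exact this
    have hjN : j * k + k ≤ N := by omega
    have hwin := hκ j hjN
    have hρ : ∑ l ∈ Finset.Ico (j * k) (j * k + k), D l ≤ M (κ j) := by
      apply Real.le_sqrt_of_sq_le
      refine sq_sum_le_card_mul_sum_sq.trans ?_
      rw [Nat.card_Ico, Nat.add_sub_cancel_left]
      gcongr
      intro l hl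
      rw [Finset.mem_Ico] at hl
      rw [Finset.mem_filter, Finset.mem_range]
      refine ⟨by omega, ?_⟩
      congr 1
      exact Nat.div_eq_of_lt_le hl.1 (by rw [Nat.succ_mul]; exact hl.2)
    have close : ∀ i', j * k ≤ i' → i' ≤ j * k + k → a ≤ i' → i' ≤ b →
        |f i' - (if 0 ≤ t j then 1 else -1) * inner ℝ (κ j) E| ≤ r (κ j) := by
      intro i' h1 h2 h3 h4
      have := norm_inv_smul_sub_le (hQ _ (hκQ j hjN)) hη (hz i' h3 h4)
        ((hwin i' h1 h2).trans (add_le_add_left hρ _))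
      simp only [f, r]
      rw [← real_inner_smul_left, ← inner_sub_left]
      refine (abs_real_inner_le_norm _ _).trans ?_
      gcongr
    have c1 := abs_le.1 (close i hj1 hj2.le hai hib.le)
    have c2 := abs_le.1 (close (i + 1) (by omega) hj2 (by omega) hib)
    simp only [mem_iUnion]
    refine ⟨κ j, hκQ j hjN, ?_⟩
    rw [mem_union, Metric.mem_closedBall, Metric.mem_closedBall, Real.dist_eq, Real.dist_eq]
    split_ifs at c1 c2 with h0
    · left; rw [abs_le]; constructor <;> linarith
    · right; rw [abs_le]; constructor <;> linarith
  have M0 : ∀ q, 0 ≤ M q := fun q => Real.sqrt_nonneg _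
  have r0 : ∀ q, 0 ≤ r q := fun q =>
    mul_nonneg (div_nonneg (mul_nonneg zero_le_two (add_nonneg (M0 q)
      (by positivity : 0 ≤ (k : ℝ) * (h * R ^ 2)))) hη.le) (norm_nonneg E)
  have hsum : ∑ q ∈ Q, 4 * r q =
      8 / η * (∑ q ∈ Q, M q + k ^ 2 * (h * R ^ 2)) * ‖E‖ := by
    simp only [r]
    rw [← Finset.mul_sum, ← Finset.sum_mul, ← Finset.sum_div, ← Finset.mul_sum,
      Finset.sum_add_distrib, Finset.sum_const, hQk, nsmul_eq_mul]
    ring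
  clear_value r f M D
  have hvol : ENNReal.ofReal (f a - f b) ≤ ENNReal.ofReal (∑ q ∈ Q, 4 * r q) := by
    rw [← Real.volume_Icc, ENNReal.ofReal_sum_of_nonneg fun q _ => mul_nonneg (by norm_num) (r0 q)]
    refine (measure_mono cover).trans ((measure_biUnion_finset_le _ _).trans ?_)
    refine Finset.sum_le_sum fun q _ => (measure_union_le _ _).trans ?_
    rw [Real.volume_closedBall, Real.volume_closedBall, ← ENNReal.ofReal_add
      (mul_nonneg (by norm_num) (r0 q)) (mul_nonneg (by norm_num) (r0 q))]
    apply le_of_eq; congr 1; ring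
  have hvol := (ENNReal.ofReal_le_ofReal_iff
    (Finset.sum_nonneg fun q _ => mul_nonneg (by norm_num) (r0 q))).1 hvol
  rw [hfab] at hvol
  rw [hsum] at hvol
  have hvol2 : ‖E‖ ^ 2 ≤ 8 / η * (k * √S + k ^ 2 * (h * R ^ 2)) * ‖E‖ := by
    refine hvol.trans ?_
    gcongr
  rcases (norm_nonneg E).eq_or_lt with h0 | h0
  · rw [← h0]; positivity
  · rw [sq] at hvol2
    exact le_of_mul_le_mul_right hvol2 h0

end Window


/-! ### The scaling regime and limits of rows -/

/-- The asymptotic relations between the parameters of the model, with `h = √(2δ)`. -/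
structure IsScaling (h lam : ℕ → ℝ) (k : ℕ → ℕ) (Q : ℕ → Finset Space3) : Prop where
  h_pos : ∀ n, 0 < h n
  h_tendsto : Tendsto h atTop (𝓝 0)
  lam_pos : ∀ n, 0 < lam n
  lam_tendsto : Tendsto lam atTop (𝓝 0)
  ratio_tendsto : Tendsto (fun n => lam n / h n) atTop (𝓝 0)
  k_pos : ∀ n, 0 < k n
  k_tendsto : Tendsto (fun n => (k n : ℝ) * √(h n)) atTop (𝓝 0)
  card_eq : ∀ n, (Q n).card = k n
  norm_eq : ∀ n, ∀ q ∈ Q n, ‖q‖ = 1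

/-- A sequence of rows of spins of bounded energy. -/
structure IsRowSequence (h lam : ℕ → ℝ) (Q : ℕ → Finset Space3) (v : ℕ → ℕ → Space3)
    (B : ℝ) : Prop where
  norm_eq : ∀ n, ∀ i ≤ ⌊1 / lam n⌋₊, ‖v n i‖ = 1
  circle : ∀ n, ∀ i ≤ ⌊1 / lam n⌋₊, ∃ q ∈ Q n, inner ℝ (v n i) q = 0
  energy_le : ∀ n, rowEnergy (h n) ⌊1 / lam n⌋₊ (v n) ≤ B

theorem IsScaling.comp {h lam : ℕ → ℝ} {k : ℕ → ℕ} {Q : ℕ → Finset Space3}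
    (H : IsScaling h lam k Q) {φ : ℕ → ℕ} (hφ : StrictMono φ) :
    IsScaling (h ∘ φ) (lam ∘ φ) (k ∘ φ) (Q ∘ φ) where
  h_pos _ := H.h_pos _
  h_tendsto := H.h_tendsto.comp hφ.tendsto_atTop
  lam_pos _ := H.lam_pos _
  lam_tendsto := H.lam_tendsto.comp hφ.tendsto_atTop
  ratio_tendsto := H.ratio_tendsto.comp hφ.tendsto_atTop
  k_pos _ := H.k_pos _
  k_tendsto := H.k_tendsto.comp hφ.tendsto_atTop
  card_eq _ := H.card_eq _
  norm_eq _ := H.norm_eq _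

/-- Integrals of step functions on a grid are sums. -/
theorem lintegral_floor {lam : ℝ} (hl : 0 < lam) (f : ℕ → ℝ≥0∞) {a b : ℕ} (hab : a ≤ b) :
    ∫⁻ x in Ico (lam * a) (lam * b), f ⌊x / lam⌋₊ = ∑ i ∈ Finset.Ico a b, ENNReal.ofReal lam * f i := by
  induction b, hab using Nat.le_induction with
  | base => simp
  | succ b hab ih =>
    rw [Finset.sum_Ico_succ_top hab, ← ih]
    have e : Ico (lam * (a : ℝ)) (lam * ((b + 1 : ℕ) : ℝ)) =
        Ico (lam * (a : ℝ)) (lam * b) ∪ Ico (lam * (b : ℝ)) (lam * ((b + 1 : ℕ) : ℝ)) := by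
      rw [Ico_union_Ico_eq_Ico]
      · have : (a : ℝ) ≤ b := by exact_mod_cast hab
        gcongr
      · push_cast; nlinarith
    rw [e, lintegral_union measurableSet_Ico]
    · congr 1
      have : ∀ x ∈ Ico (lam * (b : ℝ)) (lam * ((b + 1 : ℕ) : ℝ)), f ⌊x / lam⌋₊ = f b := by
        rintro x ⟨h1, h2⟩
        congr 1
        rw [Nat.floor_eq_iff (by have : 0 ≤ lam * b := by positivity
                                 exact div_nonneg (this.trans h1) hl.le)]
        push_cast at h2
        rw [le_div_iff₀ hl, div_lt_iff₀ hl]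
        constructor <;> linarith
      rw [setLIntegral_congr_fun measurableSet_Ico this, setLIntegral_const, Real.volume_Ico, mul_comm]
      congr 2
      push_cast; ring
    · rw [Set.disjoint_left]
      rintro x ⟨_, h1⟩ ⟨h2, _⟩
      linarith

/-- A function on the line is almost everywhere constant near a point. -/
def AEConstAt {V : Type*} (ζ : ℝ → V) (t : ℝ) : Prop :=
  ∃ c, ∃ ε > 0, ∀ᵐ x : ℝ, x ∈ Ioo (t - ε) (t + ε) → ζ x = c

/-- The points of `(0,1)` near which a function is not almost everywhere constant. -/
def singularSet {V : Type*} (ζ : ℝ → V) : Set ℝ := {t | t ∈ Ioo (0 : ℝ) 1 ∧ ¬AEConstAt ζ t}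

/-- Otherwise all values on `D` near `t` would agree and ζ would be a.e. constant there. The two
points may lie on the same side of `t`. -/
theorem exists_pair_of_not_aeConstAt {V : Type*} {ζ : ℝ → V} {t ε : ℝ} (ht : ¬AEConstAt ζ t)
    (hε : 0 < ε) {D : Set ℝ} (hD : ∀ᵐ x : ℝ, x ∈ Ioo (t - ε) (t + ε) → x ∈ D) :
    ∃ x x', x ∈ D ∧ x' ∈ D ∧ t - ε < x ∧ x < x' ∧ x' < t + ε ∧ ζ x ≠ ζ x' := by
  have hne : ∃ x ∈ Ioo (t - ε) (t + ε), x ∈ D := by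
    by_contra! hc
    have h0 : volume (Ioo (t - ε) (t + ε)) = 0 := by
      refine measure_mono_null ?_ (ae_iff.1 hD)
      intro x hx
      simp only [mem_ofPred_eq, Classical.not_imp]
      exact ⟨hx, hc x hx⟩
    rw [Real.volume_Ioo, ENNReal.ofReal_eq_zero] at h0
    linarith
  obtain ⟨x, hx, hxD⟩ := hne
  by_cases hall : ∀ y ∈ Ioo (t - ε) (t + ε), y ∈ D → ζ y = ζ x
  · exact absurd ⟨ζ x, ε, hε, hD.mono fun y hy hyI => hall y hyI (hy hyI)⟩ ht
  · push Not at hall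
    obtain ⟨y, hy, hyD, hne⟩ := hall
    rcases lt_trichotomy x y with hxy | rfl | hxy
    · exact ⟨x, y, hxD, hyD, hx.1, hxy, hy.2, hne.symm⟩
    · exact absurd rfl hne
    · exact ⟨y, x, hyD, hxD, hy.1, hxy, hx.2, hne⟩

theorem exists_separation (T : Finset ℝ) (hT : ∀ t ∈ T, t ∈ Ioo (0 : ℝ) 1) :
    ∃ ε > 0, (∀ t ∈ T, ε < t ∧ t + ε < 1) ∧ ∀ t ∈ T, ∀ t' ∈ T, t < t' → t + ε < t' - ε := by
  have h1 : ∀ᶠ ε : ℝ in 𝓝[>] 0, ∀ t ∈ T, ε < t ∧ t + ε < 1 := by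
    rw [Filter.eventually_all_finset]
    intro t ht
    obtain ⟨h0, h1⟩ := hT t ht
    have a1 : ∀ᶠ ε : ℝ in 𝓝[>] 0, ε < t := nhdsWithin_le_nhds (gt_mem_nhds h0)
    have a2 : ∀ᶠ ε : ℝ in 𝓝[>] 0, ε < 1 - t := nhdsWithin_le_nhds (gt_mem_nhds (by linarith))
    filter_upwards [a1, a2] with ε h2 h3
    exact ⟨h2, by linarith⟩
  have h2 : ∀ᶠ ε : ℝ in 𝓝[>] 0, ∀ t ∈ T, ∀ t' ∈ T, t < t' → t + ε < t' - ε := by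
    rw [Filter.eventually_all_finset]
    intro t ht
    rw [Filter.eventually_all_finset]
    intro t' ht'
    by_cases hlt : t < t'
    · have a1 : ∀ᶠ ε : ℝ in 𝓝[>] 0, ε < (t' - t) / 2 :=
        nhdsWithin_le_nhds (gt_mem_nhds (by linarith))
      filter_upwards [a1] with ε h2 _
      linarith
    · exact Eventually.of_forall fun _ h => absurd h hlt
  obtain ⟨ε, ⟨h3, h4⟩, h5⟩ := ((h1.and h2).and self_mem_nhdsWithin).exists
  exact ⟨ε, h5, h3, h4⟩

section Rows

variable {h lam : ℕ → ℝ} {k : ℕ → ℕ} {Q : ℕ → Finset Space3} {v : ℕ → ℕ → Space3} {B : ℝ}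

namespace IsScaling

theorem kh_tendsto (H : IsScaling h lam k Q) : Tendsto (fun n => (k n : ℝ) * h n) atTop (𝓝 0) := by
  have h1 : Tendsto (fun n => √(h n)) atTop (𝓝 0) := by
    simpa using H.h_tendsto.sqrt
  have := H.k_tendsto.mul h1
  rw [mul_zero] at this
  refine this.congr fun n => ?_
  rw [mul_assoc, Real.mul_self_sqrt (H.h_pos n).le]

theorem lamk_tendsto (H : IsScaling h lam k Q) :
    Tendsto (fun n => lam n * k n) atTop (𝓝 0) := by
  have := H.ratio_tendsto.mul H.kh_tendsto
  rw [mul_zero] at this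
  refine this.congr fun n => ?_
  have := (H.h_pos n).ne'
  field_simp

/-- A point left of 1 has room for a whole window to its right, because λk = (λ/h)(kh) → 0. -/
theorem eventually_floor_add_le (H : IsScaling h lam k Q) {x : ℝ} (hx0 : 0 ≤ x) (hx : x < 1) :
    ∀ᶠ n in atTop, ⌊x / lam n⌋₊ + k n + 2 ≤ ⌊1 / lam n⌋₊ := by
  have h1 : Tendsto (fun n => lam n * k n + 2 * lam n) atTop (𝓝 0) := by
    simpa using H.lamk_tendsto.add (H.lam_tendsto.const_mul 2)
  filter_upwards [h1.eventually (gt_mem_nhds (by linarith : 0 < 1 - x))] with n hn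
  have hl := H.lam_pos n
  apply Nat.le_floor
  push_cast
  have h2 : (⌊x / lam n⌋₊ : ℝ) ≤ x / lam n := Nat.floor_le (by positivity)
  have h3 : x / lam n + k n + 2 ≤ 1 / lam n := by
    rw [div_add' _ _ _ hl.ne', div_add' _ _ _ hl.ne']
    gcongr
    linarith
  linarith

/-- A row is much longer than 1/h, the width of a transition. -/
theorem length_tendsto (H : IsScaling h lam k Q) :
    Tendsto (fun n => ((⌊1 / lam n⌋₊ - 1 : ℕ) : ℝ) * h n) atTop atTop := by
  have h1 : Tendsto (fun n => h n / lam n) atTop atTop := by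
    have : Tendsto (fun n => (lam n / h n)⁻¹) atTop atTop := by
      refine Tendsto.inv_tendsto_nhdsGT_zero ?_
      rw [tendsto_nhdsWithin_iff]
      exact ⟨H.ratio_tendsto, Eventually.of_forall fun n => div_pos (H.lam_pos n) (H.h_pos n)⟩
    simpa using this
  have h2 : Tendsto (fun n => h n / lam n + (-2) * h n) atTop atTop :=
    h1.atTop_add (H.h_tendsto.const_mul (-2))
  refine tendsto_atTop_mono (fun n => ?_) h2
  have h3 := Nat.lt_floor_add_one (1 / lam n)
  have h4 : (⌊1 / lam n⌋₊ : ℝ) - 1 ≤ ((⌊1 / lam n⌋₊ - 1 : ℕ) : ℝ) := by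
    have := Nat.sub_le_iff_le_add.1 (le_refl (⌊1 / lam n⌋₊ - 1))
    have h5 : (⌊1 / lam n⌋₊ : ℝ) ≤ ((⌊1 / lam n⌋₊ - 1 : ℕ) : ℝ) + 1 := by exact_mod_cast this
    linarith
  have h5 : h n / lam n + (-2) * h n = (1 / lam n - 2) * h n := by ring
  rw [h5]
  have := (H.h_pos n).le
  gcongr
  linarith

end IsScaling

theorem tendsto_zero_of_sq_le {f g : ℕ → ℝ} (hf : ∀ᶠ n in atTop, 0 ≤ f n)
    (hfg : ∀ᶠ n in atTop, f n ^ 2 ≤ g n) (hg : Tendsto g atTop (𝓝 0)) : Tendsto f atTop (𝓝 0) := by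
  have h1 : Tendsto (fun n => √(g n)) atTop (𝓝 0) := by simpa using hg.sqrt
  exact squeeze_zero' hf (hfg.mono fun n hn => Real.le_sqrt_of_sq_le hn) h1

namespace IsRowSequence

variable (H : IsScaling h lam k Q) (A : IsRowSequence h lam Q v B)
include H A

theorem nonneg : 0 ≤ B := (rowEnergy_nonneg (H.h_pos 0)).trans (A.energy_le 0)

theorem eventually_rowStep_le :
    ∀ᶠ n in atTop, ∀ i < ⌊1 / lam n⌋₊, rowStep (h n) (v n) i ≤ B + 3 := by
  obtain ⟨h₀, h₀pos, hh₀⟩ := exists_rowStep_le (A.nonneg H)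
  filter_upwards [H.h_tendsto.eventually (gt_mem_nhds h₀pos),
    H.length_tendsto.eventually (eventually_gt_atTop (4 * B))] with n h1 h2
  exact hh₀ (h n) (H.h_pos n) h1 _ (v n) (A.norm_eq n) (A.energy_le n) h2

theorem rowStep_sq_sub_tendsto {i : ℕ → ℕ} (hi : ∀ᶠ n in atTop, i n < ⌊1 / lam n⌋₊) :
    Tendsto (fun n => rowStep (h n) (v n) (i n) ^ 2 - ‖rowChir (h n) (v n) (i n)‖ ^ 2) atTop
      (𝓝 0) := by
  have h1 : Tendsto (fun n => h n ^ 2 * ((B + 3) ^ 4 / 4)) atTop (𝓝 0) := by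
    simpa using (H.h_tendsto.pow 2).mul_const ((B + 3) ^ 4 / 4)
  refine squeeze_zero' ?_ ?_ h1
  · filter_upwards [hi] with n hn
    have := norm_rowChir_le (H.h_pos n) (A.norm_eq n (i n) hn.le) (A.norm_eq n (i n + 1) hn)
    have : ‖rowChir (h n) (v n) (i n)‖ ^ 2 ≤ rowStep (h n) (v n) (i n) ^ 2 := by gcongr
    linarith
  · filter_upwards [hi, A.eventually_rowStep_le H] with n hn hR
    rw [norm_rowChir_sq (H.h_pos n) (A.norm_eq n (i n) hn.le) (A.norm_eq n (i n + 1) hn)]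
    have h2 := hR _ hn
    have h3 := rowStep_nonneg (H.h_pos n) (v n) (i n)
    have : rowStep (h n) (v n) (i n) ^ 4 ≤ (B + 3) ^ 4 := by gcongr
    nlinarith [sq_nonneg (h n)]

theorem rowStep_sq_tendsto {i : ℕ → ℕ} (hi : ∀ᶠ n in atTop, i n < ⌊1 / lam n⌋₊) {p : Space3}
    (hp : Tendsto (fun n => rowChir (h n) (v n) (i n)) atTop (𝓝 p)) :
    Tendsto (fun n => rowStep (h n) (v n) (i n) ^ 2) atTop (𝓝 (‖p‖ ^ 2)) := by
  have := (A.rowStep_sq_sub_tendsto H hi).add (hp.norm.pow 2)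
  simpa using this

theorem rowStep_tendsto {i : ℕ → ℕ} (hi : ∀ᶠ n in atTop, i n < ⌊1 / lam n⌋₊) {p : Space3}
    (hp : Tendsto (fun n => rowChir (h n) (v n) (i n)) atTop (𝓝 p)) :
    Tendsto (fun n => rowStep (h n) (v n) (i n)) atTop (𝓝 ‖p‖) := by
  have := (A.rowStep_sq_tendsto H hi hp).sqrt
  rw [Real.sqrt_sq (norm_nonneg p)] at this
  exact this.congr fun n => Real.sqrt_sq (rowStep_nonneg (H.h_pos n) _ _)

theorem rowChir_succ_tendsto {i : ℕ → ℕ} (hi : ∀ᶠ n in atTop, i n < ⌊1 / lam n⌋₊ - 1) {p : Space3}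
    (hp : Tendsto (fun n => rowChir (h n) (v n) (i n)) atTop (𝓝 p)) :
    Tendsto (fun n => rowChir (h n) (v n) (i n + 1)) atTop (𝓝 p) := by
  have h1 : Tendsto (fun n => ‖rowChir (h n) (v n) (i n + 1) - rowChir (h n) (v n) (i n)‖) atTop
      (𝓝 0) := by
    refine tendsto_zero_of_sq_le (g := fun n => h n * B) (Eventually.of_forall fun n =>
      norm_nonneg _) ?_ (by simpa using H.h_tendsto.mul_const B)
    filter_upwards [hi] with n hn
    exact norm_rowChir_sub_sq_le (H.h_pos n) (A.norm_eq n) (A.energy_le n) hn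
  have := hp.add (tendsto_zero_iff_norm_tendsto_zero.2 h1)
  simpa using this

/-- By Cauchy–Schwarz over k steps the sum is at most √(k h B), and kh → 0. -/
theorem window_error_tendsto {a : ℕ → ℕ} (ha : ∀ᶠ n in atTop, a n + k n ≤ ⌊1 / lam n⌋₊ - 1) :
    Tendsto (fun n => ∑ l ∈ Finset.Ico (a n) (a n + k n),
      ‖rowChir (h n) (v n) (l + 1) - rowChir (h n) (v n) l‖ + k n * (h n * (B + 3) ^ 2)) atTop
      (𝓝 0) := by
  have h1 : Tendsto (fun n => (k n : ℝ) * (h n * B)) atTop (𝓝 0) := by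
    simpa [mul_assoc] using H.kh_tendsto.mul_const B
  have h2 : Tendsto (fun n => (k n : ℝ) * (h n * (B + 3) ^ 2)) atTop (𝓝 0) := by
    simpa [mul_assoc] using H.kh_tendsto.mul_const ((B + 3) ^ 2)
  rw [← add_zero (0 : ℝ)]
  refine Tendsto.add ?_ h2
  refine tendsto_zero_of_sq_le (g := fun n => k n * (h n * B)) (Eventually.of_forall fun n =>
    by positivity) ?_ h1
  filter_upwards [ha] with n hn
  refine sq_sum_le_card_mul_sum_sq.trans ?_
  rw [Nat.card_Ico, Nat.add_sub_cancel_left]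
  gcongr
  refine le_trans ?_ (sum_norm_rowChir_sub_sq_le (H.h_pos n) (A.norm_eq n) (A.energy_le n))
  refine Finset.sum_le_sum_of_subset_of_nonneg ?_ fun _ _ _ => by positivity
  intro l hl
  rw [Finset.mem_Ico] at hl
  rw [Finset.mem_range]
  omega

/-- Limits of the chirality that are unit vectors are limits of axes. -/
theorem mem_of_rowChir_tendsto {Qbar : Set Space3}
    (hQbar : ∀ x : ℕ → Space3, (∀ n, x n ∈ Q n) → ∀ a, MapClusterPt a atTop x → a ∈ Qbar)
    {a : ℕ → ℕ} (ha : ∀ᶠ n in atTop, a n + k n ≤ ⌊1 / lam n⌋₊ - 1) {p : Space3} (hp1 : ‖p‖ = 1)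
    (hp : Tendsto (fun n => rowChir (h n) (v n) (a n)) atTop (𝓝 p)) :
    p ∈ Qbar ∪ {q | -q ∈ Qbar} := by
  have hne : ∀ n, ∃ q, q ∈ Q n := fun n =>
    Finset.card_pos.1 ((H.card_eq n).symm ▸ H.k_pos n)
  -- The estimate is available for large n only; for the other n any axis with the factor 0 keeps
  -- the choice total.
  have win : ∀ n, ∃ q ∈ Q n, ∃ t : ℝ, (a n + k n ≤ ⌊1 / lam n⌋₊ - 1 ∧
      ∀ i < ⌊1 / lam n⌋₊, rowStep (h n) (v n) i ≤ B + 3) →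
      ‖rowChir (h n) (v n) (a n) - t • q‖ ≤ ∑ l ∈ Finset.Ico (a n) (a n + k n),
      ‖rowChir (h n) (v n) (l + 1) - rowChir (h n) (v n) l‖ + k n * (h n * (B + 3) ^ 2) := by
    intro n
    by_cases hc : a n + k n ≤ ⌊1 / lam n⌋₊ - 1 ∧
      ∀ i < ⌊1 / lam n⌋₊, rowStep (h n) (v n) i ≤ B + 3
    · obtain ⟨q, hq, t, ht⟩ := exists_line_of_window (H.h_pos n)
        (by linarith [A.nonneg H] : 0 ≤ B + 3) (H.card_eq n) (H.norm_eq n) (A.circle n) hc.2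
        (a := a n) (by omega)
      exact ⟨q, hq, t, fun _ => ht _ le_rfl (by omega)⟩
    · obtain ⟨q, hq⟩ := hne n
      exact ⟨q, hq, 0, fun hc' => absurd hc' hc⟩
  choose q hqQ t ht using win
  set s : ℕ → ℝ := fun n => if 0 ≤ t n then 1 else -1 with hs
  have hsq : Tendsto (fun n => s n • q n) atTop (𝓝 p) := by
    have e0 := A.window_error_tendsto H ha
    have e1 : Tendsto (fun n => ‖rowChir (h n) (v n) (a n)‖⁻¹ • rowChir (h n) (v n) (a n)) atTop
        (𝓝 p) := by
      have := (hp.norm.inv₀ (by rw [hp1]; norm_num)).smul hp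
      rwa [hp1, inv_one, one_smul] at this
    have e2 : ∀ᶠ n in atTop, (1 / 2 : ℝ) ≤ ‖rowChir (h n) (v n) (a n)‖ :=
      hp.norm.eventually (by rw [hp1]; exact le_mem_nhds (by norm_num))
    have e3 : Tendsto (fun n => ‖rowChir (h n) (v n) (a n)‖⁻¹ • rowChir (h n) (v n) (a n) -
        s n • q n) atTop (𝓝 0) := by
      have e0' := (e0.const_mul 2).div_const (1 / 2 : ℝ)
      rw [mul_zero, zero_div] at e0'
      refine squeeze_zero_norm' ?_ e0'
      filter_upwards [e2, ha, A.eventually_rowStep_le H] with n h2 h3 h4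
      exact norm_inv_smul_sub_le (H.norm_eq n _ (hqQ n)) (by norm_num) h2 (ht n ⟨h3, h4⟩)
    have := e1.sub e3
    simpa using this
  -- If the sign + occurs infinitely often, p is a cluster point of the axes; otherwise -p is their
  -- limit.
  by_cases hf : ∃ᶠ n in atTop, s n = 1
  · left
    refine hQbar q hqQ p ?_
    rw [mapClusterPt_iff_frequently]
    intro U hU
    refine (hf.and_eventually (hsq.eventually hU)).mono ?_
    rintro n ⟨h1, h2⟩
    rwa [h1, one_smul] at h2
  · right
    rw [not_frequently] at hf
    refine hQbar q hqQ (-p) ?_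
    refine (Tendsto.congr' ?_ hsq.neg).mapClusterPt
    filter_upwards [hf] with n hn
    have : s n = -1 := by
      simp only [hs] at hn ⊢
      split_ifs at hn ⊢ <;> simp_all
    rw [this]; simp

/-- Between two places with different directions of the chirality, it gets close to zero. -/
theorem eventually_exists_norm_lt {a b : ℕ → ℕ} (hab : ∀ n, a n ≤ b n)
    (hb : ∀ᶠ n in atTop, b n + k n ≤ ⌊1 / lam n⌋₊) {p p' : Space3} (hp1 : ‖p‖ = 1)
    (hp1' : ‖p'‖ = 1) (hne : p ≠ p')
    (hp : Tendsto (fun n => rowChir (h n) (v n) (a n)) atTop (𝓝 p))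
    (hp' : Tendsto (fun n => rowChir (h n) (v n) (b n)) atTop (𝓝 p')) {η : ℝ} (hη : 0 < η) :
    ∀ᶠ n in atTop, ∃ i, a n ≤ i ∧ i ≤ b n ∧ ‖rowChir (h n) (v n) i‖ < η := by
  have dir : ∀ {p : Space3} {a : ℕ → ℕ}, ‖p‖ = 1 →
      Tendsto (fun n => rowChir (h n) (v n) (a n)) atTop (𝓝 p) →
      Tendsto (fun n => ‖rowChir (h n) (v n) (a n)‖⁻¹ • rowChir (h n) (v n) (a n)) atTop
        (𝓝 p) := by
    intro p a hp1 hp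
    have := (hp.norm.inv₀ (by rw [hp1]; norm_num)).smul hp
    rwa [hp1, inv_one, one_smul] at this
  have e1 := ((dir hp1 hp).sub (dir hp1' hp')).norm
  -- The bound of `norm_direction_sub_le` with S = hB. Both terms are controlled by k√h, so this is
  -- the place that needs kδ^{1/4} → 0 and not merely kh → 0.
  have e2 : Tendsto (fun n => 8 / η * (k n * √(h n * B) + k n ^ 2 * (h n * (B + 3) ^ 2))) atTop
      (𝓝 0) := by
    have f1 : Tendsto (fun n => (k n : ℝ) * √(h n) * √B) atTop (𝓝 0) := by
      simpa using H.k_tendsto.mul_const √B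
    have f2 : Tendsto (fun n => ((k n : ℝ) * √(h n)) ^ 2 * (B + 3) ^ 2) atTop (𝓝 0) := by
      simpa using (H.k_tendsto.pow 2).mul_const ((B + 3) ^ 2)
    have := (f1.add f2).const_mul (8 / η)
    simp only [add_zero, mul_zero] at this
    refine this.congr fun n => ?_
    rw [Real.sqrt_mul (H.h_pos n).le, mul_pow, Real.sq_sqrt (H.h_pos n).le]
    ring
  have hpos : 0 < ‖p - p'‖ := norm_pos_iff.2 (sub_ne_zero.2 hne)
  filter_upwards [e1.eventually (lt_mem_nhds (half_lt_self hpos)),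
    e2.eventually (gt_mem_nhds (half_pos hpos)), hb, A.eventually_rowStep_le H] with n h1 h2 h3 h4
  by_contra! hc
  have := norm_direction_sub_le (H.h_pos n) (by linarith [A.nonneg H]) (H.card_eq n) (H.k_pos n)
    (H.norm_eq n) (A.circle n) h4 hη
    (sum_norm_rowChir_sub_sq_le (H.h_pos n) (A.norm_eq n) (A.energy_le n)) (hab n) h3 hc
  linarith

/-- The limit of the chirality of rows of bounded energy has norm one. -/
theorem ae_norm_eq_one {ζ : ℝ → Space3}
    (hζ : ∀ᵐ x : ℝ, x ∈ Ioo (0 : ℝ) 1 →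
      Tendsto (fun n => rowChir (h n) (v n) ⌊x / lam n⌋₊) atTop (𝓝 (ζ x))) :
    ∀ᵐ x : ℝ, x ∈ Ioo (0 : ℝ) 1 → ‖ζ x‖ = 1 := by
  -- The well term as a step function on (0, 1). Its integral is at most (λ/h) · 4B → 0, and Fatou's
  -- lemma shows that its limit (2 - 2|ζ|²)² vanishes almost everywhere.
  set g : ℕ → ℕ → ℝ≥0∞ := fun n i => if i < ⌊1 / lam n⌋₊ - 1 then
    ENNReal.ofReal ((2 - rowStep (h n) (v n) i ^ 2 - rowStep (h n) (v n) (i + 1) ^ 2) ^ 2) else 0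
  have hint : ∀ n, ∫⁻ x in Ioo (0 : ℝ) 1, g n ⌊x / lam n⌋₊ ≤
      ENNReal.ofReal (lam n / h n * (4 * B)) := by
    intro n
    have hl := H.lam_pos n
    have hsub : Ioo (0 : ℝ) 1 ⊆ Ico (lam n * ((0 : ℕ) : ℝ)) (lam n * ((⌊1 / lam n⌋₊ + 1 : ℕ) : ℝ)) := by
      rintro x ⟨h0, h1⟩
      have := Nat.lt_floor_add_one (1 / lam n)
      rw [div_lt_iff₀ hl] at this
      push_cast
      refine ⟨by simpa using h0.le, by linarith⟩
    refine (lintegral_mono_set hsub).trans ?_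
    rw [lintegral_floor hl (g n) (Nat.zero_le _), ← Finset.mul_sum]
    have e : ∑ i ∈ Finset.Ico 0 (⌊1 / lam n⌋₊ + 1), g n i =
        ENNReal.ofReal (∑ i ∈ Finset.range (⌊1 / lam n⌋₊ - 1),
          (2 - rowStep (h n) (v n) i ^ 2 - rowStep (h n) (v n) (i + 1) ^ 2) ^ 2) := by
      rw [ENNReal.ofReal_sum_of_nonneg fun _ _ => by positivity]
      simp only [g]
      rw [← Finset.sum_filter]
      refine Finset.sum_congr ?_ fun _ _ => rfl
      ext i
      simp only [Finset.mem_filter, Finset.mem_Ico, Finset.mem_range]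
      omega
    rw [e, ← ENNReal.ofReal_mul hl.le]
    apply ENNReal.ofReal_le_ofReal
    calc _ ≤ lam n * (4 * B / h n) := by
          gcongr
          exact sum_potential_le (H.h_pos n) (A.norm_eq n) (A.energy_le n)
      _ = _ := by ring
  have hmeas : ∀ n, Measurable fun x : ℝ => g n ⌊x / lam n⌋₊ := fun n =>
    (measurable_from_nat (f := g n)).comp (Nat.measurable_floor.comp (measurable_id.div_const _))
  have hlim : Tendsto (fun n => ENNReal.ofReal (lam n / h n * (4 * B))) atTop (𝓝 0) := by
    simpa using ENNReal.tendsto_ofReal (H.ratio_tendsto.mul_const (4 * B))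
  have hzero : ∫⁻ x in Ioo (0 : ℝ) 1, liminf (fun n => g n ⌊x / lam n⌋₊) atTop = 0 := by
    refine le_antisymm ((lintegral_liminf_le hmeas).trans ?_) zero_le
    refine (liminf_le_liminf (Eventually.of_forall hint)).trans ?_
    rw [hlim.liminf_eq]
  rw [lintegral_eq_zero_iff (.liminf hmeas), EventuallyEq, ae_restrict_iff' measurableSet_Ioo]
    at hzero
  filter_upwards [hzero, hζ] with x h0 hx hxI
  have hx := hx hxI
  have h0 := h0 hxI
  have hfl := H.eventually_floor_add_le hxI.1.le hxI.2
  have h1 := A.rowStep_sq_tendsto H (hfl.mono fun n hn => by omega) hx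
  have h2 := A.rowStep_sq_tendsto H (i := fun n => ⌊x / lam n⌋₊ + 1)
    (hfl.mono fun n hn => by have := H.k_pos n; omega)
    (A.rowChir_succ_tendsto H (hfl.mono fun n hn => by have := H.k_pos n; omega) hx)
  have h3 := ENNReal.tendsto_ofReal (((h1.const_sub 2).sub h2).pow 2)
  have h4 : Tendsto (fun n => g n ⌊x / lam n⌋₊) atTop
      (𝓝 (ENNReal.ofReal ((2 - ‖ζ x‖ ^ 2 - ‖ζ x‖ ^ 2) ^ 2))) := by
    refine h3.congr' ?_
    filter_upwards [hfl] with n hn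
    simp only [g]
    rw [if_pos (by have := H.k_pos n; omega)]
  rw [h4.liminf_eq] at h0
  simp only [Pi.zero_apply, ENNReal.ofReal_eq_zero] at h0
  have h5 : 2 - ‖ζ x‖ ^ 2 - ‖ζ x‖ ^ 2 = 0 := by
    have := le_antisymm h0 (sq_nonneg _)
    exact pow_eq_zero_iff (two_ne_zero) |>.1 this
  have h6 : ‖ζ x‖ ^ 2 = 1 := by linarith
  exact (pow_eq_one_iff_of_nonneg (norm_nonneg _) two_ne_zero).1 h6

/-- The number of jumps of the limit is bounded by the energy. -/
theorem card_le_of_subset_singularSet {ζ : ℝ → Space3}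
    (hζ : ∀ᵐ x : ℝ, x ∈ Ioo (0 : ℝ) 1 →
      Tendsto (fun n => rowChir (h n) (v n) ⌊x / lam n⌋₊) atTop (𝓝 (ζ x)))
    {T : Finset ℝ} (hT : (T : Set ℝ) ⊆ singularSet ζ) : 8 / 3 * (T.card : ℝ) ≤ B := by
  obtain ⟨ε, hε, hε1, hε2⟩ := exists_separation T fun t ht => (hT ht).1
  have hD := hζ.and (A.ae_norm_eq_one H hζ)
  -- Close to each singular point two points of convergence with different unit limits are chosen;
  -- the separation ε keeps the intervals between them disjoint.
  have pairs : ∀ t ∈ T, ∃ x x', x ∈ Ioo (0 : ℝ) 1 ∧ x' ∈ Ioo (0 : ℝ) 1 ∧ t - ε < x ∧ x < x' ∧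
      x' < t + ε ∧ ζ x ≠ ζ x' ∧ ‖ζ x‖ = 1 ∧ ‖ζ x'‖ = 1 ∧
      Tendsto (fun n => rowChir (h n) (v n) ⌊x / lam n⌋₊) atTop (𝓝 (ζ x)) ∧
      Tendsto (fun n => rowChir (h n) (v n) ⌊x' / lam n⌋₊) atTop (𝓝 (ζ x')) := by
    intro t ht
    obtain ⟨e1, e2⟩ := hε1 t ht
    obtain ⟨x, x', hx, hx', h1, h2, h3, h4⟩ := exists_pair_of_not_aeConstAt (hT ht).2 hε
      (hD.mono fun x hx hxI => (⟨⟨by linarith [hxI.1], by linarith [hxI.2]⟩, hx⟩ :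
        x ∈ {x | x ∈ Ioo (0 : ℝ) 1 ∧ _}))
    exact ⟨x, x', hx.1, hx'.1, h1, h2, h3, h4, hx.2.2 hx.1, hx'.2.2 hx'.1, hx.2.1 hx.1,
      hx'.2.1 hx'.1⟩
  choose! x x' hx01 hx01' hx1 hx2 hx3 hx4 hx5 hx6 hx7 hx8 using pairs
  have main : ∀ η : ℝ, 0 < η → 8 / 3 * (T.card : ℝ) ≤ B + (10 * T.card + 1) * η := by
    intro η hη
    obtain ⟨h₀, h₀pos, hV⟩ := exists_sum_mmPotential_le (B := B) hη
    have cont : Tendsto mmPotential (𝓝 1) (𝓝 (4 / 3)) := by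
      have : Continuous mmPotential := by unfold mmPotential; fun_prop
      convert this.tendsto 1 using 2
      unfold mmPotential; norm_num
    -- The potential exceeds 4/3 - η at both ends and is at most 4η somewhere in between, so its
    -- variation is at least 2(4/3 - 5η).
    have local_bound : ∀ t ∈ T, ∀ᶠ n in atTop, 8 / 3 - 10 * η ≤
        ∑ i ∈ Finset.Ico ⌊x t / lam n⌋₊ ⌊x' t / lam n⌋₊,
          |mmPotential (rowStep (h n) (v n) (i + 1)) - mmPotential (rowStep (h n) (v n) i)| := by
      intro t ht
      have hfl := H.eventually_floor_add_le (hx01 t ht).1.le (hx01 t ht).2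
      have hfl' := H.eventually_floor_add_le (hx01' t ht).1.le (hx01' t ht).2
      have hmono : ∀ n, ⌊x t / lam n⌋₊ ≤ ⌊x' t / lam n⌋₊ := fun n => by
        have := H.lam_pos n
        have := hx2 t ht
        gcongr
      have w1 := A.rowStep_tendsto H (hfl.mono fun n hn => by omega) (hx7 t ht)
      have w2 := A.rowStep_tendsto H (hfl'.mono fun n hn => by omega) (hx8 t ht)
      rw [hx5 t ht] at w1
      rw [hx6 t ht] at w2
      -- Once this is below 3η², |z| < η gives w² = |z|² + h²w⁴/4 ≤ 4η².
      have sm : Tendsto (fun n => h n ^ 2 * ((B + 3) ^ 4 / 4)) atTop (𝓝 0) := by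
        simpa using (H.h_tendsto.pow 2).mul_const ((B + 3) ^ 4 / 4)
      filter_upwards [(cont.comp w1).eventually (lt_mem_nhds (by linarith : 4 / 3 - η < 4 / 3)),
        (cont.comp w2).eventually (lt_mem_nhds (by linarith : 4 / 3 - η < 4 / 3)),
        A.eventually_exists_norm_lt H hmono (hfl'.mono fun n hn => by omega) (hx5 t ht) (hx6 t ht)
          (hx4 t ht) (hx7 t ht) (hx8 t ht) hη, hfl', A.eventually_rowStep_le H,
        sm.eventually (gt_mem_nhds (by positivity : 0 < 3 * η ^ 2))] with n a1 a2 a3 a4 a5 a6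
      obtain ⟨c, hc1, hc2, hc3⟩ := a3
      have hc4 : c < ⌊1 / lam n⌋₊ := by omega
      have hwc : mmPotential (rowStep (h n) (v n) c) ≤ 4 * η := by
        have b1 := norm_rowChir_sq (H.h_pos n) (A.norm_eq n c hc4.le) (A.norm_eq n (c + 1) hc4)
        have b2 := a5 c hc4
        have b3 := rowStep_nonneg (H.h_pos n) (v n) c
        have b4 : rowStep (h n) (v n) c ^ 4 ≤ (B + 3) ^ 4 := by gcongr
        have b5 : ‖rowChir (h n) (v n) c‖ ^ 2 ≤ η ^ 2 := by gcongr
        have b6 : rowStep (h n) (v n) c ^ 2 ≤ (2 * η) ^ 2 := by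
          nlinarith [mul_le_mul_of_nonneg_left b4 (sq_nonneg (h n))]
        have b7 : rowStep (h n) (v n) c ≤ 2 * η := abs_le_of_sq_le_sq' b6 (by positivity) |>.2
        unfold mmPotential
        have : 0 ≤ rowStep (h n) (v n) c ^ 3 := by positivity
        linarith
      have tele : ∀ a b : ℕ, a ≤ b →
          |mmPotential (rowStep (h n) (v n) b) - mmPotential (rowStep (h n) (v n) a)| ≤
          ∑ i ∈ Finset.Ico a b,
          |mmPotential (rowStep (h n) (v n) (i + 1)) - mmPotential (rowStep (h n) (v n) i)| := by
        intro a b hab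
        rw [← Finset.sum_Ico_sub (fun i => mmPotential (rowStep (h n) (v n) i)) hab]
        exact Finset.abs_sum_le_sum_abs _ _
      rw [← Finset.sum_Ico_consecutive _ hc1 hc2]
      have t1 := (abs_le.1 (tele _ _ hc1)).1
      have t2 := (le_abs_self _).trans (tele _ _ hc2)
      simp only [Function.comp_apply] at a1 a2
      linarith
    have hx'1 : ∀ t ∈ T, ∀ᶠ n in atTop, ⌊x' t / lam n⌋₊ + k n + 2 ≤ ⌊1 / lam n⌋₊ := fun t ht =>
      H.eventually_floor_add_le (hx01' t ht).1.le (hx01' t ht).2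
    obtain ⟨n, hn1, hn2, hn3⟩ := (((Filter.eventually_all_finset T).2 local_bound).and
      (((Filter.eventually_all_finset T).2 hx'1).and
        (H.h_tendsto.eventually (gt_mem_nhds h₀pos)))).exists
    have hVn := hV (h n) (H.h_pos n) hn3 _ (v n) (A.norm_eq n) (A.energy_le n)
    have hsum := Finset.sum_le_sum hn1
    rw [Finset.sum_const, nsmul_eq_mul, ← Finset.sum_biUnion] at hsum
    · have hle : ∑ i ∈ T.biUnion fun t => Finset.Ico ⌊x t / lam n⌋₊ ⌊x' t / lam n⌋₊,
          |mmPotential (rowStep (h n) (v n) (i + 1)) - mmPotential (rowStep (h n) (v n) i)| ≤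
          ∑ i ∈ Finset.range (⌊1 / lam n⌋₊ - 1),
          |mmPotential (rowStep (h n) (v n) (i + 1)) - mmPotential (rowStep (h n) (v n) i)| := by
        refine Finset.sum_le_sum_of_subset_of_nonneg ?_ fun _ _ _ => abs_nonneg _
        intro i hi
        rw [Finset.mem_biUnion] at hi
        obtain ⟨t, ht, hi⟩ := hi
        rw [Finset.mem_Ico] at hi
        rw [Finset.mem_range]
        have := hn2 t ht
        omega
      have := A.energy_le n
      nlinarith
    · intro t ht t' ht' hne
      have key : ∀ t ∈ T, ∀ t' ∈ T, t < t' → ⌊x' t / lam n⌋₊ ≤ ⌊x t' / lam n⌋₊ := by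
        intro t ht t' ht' hlt
        have h1 := hε2 t ht t' ht' hlt
        have h2 := hx3 t ht
        have h3 := hx1 t' ht'
        have := H.lam_pos n
        have : x' t ≤ x t' := by linarith
        gcongr
      simp only [Function.onFun]
      rw [Finset.disjoint_left]
      intro i hi hi'
      rw [Finset.mem_Ico] at hi hi'
      rcases lt_or_gt_of_ne hne with hlt | hlt
      · have := key t ht t' ht' hlt; omega
      · have := key t' ht' t ht hlt; omega
  by_contra! hc
  have hpos : (0 : ℝ) < 10 * T.card + 1 := by positivity
  -- With this η the error term is half of the supposed excess.
  have := main ((8 / 3 * (T.card : ℝ) - B) / (2 * (10 * T.card + 1)))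
    (by have : 0 < 8 / 3 * (T.card : ℝ) - B := by linarith
        positivity)
  have e : (10 * (T.card : ℝ) + 1) * ((8 / 3 * (T.card : ℝ) - B) / (2 * (10 * T.card + 1))) =
    (8 / 3 * (T.card : ℝ) - B) / 2 := by field_simp
  rw [e] at this
  linarith

theorem finite_singularSet {ζ : ℝ → Space3}
    (hζ : ∀ᵐ x : ℝ, x ∈ Ioo (0 : ℝ) 1 →
      Tendsto (fun n => rowChir (h n) (v n) ⌊x / lam n⌋₊) atTop (𝓝 (ζ x))) :
    (singularSet ζ).Finite ∧ 8 / 3 * ((singularSet ζ).ncard : ℝ) ≤ B := by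
  have fin : (singularSet ζ).Finite := by
    by_contra hc
    obtain ⟨T, hT, hcard⟩ := Set.Infinite.exists_subset_card_eq hc (⌊B⌋₊ + 1)
    have h1 := A.card_le_of_subset_singularSet H hζ hT
    rw [hcard] at h1
    have h2 := Nat.lt_floor_add_one B
    have h3 := A.nonneg H
    push_cast at h1
    linarith
  refine ⟨fin, ?_⟩
  rw [Set.ncard_eq_toFinset_card _ fin]
  exact A.card_le_of_subset_singularSet H hζ (by simp)

theorem ae_mem {Qbar : Set Space3}
    (hQbar : ∀ x : ℕ → Space3, (∀ n, x n ∈ Q n) → ∀ a, MapClusterPt a atTop x → a ∈ Qbar)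
    {ζ : ℝ → Space3}
    (hζ : ∀ᵐ x : ℝ, x ∈ Ioo (0 : ℝ) 1 →
      Tendsto (fun n => rowChir (h n) (v n) ⌊x / lam n⌋₊) atTop (𝓝 (ζ x))) :
    ∀ᵐ x : ℝ, x ∈ Ioo (0 : ℝ) 1 → ζ x ∈ Qbar ∪ {q | -q ∈ Qbar} := by
  filter_upwards [hζ, A.ae_norm_eq_one H hζ] with x h1 h2 hx
  exact A.mem_of_rowChir_tendsto H hQbar
    ((H.eventually_floor_add_le hx.1.le hx.2).mono fun n hn => by omega) (h2 hx) (h1 hx)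

end IsRowSequence

end Rows


/-! ### Neighbouring rows turn about the same axis -/

/-- The triple product (v × w) × v = w - ⟨v, w⟩ v exhibits a step as an infinitesimal rotation about
z with a radial correction of order h². -/
theorem sub_eq_cross3_rowChir {h : ℝ} (hh : 0 < h) {u : ℕ → Space3} {i : ℕ}
    (h0 : ‖u i‖ = 1) (h1 : ‖u (i + 1)‖ = 1) :
    u (i + 1) - u i =
      h • cross3 (rowChir h u i) (u i) - (h ^ 2 * rowStep h u i ^ 2 / 2) • u i := by
  unfold rowChir
  rw [cross3_smul_left, smul_smul, mul_inv_cancel₀ hh.ne', one_smul, cross3_cross3_left, h0,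
    inner_eq_of_rowStep hh h0 h1, sub_smul]
  simp only [one_pow, one_smul]
  abel

theorem inner_rowChir (h : ℝ) (u : ℕ → Space3) (i : ℕ) : inner ℝ (rowChir h u i) (u i) = 0 := by
  unfold rowChir
  rw [inner_smul_left, real_inner_comm, inner_cross3_left, mul_zero]

theorem sum_Ico_by_parts {E : Type*} [NormedAddCommGroup E] [InnerProductSpace ℝ E]
    (d w : ℕ → E) {a b : ℕ} (hab : a ≤ b) :
    ∑ i ∈ Finset.Ico a b, inner ℝ (d (i + 1) - d i) (w i) =
      inner ℝ (d b) (w b) - inner ℝ (d a) (w a) -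
        ∑ i ∈ Finset.Ico a b, inner ℝ (d (i + 1)) (w (i + 1) - w i) := by
  rw [← Finset.sum_Ico_sub (fun i => inner ℝ (d i) (w i)) hab, ← Finset.sum_sub_distrib]
  refine Finset.sum_congr rfl fun i _ => ?_
  simp only [inner_sub_left, inner_sub_right]
  ring

/-- Two rows of spins that stay close to each other rotate in the same way. -/
theorem card_mul_norm_sub_sq_le {h R : ℝ} (hh : 0 < h) {u u' : ℕ → Space3}
    {a b : ℕ} (hab : a ≤ b)
    (hu : ∀ i ≤ b, ‖u i‖ = 1) (hu' : ∀ i ≤ b, ‖u' i‖ = 1) (hR : ∀ i < b, rowStep h u i ≤ R)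
    (hR' : ∀ i < b, rowStep h u' i ≤ R) (q q' : Space3) :
    ((b - a : ℕ) : ℝ) * ‖q - q'‖ ^ 2 ≤ ‖q - q'‖ * (2 * ∑ i ∈ Finset.Ico a b,
      (‖rowChir h u i - q‖ + ‖q'‖ * ‖u i - u' i‖ + ‖rowChir h u' i - q'‖) +
      ((b - a : ℕ) : ℝ) * (h * R ^ 2) + 4 / h +
      R * ∑ i ∈ Finset.Ico a b, ‖u (i + 1) - u' (i + 1)‖) := by
  set E := q - q' with hE
  set τ : ℕ → ℝ := fun i =>
    ‖rowChir h u i - q‖ + ‖q'‖ * ‖u i - u' i‖ + ‖rowChir h u' i - q'‖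
  -- The difference d = u - u' of the rows grows like d_{i+1} - d_i ≈ h E × u_i. Tested with E × u_i
  -- this gives h(|E|² - ⟨E, u_i⟩²), a steady drift unless E = 0.
  have low : ∀ i ∈ Finset.Ico a b, h * (‖E‖ ^ 2 - 2 * ‖E‖ * τ i - h * R ^ 2 * ‖E‖) ≤
      inner ℝ ((u (i + 1) - u' (i + 1)) - (u i - u' i)) (cross3 E (u i)) := by
    intro i hi
    rw [Finset.mem_Ico] at hi
    have n0 := hu i hi.2.le
    have n0' := hu' i hi.2.le
    have e1 := sub_eq_cross3_rowChir hh n0 (hu (i + 1) hi.2)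
    have e2 := sub_eq_cross3_rowChir hh n0' (hu' (i + 1) hi.2)
    set z := rowChir h u i
    set z' := rowChir h u' i
    set c := h ^ 2 * rowStep h u i ^ 2 / 2
    set c' := h ^ 2 * rowStep h u' i ^ 2 / 2
    have hc : c ≤ h ^ 2 * R ^ 2 / 2 := by
      have := rowStep_nonneg hh u i
      have := hR i hi.2
      simp only [c]; gcongr
    have hc' : c' ≤ h ^ 2 * R ^ 2 / 2 := by
      have := rowStep_nonneg hh u' i
      have := hR' i hi.2
      simp only [c']; gcongr
    have c0 : 0 ≤ c := by simp only [c]; positivity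
    have c0' : 0 ≤ c' := by simp only [c']; positivity
    have e3 : (u (i + 1) - u' (i + 1)) - (u i - u' i) =
        h • cross3 E (u i) + (h • (cross3 q' (u i - u' i) + cross3 (z - q) (u i) -
          cross3 (z' - q') (u' i)) - c • u i + c' • u' i) := by
      have : (u (i + 1) - u' (i + 1)) - (u i - u' i) =
        (u (i + 1) - u i) - (u' (i + 1) - u' i) := by abel
      rw [this, e1, e2, hE]
      simp only [cross3_sub_left, cross3_sub_right]
      module
    have bE : ‖cross3 E (u i)‖ ≤ ‖E‖ := by
      have := norm_cross3_le E (u i); rwa [n0, mul_one] at this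
    have b1 : ‖cross3 q' (u i - u' i) + cross3 (z - q) (u i) - cross3 (z' - q') (u' i)‖ ≤ τ i := by
      have f1 := norm_cross3_le q' (u i - u' i)
      have f2 := norm_cross3_le (z - q) (u i)
      have f3 := norm_cross3_le (z' - q') (u' i)
      rw [n0, mul_one] at f2
      rw [n0', mul_one] at f3
      have f4 := norm_sub_le (cross3 q' (u i - u' i) + cross3 (z - q) (u i)) (cross3 (z' - q') (u' i))
      have f5 := norm_add_le (cross3 q' (u i - u' i)) (cross3 (z - q) (u i))
      simp only [τ]
      linarith
    have τ0 : 0 ≤ τ i := (norm_nonneg _).trans b1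
    have b2 : ‖h • (cross3 q' (u i - u' i) + cross3 (z - q) (u i) -
          cross3 (z' - q') (u' i)) - c • u i + c' • u' i‖ ≤ h * τ i + h ^ 2 * R ^ 2 := by
      refine (norm_add_le _ _).trans ?_
      have f1 := norm_sub_le (h • (cross3 q' (u i - u' i) + cross3 (z - q) (u i) -
          cross3 (z' - q') (u' i))) (c • u i)
      rw [norm_smul, norm_smul, n0, Real.norm_of_nonneg hh.le, Real.norm_of_nonneg c0] at f1
      rw [norm_smul, n0', Real.norm_of_nonneg c0']
      have := mul_le_mul_of_nonneg_left b1 hh.le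
      linarith
    have b3 := (abs_le.1 (abs_real_inner_le_norm (h • (cross3 q' (u i - u' i) + cross3 (z - q) (u i) -
          cross3 (z' - q') (u' i)) - c • u i + c' • u' i) (cross3 E (u i)))).1
    have b4 : ‖h • (cross3 q' (u i - u' i) + cross3 (z - q) (u i) -
          cross3 (z' - q') (u' i)) - c • u i + c' • u' i‖ * ‖cross3 E (u i)‖ ≤
          (h * τ i + h ^ 2 * R ^ 2) * ‖E‖ := by gcongr
    -- Spins are orthogonal to their chirality, so ⟨E, u_i⟩ is as small as the error τ_i.
    have b5 : inner ℝ E (u i) ^ 2 ≤ ‖E‖ * τ i := by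
      have g1 : |inner ℝ E (u i)| ≤ ‖E‖ := by
        have := abs_real_inner_le_norm E (u i); rwa [n0, mul_one] at this
      have g2 : |inner ℝ E (u i)| ≤ τ i := by
        have k1 : inner ℝ z (u i) = 0 := inner_rowChir h u i
        have k2 : inner ℝ z' (u' i) = 0 := inner_rowChir h u' i
        have k3 : inner ℝ E (u i) = -inner ℝ (z - q) (u i) - inner ℝ q' (u i - u' i) +
            inner ℝ (z' - q') (u' i) := by
          rw [hE]
          simp only [inner_sub_left, inner_sub_right, k1, k2]
          ring
        have l1 := abs_le.1 (abs_real_inner_le_norm (z - q) (u i))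
        have l2 := abs_le.1 (abs_real_inner_le_norm q' (u i - u' i))
        have l3 := abs_le.1 (abs_real_inner_le_norm (z' - q') (u' i))
        rw [n0, mul_one] at l1
        rw [n0', mul_one] at l3
        rw [k3, abs_le]
        simp only [τ]
        constructor <;> linarith [l1.1, l1.2, l2.1, l2.2, l3.1, l3.2]
      rw [← sq_abs, sq]
      exact mul_le_mul g1 g2 (abs_nonneg _) (norm_nonneg _)
    rw [e3, inner_add_left, real_inner_smul_left, real_inner_self_eq_norm_sq, norm_cross3_sq, n0]
    nlinarith [mul_le_mul_of_nonneg_left b5 hh.le]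
  -- Summation by parts: |d| ≤ 2 at both ends, and the test vector changes by at most |E| h R per
  -- step.
  have up : ∑ i ∈ Finset.Ico a b,
      inner ℝ ((u (i + 1) - u' (i + 1)) - (u i - u' i)) (cross3 E (u i)) ≤
      4 * ‖E‖ + ∑ i ∈ Finset.Ico a b, ‖u (i + 1) - u' (i + 1)‖ * (‖E‖ * (h * R)) := by
    rw [sum_Ico_by_parts (fun i => u i - u' i) (fun i => cross3 E (u i)) hab]
    have bd : ∀ i ≤ b, |inner ℝ (u i - u' i) (cross3 E (u i))| ≤ 2 * ‖E‖ := by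
      intro i hi
      refine (abs_real_inner_le_norm _ _).trans ?_
      have f1 := norm_sub_le (u i) (u' i)
      rw [hu i hi, hu' i hi] at f1
      have f2 := norm_cross3_le E (u i)
      rw [hu i hi, mul_one] at f2
      have := norm_nonneg (cross3 E (u i))
      have : ‖u i - u' i‖ ≤ 2 := by linarith
      gcongr
    have f1 := (abs_le.1 (bd b le_rfl)).2
    have f2 := (abs_le.1 (bd a hab)).1
    have f3 : -∑ i ∈ Finset.Ico a b, ‖u (i + 1) - u' (i + 1)‖ * (‖E‖ * (h * R)) ≤
        ∑ i ∈ Finset.Ico a b, inner ℝ (u (i + 1) - u' (i + 1))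
          (cross3 E (u (i + 1)) - cross3 E (u i)) := by
      rw [← Finset.sum_neg_distrib]
      refine Finset.sum_le_sum fun i hi => ?_
      rw [Finset.mem_Ico] at hi
      refine le_trans (neg_le_neg ?_) (abs_le.1 (abs_real_inner_le_norm _ _)).1
      rw [← cross3_sub_right]
      gcongr
      refine (norm_cross3_le _ _).trans ?_
      gcongr
      have := hR i hi.2
      unfold rowStep at this
      rwa [div_le_iff₀' hh] at this
    linarith
  have tot := (Finset.sum_le_sum low).trans up
  rw [← Finset.mul_sum, Finset.sum_sub_distrib, Finset.sum_sub_distrib, Finset.sum_const,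
    Finset.sum_const, ← Finset.mul_sum, nsmul_eq_mul, nsmul_eq_mul, Nat.card_Ico,
    ← Finset.sum_mul] at tot
  set m : ℝ := ((b - a : ℕ) : ℝ)
  set G := ∑ i ∈ Finset.Ico a b, ‖u (i + 1) - u' (i + 1)‖
  set W := ∑ i ∈ Finset.Ico a b, τ i
  have fin : h * (m * ‖E‖ ^ 2) ≤ h * (‖E‖ * (2 * W + m * (h * R ^ 2) + 4 / h + R * G)) := by
    have : h * (‖E‖ * (2 * W + m * (h * R ^ 2) + 4 / h + R * G)) =
      h * (‖E‖ * (2 * W + m * (h * R ^ 2) + R * G)) + 4 * ‖E‖ := by field_simp; ring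
    rw [this]
    linarith
  exact le_of_mul_le_mul_left fin hh

section TwoRows

variable {h lam : ℕ → ℝ} {k : ℕ → ℕ} {Q : ℕ → Finset Space3} {v v' : ℕ → ℕ → Space3} {B B' : ℝ}

/-- The sum is the integral of a step function over the whole cells inside (α, β). Dominated
convergence applies with the bound `B + 3` on the steps. -/
theorem IsRowSequence.sum_norm_rowChir_sub_tendsto (H : IsScaling h lam k Q)
    (A : IsRowSequence h lam Q v B) {q : Space3} {α β : ℝ} (hα : 0 ≤ α) (hαβ : α < β) (hβ : β < 1)
    (hζ : ∀ᵐ x : ℝ, x ∈ Ioo α β →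
      Tendsto (fun n => rowChir (h n) (v n) ⌊x / lam n⌋₊) atTop (𝓝 q)) :
    Tendsto (fun n => lam n * ∑ i ∈ Finset.Ico ⌈α / lam n⌉₊ ⌊β / lam n⌋₊,
      ‖rowChir (h n) (v n) i - q‖) atTop (𝓝 0) := by
  set g : ℕ → ℕ → ℝ≥0∞ := fun n i => ENNReal.ofReal ‖rowChir (h n) (v n) i - q‖
  have hmeas : ∀ n, Measurable fun x : ℝ => g n ⌊x / lam n⌋₊ := fun n =>
    (measurable_from_nat (f := g n)).comp (Nat.measurable_floor.comp (measurable_id.div_const _))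
  have lim : Tendsto (fun n => ∫⁻ x in Ioo α β, g n ⌊x / lam n⌋₊) atTop
      (𝓝 (∫⁻ x in Ioo α β, 0)) := by
    refine tendsto_lintegral_filter_of_dominated_convergence
      (fun _ => ENNReal.ofReal (B + 3 + ‖q‖)) (Eventually.of_forall hmeas) ?_ ?_ ?_
    · filter_upwards [H.eventually_floor_add_le (hα.trans hαβ.le) hβ, A.eventually_rowStep_le H]
        with n h1 h2
      rw [ae_restrict_iff' measurableSet_Ioo]
      refine Eventually.of_forall fun x hx => ?_
      have h3 : ⌊x / lam n⌋₊ < ⌊1 / lam n⌋₊ := by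
        have : ⌊x / lam n⌋₊ ≤ ⌊β / lam n⌋₊ := by
          have := H.lam_pos n
          have := hx.2
          gcongr
        omega
      apply ENNReal.ofReal_le_ofReal
      refine (norm_sub_le _ _).trans ?_
      have := norm_rowChir_le (H.h_pos n) (A.norm_eq n _ h3.le) (A.norm_eq n _ h3)
      have := h2 _ h3
      linarith
    · rw [setLIntegral_const, Real.volume_Ioo]
      exact ENNReal.mul_ne_top ENNReal.ofReal_ne_top ENNReal.ofReal_ne_top
    · rw [ae_restrict_iff' measurableSet_Ioo]
      filter_upwards [hζ] with x hx hxI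
      have := ((hx hxI).sub_const q).norm
      rw [sub_self, norm_zero] at this
      have := ENNReal.tendsto_ofReal this
      rwa [ENNReal.ofReal_zero] at this
  rw [lintegral_zero] at lim
  have lim2 := (ENNReal.tendsto_toReal ENNReal.zero_ne_top).comp lim
  rw [ENNReal.toReal_zero] at lim2
  have hle : ∀ᶠ n in atTop, ∫⁻ x in Ioo α β, g n ⌊x / lam n⌋₊ < 1 :=
    lim.eventually (gt_mem_nhds one_pos)
  refine squeeze_zero' (Eventually.of_forall fun n => ?_) ?_ lim2
  · have := (H.lam_pos n).le
    positivity
  · filter_upwards [hle] with n hn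
    have hl := H.lam_pos n
    simp only [Function.comp_apply]
    rw [← ENNReal.ofReal_le_iff_le_toReal (hn.trans ENNReal.one_lt_top).ne]
    rcases le_total ⌊β / lam n⌋₊ ⌈α / lam n⌉₊ with hc | hc
    · rw [Finset.Ico_eq_empty_of_le hc]; simp
    · have e := lintegral_floor hl (g n) hc
      rw [← Finset.mul_sum] at e
      rw [Finset.mul_sum, ENNReal.ofReal_sum_of_nonneg fun _ _ => by positivity]
      simp_rw [ENNReal.ofReal_mul hl.le]
      rw [← Finset.mul_sum, ← e, ← restrict_Ioo_eq_restrict_Ico]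
      refine lintegral_mono_set ?_
      refine Ioo_subset_Ioo ?_ ?_
      · have := Nat.le_ceil (α / lam n)
        rwa [div_le_iff₀' hl] at this
      · have := Nat.floor_le (div_nonneg (hα.trans hαβ.le) hl.le)
        rwa [le_div_iff₀' hl] at this

/-- In `card_mul_norm_sub_sq_le`, multiplied by λ, the left side tends to (β - α)|q - q'|². On the
right everything tends to 0; the boundary term 4λ/h does because λ/h → 0. -/
theorem IsRowSequence.eq_of_interval (H : IsScaling h lam k Q)
    (A : IsRowSequence h lam Q v B) (A' : IsRowSequence h lam Q v' B') {C : ℝ}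
    (hC : ∀ n, lam n * ∑ i ∈ Finset.range (⌊1 / lam n⌋₊ + 1), ‖v n i - v' n i‖ ^ 2 ≤ C * h n ^ 2)
    {q q' : Space3} {α β : ℝ} (hα : 0 ≤ α) (hαβ : α < β) (hβ : β < 1)
    (hζ : ∀ᵐ x : ℝ, x ∈ Ioo α β →
      Tendsto (fun n => rowChir (h n) (v n) ⌊x / lam n⌋₊) atTop (𝓝 q))
    (hζ' : ∀ᵐ x : ℝ, x ∈ Ioo α β →
      Tendsto (fun n => rowChir (h n) (v' n) ⌊x / lam n⌋₊) atTop (𝓝 q')) : q = q' := by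
  have s1 := A.sum_norm_rowChir_sub_tendsto H hα hαβ hβ hζ
  have s2 := A'.sum_norm_rowChir_sub_tendsto H hα hαβ hβ hζ'
  set R := max (B + 3) (B' + 3)
  have hR0 : 0 ≤ R := le_max_of_le_left (by linarith [A.nonneg H])
  have hC0 : 0 ≤ C := by
    have h1 := hC 0
    have h2 := H.h_pos 0
    have h3 : 0 ≤ lam 0 * ∑ i ∈ Finset.range (⌊1 / lam 0⌋₊ + 1), ‖v 0 i - v' 0 i‖ ^ 2 := by
      have := (H.lam_pos 0).le
      positivity
    by_contra! hc
    nlinarith [sq_pos_of_pos h2]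
  -- From |d| ≤ h + |d|²/h, the mean square bound C h² becomes the mean bound (1 + C) h.
  have dsum : ∀ n, ∀ I : Finset ℕ, I ⊆ Finset.range (⌊1 / lam n⌋₊ + 1) →
      (I.card : ℝ) ≤ ⌊1 / lam n⌋₊ →
      lam n * ∑ i ∈ I, ‖v n i - v' n i‖ ≤ (1 + C) * h n := by
    intro n I hI hcard
    have hl := H.lam_pos n
    have hh := H.h_pos n
    have e1 : ∑ i ∈ I, ‖v n i - v' n i‖ ≤ ∑ i ∈ I, (h n + ‖v n i - v' n i‖ ^ 2 / h n) := by
      refine Finset.sum_le_sum fun i _ => ?_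
      rw [← sub_nonneg]
      have : h n + ‖v n i - v' n i‖ ^ 2 / h n - ‖v n i - v' n i‖ =
        ((h n - ‖v n i - v' n i‖ / 2) ^ 2 + 3 / 4 * ‖v n i - v' n i‖ ^ 2) / h n := by
        field_simp; ring
      rw [this]; positivity
    rw [Finset.sum_add_distrib, Finset.sum_const, nsmul_eq_mul, ← Finset.sum_div] at e1
    have e2 : ∑ i ∈ I, ‖v n i - v' n i‖ ^ 2 ≤
        ∑ i ∈ Finset.range (⌊1 / lam n⌋₊ + 1), ‖v n i - v' n i‖ ^ 2 :=
      Finset.sum_le_sum_of_subset_of_nonneg hI fun _ _ _ => by positivity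
    have e3 : lam n * (I.card : ℝ) ≤ 1 := by
      have := Nat.floor_le (by positivity : 0 ≤ 1 / lam n)
      rw [le_div_iff₀' hl] at this
      nlinarith
    calc lam n * ∑ i ∈ I, ‖v n i - v' n i‖
        ≤ lam n * (I.card * h n +
          (∑ i ∈ Finset.range (⌊1 / lam n⌋₊ + 1), ‖v n i - v' n i‖ ^ 2) / h n) := by
          gcongr
          exact e1.trans (by gcongr)
      _ = (lam n * I.card) * h n +
          (lam n * ∑ i ∈ Finset.range (⌊1 / lam n⌋₊ + 1), ‖v n i - v' n i‖ ^ 2) / h n := by ring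
      _ ≤ 1 * h n + (C * h n ^ 2) / h n :=
          add_le_add (mul_le_mul_of_nonneg_right e3 hh.le) (div_le_div_of_nonneg_right (hC n) hh.le)
      _ = _ := by field_simp
  have m1 : Tendsto (fun n => lam n * ((⌊β / lam n⌋₊ - ⌈α / lam n⌉₊ : ℕ) : ℝ)) atTop
      (𝓝 (β - α)) := by
    have low : Tendsto (fun n => β - α - 2 * lam n) atTop (𝓝 (β - α)) := by
      simpa using (H.lam_tendsto.const_mul 2).const_sub (β - α)
    refine tendsto_of_tendsto_of_tendsto_of_le_of_le' low tendsto_const_nhds ?_ ?_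
    · filter_upwards with n
      have hl := H.lam_pos n
      have f1 := (Nat.lt_floor_add_one (β / lam n)).le
      have f2 := (Nat.ceil_lt_add_one (div_nonneg hα hl.le)).le
      have f3 : (⌊β / lam n⌋₊ : ℝ) - ⌈α / lam n⌉₊ ≤ ((⌊β / lam n⌋₊ - ⌈α / lam n⌉₊ : ℕ) : ℝ) := by
        rw [sub_le_iff_le_add]
        exact_mod_cast Nat.sub_le_iff_le_add.1 le_rfl
      have f4 : β / lam n - α / lam n - 2 ≤ ((⌊β / lam n⌋₊ - ⌈α / lam n⌉₊ : ℕ) : ℝ) := by linarith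
      have f5 := mul_le_mul_of_nonneg_left f4 hl.le
      refine le_trans (le_of_eq ?_) f5
      field_simp
    · filter_upwards with n
      have hl := H.lam_pos n
      rcases le_total ⌊β / lam n⌋₊ ⌈α / lam n⌉₊ with hc | hc
      · rw [Nat.sub_eq_zero_of_le hc]; simp; exact hαβ.le
      · rw [Nat.cast_sub hc]
        have f1 := Nat.floor_le (div_nonneg (hα.trans hαβ.le) hl.le)
        have f2 := Nat.le_ceil (α / lam n)
        have f4 : (⌊β / lam n⌋₊ : ℝ) - ⌈α / lam n⌉₊ ≤ β / lam n - α / lam n := by linarith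
        have f5 := mul_le_mul_of_nonneg_left f4 hl.le
        refine f5.trans (le_of_eq ?_)
        field_simp
  have rhs : Tendsto (fun n => ‖q - q'‖ * (2 * (lam n * ∑ i ∈ Finset.Ico ⌈α / lam n⌉₊ ⌊β / lam n⌋₊,
      ‖rowChir (h n) (v n) i - q‖ + ‖q'‖ * ((1 + C) * h n) +
      lam n * ∑ i ∈ Finset.Ico ⌈α / lam n⌉₊ ⌊β / lam n⌋₊, ‖rowChir (h n) (v' n) i - q'‖) +
      (lam n * ((⌊β / lam n⌋₊ - ⌈α / lam n⌉₊ : ℕ) : ℝ)) * (h n * R ^ 2) + 4 * (lam n / h n) +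
      R * ((1 + C) * h n))) atTop (𝓝 0) := by
    have g1 : Tendsto (fun n => (1 + C) * h n) atTop (𝓝 0) := by
      simpa using H.h_tendsto.const_mul (1 + C)
    have g2 : Tendsto (fun n => h n * R ^ 2) atTop (𝓝 0) := by
      simpa using H.h_tendsto.mul_const (R ^ 2)
    have := ((((((s1.add (g1.const_mul ‖q'‖)).add s2).const_mul 2).add (m1.mul g2)).add
      (H.ratio_tendsto.const_mul 4)).add (g1.const_mul R)).const_mul ‖q - q'‖
    simpa using this
  have lhs := m1.mul_const (‖q - q'‖ ^ 2)
  have le : (β - α) * ‖q - q'‖ ^ 2 ≤ 0 := by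
    refine le_of_tendsto_of_tendsto lhs rhs ?_
    filter_upwards [A.eventually_rowStep_le H, A'.eventually_rowStep_le H,
      H.eventually_floor_add_le (hα.trans hαβ.le) hβ] with n r1 r2 r3
    have hl := H.lam_pos n
    have hh := H.h_pos n
    rcases le_total ⌊β / lam n⌋₊ ⌈α / lam n⌉₊ with hc | hc
    · rw [Nat.sub_eq_zero_of_le hc, Finset.Ico_eq_empty_of_le hc]
      simp only [Finset.sum_empty, Nat.cast_zero, mul_zero, zero_mul]
      positivity
    · have key := card_mul_norm_sub_sq_le hh (u := v n) (u' := v' n) hc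
        (fun i hi => A.norm_eq n i (by omega)) (fun i hi => A'.norm_eq n i (by omega))
        (fun i hi => (r1 i (by omega)).trans (le_max_left _ _))
        (fun i hi => (r2 i (by omega)).trans (le_max_right _ _)) q q'
      have key2 := mul_le_mul_of_nonneg_left key hl.le
      rw [← mul_assoc] at key2
      refine key2.trans ?_
      rw [mul_left_comm]
      gcongr
      have d1 := dsum n (Finset.Ico ⌈α / lam n⌉₊ ⌊β / lam n⌋₊)
        (by intro i hi; rw [Finset.mem_Ico] at hi; rw [Finset.mem_range]; omega)
        (by rw [Nat.card_Ico]; exact_mod_cast (by omega))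
      have d2 : lam n * ∑ i ∈ Finset.Ico ⌈α / lam n⌉₊ ⌊β / lam n⌋₊,
          ‖v n (i + 1) - v' n (i + 1)‖ ≤ (1 + C) * h n := by
        rw [Finset.sum_Ico_add' (fun i => ‖v n i - v' n i‖)]
        exact dsum n _ (by intro i hi; rw [Finset.mem_Ico] at hi; rw [Finset.mem_range]; omega)
          (by rw [Nat.card_Ico]; exact_mod_cast (by omega))
      rw [Finset.sum_add_distrib, Finset.sum_add_distrib, ← Finset.mul_sum]
      have d3 := mul_le_mul_of_nonneg_left d1 (norm_nonneg q')
      have d4 := mul_le_mul_of_nonneg_left d2 hR0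
      have e : lam n * (4 / h n) = 4 * (lam n / h n) := by ring
      nlinarith
  have h0 : ‖q - q'‖ ^ 2 ≤ 0 := by
    by_contra! hc
    have := mul_pos (sub_pos.2 hαβ) hc
    linarith
  have h1 : ‖q - q'‖ = 0 := by
    have := le_antisymm h0 (sq_nonneg _)
    exact pow_eq_zero_iff two_ne_zero |>.1 this
  exact sub_eq_zero.1 (norm_eq_zero.1 h1)

theorem AEConstAt.exists_lt {V : Type*} {ζ : ℝ → V} {t : ℝ} (h : AEConstAt ζ t) {ε₀ : ℝ} (hε₀ : 0 < ε₀) :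
    ∃ c, ∃ ε > 0, ε < ε₀ ∧ ∀ ε' ≤ ε, ∀ᵐ x : ℝ, x ∈ Ioo (t - ε') (t + ε') → ζ x = c := by
  obtain ⟨c, ε, hε, hc⟩ := h
  refine ⟨c, min ε (ε₀ / 2), by positivity, (min_le_right _ _).trans_lt (by linarith), ?_⟩
  intro ε' hε'
  filter_upwards [hc] with x hx hxI
  have := min_le_left ε (ε₀ / 2)
  exact hx ⟨by linarith [hxI.1], by linarith [hxI.2]⟩

/-- A property that holds almost everywhere near all points of an interval except finitely many holds
almost everywhere. -/
theorem ae_of_locally {a b : ℝ} {P : ℝ → Prop} {S : Set ℝ} (hS : S.Finite)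
    (hP : ∀ t ∈ Ioo a b, t ∉ S → ∃ ε > 0, ∀ᵐ x : ℝ, x ∈ Ioo (t - ε) (t + ε) → P x) :
    ∀ᵐ x : ℝ, x ∈ Ioo a b → P x := by
  have h0 : volume {x | x ∈ Ioo a b ∧ x ∉ S ∧ ¬P x} = 0 := by
    refine measure_null_of_locally_null _ fun t ht => ?_
    obtain ⟨ε, hε, h⟩ := hP t ht.1 ht.2.1
    refine ⟨Ioo (t - ε) (t + ε) ∩ {x | x ∈ Ioo a b ∧ x ∉ S ∧ ¬P x}, ?_, ?_⟩
    · exact inter_mem (mem_nhdsWithin_of_mem_nhds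
        (Ioo_mem_nhds (by linarith) (by linarith))) self_mem_nhdsWithin
    · refine measure_mono_null ?_ (ae_iff.1 h)
      rintro x ⟨hx, _, _, hx'⟩
      simp only [mem_ofPred_eq, Classical.not_imp]
      exact ⟨hx, hx'⟩
  have h1 : ∀ᵐ x : ℝ, x ∉ S := hS.countable.ae_notMem volume
  have h2 : ∀ᵐ x : ℝ, ¬(x ∈ Ioo a b ∧ x ∉ S ∧ ¬P x) := by
    rw [ae_iff]
    simpa only [not_not] using h0
  filter_upwards [h1, h2] with x hx hx' hxI
  by_contra hc
  exact hx' ⟨hxI, hx, hc⟩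

/-- Rows of bounded energy that stay close to each other have the same limit. -/
theorem IsRowSequence.ae_eq (H : IsScaling h lam k Q)
    (A : IsRowSequence h lam Q v B) (A' : IsRowSequence h lam Q v' B') {C : ℝ}
    (hC : ∀ n, lam n * ∑ i ∈ Finset.range (⌊1 / lam n⌋₊ + 1), ‖v n i - v' n i‖ ^ 2 ≤ C * h n ^ 2)
    {ζ ζ' : ℝ → Space3}
    (hζ : ∀ᵐ x : ℝ, x ∈ Ioo (0 : ℝ) 1 →
      Tendsto (fun n => rowChir (h n) (v n) ⌊x / lam n⌋₊) atTop (𝓝 (ζ x)))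
    (hζ' : ∀ᵐ x : ℝ, x ∈ Ioo (0 : ℝ) 1 →
      Tendsto (fun n => rowChir (h n) (v' n) ⌊x / lam n⌋₊) atTop (𝓝 (ζ' x))) :
    ∀ᵐ x : ℝ, x ∈ Ioo (0 : ℝ) 1 → ζ x = ζ' x := by
  refine ae_of_locally (((A.finite_singularSet H hζ).1).union (A'.finite_singularSet H hζ').1) ?_
  intro t ht htS
  have c1 : AEConstAt ζ t := by
    by_contra hc
    exact htS (Or.inl ⟨ht, hc⟩)
  have c2 : AEConstAt ζ' t := by
    by_contra hc
    exact htS (Or.inr ⟨ht, hc⟩)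
  have hpos : 0 < min t (1 - t) := lt_min ht.1 (by linarith [ht.2])
  obtain ⟨c, ε, hε, hε0, hc⟩ := c1.exists_lt hpos
  obtain ⟨c', ε', hε', hε0', hc'⟩ := c2.exists_lt hpos
  set e := min ε ε'
  have he : 0 < e := lt_min hε hε'
  have e1 := hc e (min_le_left _ _)
  have e2 := hc' e (min_le_right _ _)
  have e3 : e < min t (1 - t) := (min_le_left _ _).trans_lt hε0
  have e4 : e < t := e3.trans_le (min_le_left _ _)
  have e5 : e < 1 - t := e3.trans_le (min_le_right _ _)
  have hcc : c = c' := by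
    refine A.eq_of_interval H A' hC (α := t - e) (β := t + e) (by linarith) (by linarith)
      (by linarith) ?_ ?_
    · filter_upwards [hζ, e1] with x h1 h2 hx
      rw [← h2 hx]
      exact h1 ⟨by linarith [hx.1], by linarith [hx.2]⟩
    · filter_upwards [hζ', e2] with x h1 h2 hx
      rw [← h2 hx]
      exact h1 ⟨by linarith [hx.1], by linarith [hx.2]⟩
  refine ⟨e, he, ?_⟩
  filter_upwards [e1, e2] with x h1 h2 hx
  rw [h1 hx, h2 hx, hcc]

end TwoRows


/-! ### Step functions on the line -/

theorem eq_of_ae_eq_on_Ioo {V : Type*} {ζ : ℝ → V} {a b : ℝ} (hab : a < b) {c c' : V}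
    (h : ∀ᵐ x : ℝ, x ∈ Ioo a b → ζ x = c) (h' : ∀ᵐ x : ℝ, x ∈ Ioo a b → ζ x = c') : c = c' := by
  have hne : ∃ x, x ∈ Ioo a b ∧ ζ x = c ∧ ζ x = c' := by
    by_contra! hc
    have h0 : volume (Ioo a b) = 0 := by
      refine measure_mono_null ?_ (ae_iff.1 (h.and h'))
      intro x hx hx'
      exact hc x hx (hx'.1 hx) (hx'.2 hx)
    rw [Real.volume_Ioo, ENNReal.ofReal_eq_zero] at h0
    linarith
  obtain ⟨x, _, h1, h2⟩ := hne
  exact h1.symm.trans h2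

/-- A function that is locally almost everywhere constant on an interval is almost everywhere
constant. -/
theorem exists_ae_eq_of_aeConstAt {V : Type*} {ζ : ℝ → V} {a b : ℝ}
    (h : ∀ t ∈ Ioo a b, AEConstAt ζ t) : ∃ c, ∀ᵐ x : ℝ, x ∈ Ioo a b → ζ x = c := by
  rcases le_or_gt b a with hab | hab
  · exact ⟨ζ 0, by simp [Ioo_eq_empty_of_le hab]⟩
  have h' : ∀ t, ∃ c, ∃ ε > 0, t ∈ Ioo a b → ∀ᵐ x : ℝ, x ∈ Ioo (t - ε) (t + ε) → ζ x = c := by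
    intro t
    by_cases ht : t ∈ Ioo a b
    · obtain ⟨c, ε, hε, hc⟩ := h t ht
      exact ⟨c, ε, hε, fun _ => hc⟩
    · exact ⟨ζ 0, 1, one_pos, fun ht' => absurd ht' ht⟩
  choose f ε hε hf using h'
  -- Neighbouring local constants agree because their intervals overlap in a set of positive
  -- measure; connectedness does the rest.
  have hconst : ∀ x ∈ Ioo a b, ∀ y ∈ Ioo a b, f x = f y := by
    intro x hx y hy
    refine isPreconnected_Ioo.induction₂ (fun x y => f x = f y) ?_ ?_ ?_ hx hy
    · intro t ht
      filter_upwards [mem_nhdsWithin_of_mem_nhds (Ioo_mem_nhds (by linarith [hε t] : t - ε t < t)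
        (by linarith [hε t] : t < t + ε t)), self_mem_nhdsWithin] with s hs hsI
      refine eq_of_ae_eq_on_Ioo (ζ := ζ) (a := max (t - ε t) (s - ε s)) (b := min (t + ε t) (s + ε s))
        ?_ ?_ ?_
      · have := hε s
        have := hε t
        exact max_lt (lt_min (by linarith) (by linarith [hs.1]))
          (lt_min (by linarith [hs.2]) (by linarith))
      · filter_upwards [hf t ht] with x hx hxI
        exact hx ⟨(le_max_left _ _).trans_lt hxI.1, hxI.2.trans_le (min_le_left _ _)⟩
      · filter_upwards [hf s hsI] with x hx hxI
        exact hx ⟨(le_max_right _ _).trans_lt hxI.1, hxI.2.trans_le (min_le_right _ _)⟩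
    · intro x y z _ _ _ h1 h2
      exact h1.trans h2
    · intro x y _ _ h1
      exact h1.symm
  refine ⟨f ((a + b) / 2), ae_of_locally (S := ∅) finite_empty fun t ht _ => ?_⟩
  refine ⟨ε t, hε t, ?_⟩
  filter_upwards [hf t ht] with x hx hxI
  rw [hx hxI]
  exact hconst t ht _ ⟨by linarith, by linarith⟩

section StepFunction

variable {V : Type*} [AddCommGroup V]

/-- The step function with initial value `c` and with jump `Δ t` at the points `t ∈ S`. -/
def stepFunction (S : Finset ℝ) (c : V) (Δ : ℝ → V) (x : ℝ) : V :=
  c + ∑ t ∈ S, if t < x then Δ t else 0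

/-- The strict inequality in `stepFunction` makes it continuous from the left, so the jump at `t`
shows on the right only. -/
theorem stepFunction_eventually (S : Finset ℝ) (c : V) (Δ : ℝ → V) (t : ℝ) :
    ∃ ε > 0, (∀ x ∈ Ioo (t - ε) t, stepFunction S c Δ x = stepFunction S c Δ t) ∧
      ∀ x ∈ Ioo t (t + ε), stepFunction S c Δ x =
        stepFunction S c Δ t + if t ∈ S then Δ t else 0 := by
  have h1 : ∀ᶠ ε : ℝ in 𝓝[>] 0, ∀ s ∈ S, s ≠ t → ε < |s - t| := by
    rw [Filter.eventually_all_finset]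
    intro s _
    by_cases hst : s = t
    · exact Eventually.of_forall fun _ h => absurd hst h
    · filter_upwards [nhdsWithin_le_nhds (gt_mem_nhds (abs_pos.2 (sub_ne_zero.2 hst)))] with ε h _
      exact h
  obtain ⟨ε, h2, hε⟩ := (h1.and self_mem_nhdsWithin).exists
  have hε : 0 < ε := hε
  refine ⟨ε, hε, ?_, ?_⟩
  · rintro x ⟨hx1, hx2⟩
    unfold stepFunction
    congr 1
    refine Finset.sum_congr rfl fun s hs => ?_
    by_cases hst : s = t
    · rw [hst, if_neg (not_lt.2 hx2.le), if_neg (lt_irrefl t)]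
    · have h3 := h2 s hs hst
      have : s < x ↔ s < t := by
        constructor
        · intro h; linarith
        · intro h
          rw [abs_of_neg (by linarith)] at h3
          linarith
      simp only [this]
  · rintro x ⟨hx1, hx2⟩
    unfold stepFunction
    rw [add_assoc]
    congr 1
    have e : (if t ∈ S then Δ t else 0) = ∑ s ∈ S, if s = t then Δ s else 0 := by
      rw [Finset.sum_ite_eq']
    rw [e, ← Finset.sum_add_distrib]
    refine Finset.sum_congr rfl fun s hs => ?_
    by_cases hst : s = t
    · rw [hst, if_pos hx1, if_neg (lt_irrefl t), if_pos rfl, zero_add]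
    · have h3 := h2 s hs hst
      have : s < x ↔ s < t := by
        constructor
        · intro h
          by_contra! hc
          rw [abs_of_nonneg (by linarith)] at h3
          linarith
        · intro h; linarith
      simp only [this, if_neg hst, add_zero]

/-- A function with finitely many singular points is a step function. -/
theorem exists_ae_eq_stepFunction {ζ : ℝ → V} (hS : (singularSet ζ).Finite) :
    ∃ (c : V) (Δ : ℝ → V), (∀ t ∈ singularSet ζ, Δ t ≠ 0) ∧
      ∀ᵐ x : ℝ, x ∈ Ioo (0 : ℝ) 1 → ζ x = stepFunction hS.toFinset c Δ x := by
  obtain ⟨ε₀, hε₀, hsep1, hsep2⟩ := exists_separation hS.toFinset fun t ht =>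
    ((hS.mem_toFinset).1 ht).1
  have onesided : ∀ t, ∃ c c' : V, t ∈ singularSet ζ →
      (∀ᵐ x : ℝ, x ∈ Ioo (t - ε₀) t → ζ x = c) ∧ (∀ᵐ x : ℝ, x ∈ Ioo t (t + ε₀) → ζ x = c') := by
    intro t
    by_cases ht : t ∈ singularSet ζ
    · have ht' := hS.mem_toFinset.2 ht
      obtain ⟨e1, e2⟩ := hsep1 t ht'
      have reg : ∀ s ∈ Ioo (t - ε₀) (t + ε₀), s ≠ t → AEConstAt ζ s := by
        intro s hs hst
        by_contra hc
        have hs' : s ∈ singularSet ζ := ⟨⟨by linarith [hs.1], by linarith [hs.2]⟩, hc⟩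
        rcases lt_or_gt_of_ne hst with hlt | hlt
        · have := hsep2 s (hS.mem_toFinset.2 hs') t ht' hlt
          linarith [hs.1]
        · have := hsep2 t ht' s (hS.mem_toFinset.2 hs') hlt
          linarith [hs.2]
      obtain ⟨c, hc⟩ := exists_ae_eq_of_aeConstAt (ζ := ζ) (a := t - ε₀) (b := t) fun s hs =>
        reg s ⟨hs.1, by linarith [hs.2]⟩ hs.2.ne
      obtain ⟨c', hc'⟩ := exists_ae_eq_of_aeConstAt (ζ := ζ) (a := t) (b := t + ε₀) fun s hs =>
        reg s ⟨by linarith [hs.1], hs.2⟩ hs.1.ne'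
      exact ⟨c, c', fun _ => ⟨hc, hc'⟩⟩
    · exact ⟨0, 0, fun h => absurd h ht⟩
  choose cl cr hcl using onesided
  set Δ : ℝ → V := fun t => cr t - cl t
  have glue : ∀ {g : ℝ → V} {t ε : ℝ} {d : V}, 0 < ε → (∀ᵐ x : ℝ, x ∈ Ioo (t - ε) t → g x = d) →
      (∀ᵐ x : ℝ, x ∈ Ioo t (t + ε) → g x = d) → AEConstAt g t := by
    intro g t ε d hε h1 h2
    refine ⟨d, ε, hε, ?_⟩
    have h3 : ∀ᵐ x : ℝ, x ≠ t := by simp [ae_iff]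
    filter_upwards [h1, h2, h3] with x h1 h2 h3 hx
    rcases lt_or_gt_of_ne h3 with hlt | hlt
    · exact h1 ⟨hx.1, hlt⟩
    · exact h2 ⟨hlt, hx.2⟩
  have hΔ : ∀ t ∈ singularSet ζ, Δ t ≠ 0 := by
    intro t ht h0
    have e : cr t = cl t := sub_eq_zero.1 h0
    exact ht.2 (glue hε₀ (hcl t ht).1 (e ▸ (hcl t ht).2))
  -- Once the jumps are subtracted, no singular point is left in (0, 1), and the remainder is a.e.
  -- constant.
  set g : ℝ → V := fun x => ζ x - stepFunction hS.toFinset 0 Δ x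
  have hg : ∀ t ∈ Ioo (0 : ℝ) 1, AEConstAt g t := by
    intro t ht
    obtain ⟨ε, hε, s1, s2⟩ := stepFunction_eventually hS.toFinset (0 : V) Δ t
    by_cases htS : t ∈ singularSet ζ
    · rw [if_pos (hS.mem_toFinset.2 htS)] at s2
      refine glue (ε := min ε ε₀) (d := cl t - stepFunction hS.toFinset 0 Δ t)
        (lt_min hε hε₀) ?_ ?_
      · filter_upwards [(hcl t htS).1] with x hx hxI
        have m1 := min_le_left ε ε₀
        have m2 := min_le_right ε ε₀
        simp only [g]
        rw [hx ⟨by linarith [hxI.1], hxI.2⟩, s1 x ⟨by linarith [hxI.1], hxI.2⟩]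
      · filter_upwards [(hcl t htS).2] with x hx hxI
        have m1 := min_le_left ε ε₀
        have m2 := min_le_right ε ε₀
        simp only [g]
        rw [hx ⟨hxI.1, by linarith [hxI.2]⟩, s2 x ⟨hxI.1, by linarith [hxI.2]⟩]
        simp only [Δ]
        abel
    · rw [if_neg (fun h => htS (hS.mem_toFinset.1 h)), add_zero] at s2
      have hreg : AEConstAt ζ t := by
        by_contra hc
        exact htS ⟨ht, hc⟩
      obtain ⟨c, ε', hε', hc⟩ := hreg
      refine glue (ε := min ε ε') (d := c - stepFunction hS.toFinset 0 Δ t)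
        (lt_min hε hε') ?_ ?_
      · filter_upwards [hc] with x hx hxI
        have m1 := min_le_left ε ε'
        have m2 := min_le_right ε ε'
        simp only [g]
        rw [hx ⟨by linarith [hxI.1], by linarith [hxI.2]⟩, s1 x ⟨by linarith [hxI.1], hxI.2⟩]
      · filter_upwards [hc] with x hx hxI
        have m1 := min_le_left ε ε'
        have m2 := min_le_right ε ε'
        simp only [g]
        rw [hx ⟨by linarith [hxI.1], by linarith [hxI.2]⟩, s2 x ⟨hxI.1, by linarith [hxI.2]⟩]
  obtain ⟨c, hc⟩ := exists_ae_eq_of_aeConstAt hg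
  refine ⟨c, Δ, hΔ, ?_⟩
  filter_upwards [hc] with x hx hxI
  have := hx hxI
  simp only [g] at this
  rw [sub_eq_iff_eq_add] at this
  rw [this]
  unfold stepFunction
  rw [zero_add]

end StepFunction

/-- Integration by parts for a step function. -/
theorem integral_stepFunction_mul_deriv {S : Finset ℝ} (hS : ∀ t ∈ S, t ∈ Ioo (0 : ℝ) 1) (c : ℝ)
    (Δ : ℝ → ℝ) {ψ ψ' : ℝ → ℝ} (hψ : ∀ x, HasDerivAt ψ (ψ' x) x) (hψ' : Continuous ψ')
    (h0 : ψ 0 = 0) (h1 : ψ 1 = 0) :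
    ∫ x in Ioo (0 : ℝ) 1, stepFunction S c Δ x * ψ' x = -∑ t ∈ S, Δ t * ψ t := by
  have int : ∀ a b : ℝ, IntegrableOn ψ' (Ioo a b) := fun a b =>
    (hψ'.integrableOn_Icc (a := a) (b := b)).mono_set Ioo_subset_Icc_self
  have ftc : ∀ a b : ℝ, a ≤ b → ∫ x in Ioo a b, ψ' x = ψ b - ψ a := by
    intro a b hab
    rw [← integral_Ioc_eq_integral_Ioo, ← intervalIntegral.integral_of_le hab]
    exact intervalIntegral.integral_eq_sub_of_hasDerivAt (fun x _ => hψ x)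
      (hψ'.intervalIntegrable _ _)
  have e : ∀ t ∈ S, (fun x => (if t < x then Δ t else 0) * ψ' x) =
      (Ioi t).indicator fun x => Δ t * ψ' x := by
    intro t _
    ext x
    simp only [indicator, mem_Ioi]
    split_ifs <;> simp
  have hint : ∀ t ∈ S, Integrable (fun x => (if t < x then Δ t else 0) * ψ' x)
      (volume.restrict (Ioo 0 1)) := by
    intro t ht
    rw [e t ht]
    exact ((int 0 1).const_mul _).indicator measurableSet_Ioi
  have e2 : (fun x => stepFunction S c Δ x * ψ' x) =
      fun x => c * ψ' x + ∑ t ∈ S, (if t < x then Δ t else 0) * ψ' x := by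
    ext x
    unfold stepFunction
    rw [add_mul, Finset.sum_mul]
  rw [e2, integral_add ((int 0 1).const_mul c) (integrable_finsetSum _ hint),
    integral_finsetSum _ hint, integral_const_mul, ftc 0 1 zero_le_one, h0, h1, sub_zero,
    mul_zero, zero_add, ← Finset.sum_neg_distrib]
  refine Finset.sum_congr rfl fun t ht => ?_
  have ht' := hS t ht
  rw [e t ht, setIntegral_indicator measurableSet_Ioi, Ioo_inter_Ioi, max_eq_right ht'.1.le,
    integral_const_mul, ftc t 1 ht'.2.le, h1]
  ring

theorem measurable_stepFunction {V : Type*} [NormedAddCommGroup V] [MeasurableSpace V] [BorelSpace V]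
    [SecondCountableTopology V] (S : Finset ℝ) (c : V) (Δ : ℝ → V) :
    Measurable (stepFunction S c Δ) := by
  unfold stepFunction
  refine measurable_const.add (Finset.measurable_fun_sum _ fun t _ => ?_)
  exact Measurable.ite measurableSet_Ioi measurable_const measurable_const

theorem norm_stepFunction_le {V : Type*} [NormedAddCommGroup V] (S : Finset ℝ) (c : V) (Δ : ℝ → V)
    (x : ℝ) : ‖stepFunction S c Δ x‖ ≤ ‖c‖ + ∑ t ∈ S, ‖Δ t‖ := by
  unfold stepFunction
  refine (norm_add_le _ _).trans (add_le_add_right ((norm_sum_le _ _).trans ?_) _)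
  refine Finset.sum_le_sum fun t _ => ?_
  split_ifs <;> simp


/-! ### The plane as a product -/

/-- The Euclidean plane. -/
abbrev Plane : Type := EuclideanSpace ℝ (Fin 2)

/-- The identification of `ℝ × ℝ` with the Euclidean plane. -/
def planeEquiv : ℝ × ℝ ≃ᵐ Plane :=
  MeasurableEquiv.finTwoArrow.symm.trans (MeasurableEquiv.toLp 2 (Fin 2 → ℝ))

theorem planeEquiv_apply (p : ℝ × ℝ) : planeEquiv p = !₂[p.1, p.2] := by
  ext i
  fin_cases i <;> rfl

@[simp] theorem planeEquiv_zero (p : ℝ × ℝ) : planeEquiv p 0 = p.1 := rfl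

@[simp] theorem planeEquiv_one (p : ℝ × ℝ) : planeEquiv p 1 = p.2 := rfl

theorem measurePreserving_planeEquiv : MeasurePreserving planeEquiv := by
  have h1 : MeasurePreserving (MeasurableEquiv.finTwoArrow (α := ℝ)).symm :=
    (volume_preserving_finTwoArrow ℝ).symm _
  exact h1.trans (PiLp.volume_preserving_toLp (Fin 2))

theorem preimage_unitSquare : planeEquiv ⁻¹' unitSquare = Icc (0 : ℝ) 1 ×ˢ Icc (0 : ℝ) 1 := by
  ext p
  simp only [mem_preimage, unitSquare, mem_ofPred_eq, Fin.forall_fin_two, planeEquiv_zero,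
    planeEquiv_one, mem_prod]

theorem preimage_openUnitSquare :
    planeEquiv ⁻¹' openUnitSquare = Ioo (0 : ℝ) 1 ×ˢ Ioo (0 : ℝ) 1 := by
  ext p
  simp [openUnitSquare, Fin.forall_fin_two]

theorem isOpen_openUnitSquare : IsOpen openUnitSquare := by
  have : openUnitSquare = ⋂ j : Fin 2, (fun x : Plane => x j) ⁻¹' Ioo (0 : ℝ) 1 := by
    ext x; simp [openUnitSquare]
  rw [this]
  exact isOpen_iInter_of_finite fun j => isOpen_Ioo.preimage (by fun_prop)

theorem measurableSet_openUnitSquare : MeasurableSet openUnitSquare :=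
  isOpen_openUnitSquare.measurableSet

theorem unitSquare_ae_eq : (unitSquare : Set Plane) =ᵐ[volume] openUnitSquare := by
  have h1 : (Icc (0 : ℝ) 1 ×ˢ Icc (0 : ℝ) 1 : Set (ℝ × ℝ)) =ᵐ[volume]
      (Ioo (0 : ℝ) 1 ×ˢ Ioo (0 : ℝ) 1 : Set (ℝ × ℝ)) :=
    Measure.set_prod_ae_eq Ioo_ae_eq_Icc.symm Ioo_ae_eq_Icc.symm
  rw [← preimage_unitSquare, ← preimage_openUnitSquare] at h1
  have h2 := (measurePreserving_planeEquiv.symm planeEquiv).quasiMeasurePreserving.preimage_ae_eq h1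
  simpa [← preimage_comp] using h2

theorem restrict_unitSquare :
    (volume.restrict unitSquare : Measure Plane) = volume.restrict openUnitSquare :=
  Measure.restrict_congr_set unitSquare_ae_eq

theorem ae_openUnitSquare_iff {P : Plane → Prop} :
    (∀ᵐ p ∂volume.restrict openUnitSquare, P p) ↔
      ∀ᵐ q : ℝ × ℝ, q.1 ∈ Ioo (0 : ℝ) 1 → q.2 ∈ Ioo (0 : ℝ) 1 → P (planeEquiv q) := by
  rw [ae_restrict_iff' measurableSet_openUnitSquare]
  constructor
  · intro h
    filter_upwards [measurePreserving_planeEquiv.quasiMeasurePreserving.ae h] with q hq h1 h2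
    refine hq ?_
    rw [← mem_preimage, preimage_openUnitSquare]
    exact ⟨h1, h2⟩
  · intro h
    have h2 := (measurePreserving_planeEquiv.symm planeEquiv).quasiMeasurePreserving.ae h
    filter_upwards [h2] with p hp hpΩ
    have : planeEquiv.symm p ∈ planeEquiv ⁻¹' openUnitSquare := by
      simpa using hpΩ
    rw [preimage_openUnitSquare] at this
    simpa using hp this.1 this.2

theorem ae_openUnitSquare_iff_zero {P : ℝ → Prop} :
    (∀ᵐ p : Plane ∂volume.restrict openUnitSquare, P (p 0)) ↔
      ∀ᵐ x : ℝ, x ∈ Ioo (0 : ℝ) 1 → P x := by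
  rw [ae_openUnitSquare_iff]
  constructor
  · intro h
    have h1 := Measure.ae_ae_of_ae_prod (μ := volume) (ν := volume) h
    filter_upwards [h1] with x hx hxI
    have : ∃ y, y ∈ Ioo (0 : ℝ) 1 ∧ (y ∈ Ioo (0 : ℝ) 1 → P x) := by
      by_contra! hc
      have h0 : volume (Ioo (0 : ℝ) 1) = 0 := by
        refine measure_mono_null ?_ (ae_iff.1 hx)
        intro y hy hy'
        exact (hc y hy).2 (hy' hxI hy)
      rw [Real.volume_Ioo, ENNReal.ofReal_eq_zero] at h0
      linarith
    obtain ⟨y, hy, hP⟩ := this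
    exact hP hy
  · intro h
    have := (Measure.quasiMeasurePreserving_fst (μ := (volume : Measure ℝ))
      (ν := (volume : Measure ℝ))).ae h
    filter_upwards [this] with q hq h1 _
    exact hq h1

theorem integral_openUnitSquare (F : Plane → ℝ) :
    ∫ p in openUnitSquare, F p =
      ∫ q in Ioo (0 : ℝ) 1 ×ˢ Ioo (0 : ℝ) 1, F (planeEquiv q) := by
  rw [← preimage_openUnitSquare]
  exact (measurePreserving_planeEquiv.setIntegral_preimage_emb
    planeEquiv.measurableEmbedding F openUnitSquare).symm

theorem continuous_planeEquiv : Continuous planeEquiv := by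
  have : (planeEquiv : ℝ × ℝ → Plane) = fun p => !₂[p.1, p.2] := funext planeEquiv_apply
  rw [this]
  fun_prop

theorem hasDerivAt_planeEquiv_zero (x y : ℝ) :
    HasDerivAt (fun x => planeEquiv (x, y)) (EuclideanSpace.single 0 1) x := by
  have e : (fun x => planeEquiv (x, y)) =
      fun x => x • (EuclideanSpace.single 0 1 : Plane) + planeEquiv (0, y) := by
    ext x i
    fin_cases i <;> simp
  rw [e]
  simpa using ((hasDerivAt_id x).smul_const (EuclideanSpace.single 0 1 : Plane)).add_const
    (planeEquiv (0, y))

theorem hasDerivAt_planeEquiv_one (x y : ℝ) :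
    HasDerivAt (fun y => planeEquiv (x, y)) (EuclideanSpace.single 1 1) y := by
  have e : (fun y => planeEquiv (x, y)) =
      fun y => y • (EuclideanSpace.single 1 1 : Plane) + planeEquiv (x, 0) := by
    ext y i
    fin_cases i <;> simp
  rw [e]
  simpa using ((hasDerivAt_id y).smul_const (EuclideanSpace.single 1 1 : Plane)).add_const
    (planeEquiv (x, 0))

section TestFunction

variable {φ : Plane → ℝ} (hφ : ContDiff ℝ 1 φ)
include hφ

theorem hasDerivAt_comp_planeEquiv_zero (x y : ℝ) :
    HasDerivAt (fun x => φ (planeEquiv (x, y))) (partialDeriv 0 φ (planeEquiv (x, y))) x :=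
  ((hφ.differentiable one_ne_zero (planeEquiv (x, y))).hasFDerivAt).comp_hasDerivAt x
    (hasDerivAt_planeEquiv_zero x y)

theorem hasDerivAt_comp_planeEquiv_one (x y : ℝ) :
    HasDerivAt (fun y => φ (planeEquiv (x, y))) (partialDeriv 1 φ (planeEquiv (x, y))) y :=
  ((hφ.differentiable one_ne_zero (planeEquiv (x, y))).hasFDerivAt).comp_hasDerivAt y
    (hasDerivAt_planeEquiv_one x y)

theorem continuous_partialDeriv (j : Fin 2) : Continuous (partialDeriv j φ) := by
  unfold partialDeriv
  exact (hφ.continuous_fderiv one_ne_zero).clm_apply continuous_const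

theorem integrableOn_mul_partialDeriv (j : Fin 2) {F : ℝ → ℝ} (hF : Measurable F) {C : ℝ}
    (hC : ∀ x, |F x| ≤ C) :
    IntegrableOn (fun q : ℝ × ℝ => F q.1 * partialDeriv j φ (planeEquiv q))
      (Ioo (0 : ℝ) 1 ×ˢ Ioo (0 : ℝ) 1) := by
  have h1 : IntegrableOn (fun q : ℝ × ℝ => partialDeriv j φ (planeEquiv q))
      (Ioo (0 : ℝ) 1 ×ˢ Ioo (0 : ℝ) 1) := by
    refine IntegrableOn.mono_set (t := Icc (0 : ℝ) 1 ×ˢ Icc (0 : ℝ) 1) ?_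
      (prod_mono Ioo_subset_Icc_self Ioo_subset_Icc_self)
    exact ((continuous_partialDeriv hφ j).comp continuous_planeEquiv).continuousOn.integrableOn_compact
      (isCompact_Icc.prod isCompact_Icc)
  refine h1.bdd_mul (c := C) (hF.comp measurable_fst).aestronglyMeasurable ?_
  exact Eventually.of_forall fun q => hC q.1

variable (hsupp : tsupport φ ⊆ openUnitSquare)
include hsupp

omit hφ in
theorem eq_zero_of_notMem {p : ℝ × ℝ} (hp : p ∉ Ioo (0 : ℝ) 1 ×ˢ Ioo (0 : ℝ) 1) :
    φ (planeEquiv p) = 0 := by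
  by_contra hc
  have : planeEquiv p ∈ openUnitSquare := hsupp (subset_tsupport _ hc)
  rw [← mem_preimage, preimage_openUnitSquare] at this
  exact hp this

/-- On each vertical line F is constant and φ vanishes at both ends. -/
theorem integral_mul_partialDeriv_one {F : ℝ → ℝ} (hF : Measurable F) {C : ℝ}
    (hC : ∀ x, |F x| ≤ C) : ∫ p in openUnitSquare, F (p 0) * partialDeriv 1 φ p = 0 := by
  rw [integral_openUnitSquare]
  simp only [planeEquiv_zero]
  have e := setIntegral_prod _ (integrableOn_mul_partialDeriv hφ 1 hF hC)
  rw [Measure.volume_eq_prod, e]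
  refine integral_eq_zero_of_ae (Eventually.of_forall fun x => ?_)
  simp only [Pi.zero_apply]
  rw [integral_const_mul, ← integral_Ioc_eq_integral_Ioo,
    ← intervalIntegral.integral_of_le zero_le_one,
    intervalIntegral.integral_eq_sub_of_hasDerivAt (fun y _ => hasDerivAt_comp_planeEquiv_one hφ x y)
      (((continuous_partialDeriv hφ 1).comp (continuous_planeEquiv.comp
        (by fun_prop : Continuous fun y : ℝ => (x, y)))).intervalIntegrable _ _),
    eq_zero_of_notMem hsupp (by simp), eq_zero_of_notMem hsupp (by simp)]
  simp

theorem integral_stepFunction_mul_partialDeriv_zero {S : Finset ℝ}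
    (hS : ∀ t ∈ S, t ∈ Ioo (0 : ℝ) 1) (c : ℝ) (Δ : ℝ → ℝ) :
    ∫ p in openUnitSquare, stepFunction S c Δ (p 0) * partialDeriv 0 φ p =
      -∑ t ∈ S, Δ t * ∫ y in Ioo (0 : ℝ) 1, φ (planeEquiv (t, y)) := by
  rw [integral_openUnitSquare]
  simp only [planeEquiv_zero]
  have hi := integrableOn_mul_partialDeriv hφ 0 (measurable_stepFunction S c Δ)
    (norm_stepFunction_le S c Δ)
  -- The swap puts the x-integral inside, where the one-dimensional integration by parts applies for
  -- each y.
  have e := setIntegral_prod_swap (μ := (volume : Measure ℝ)) (ν := (volume : Measure ℝ))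
    (Ioo (0 : ℝ) 1) (Ioo (0 : ℝ) 1)
    (fun q : ℝ × ℝ => stepFunction S c Δ q.1 * partialDeriv 0 φ (planeEquiv q))
  rw [Measure.volume_eq_prod, ← e, setIntegral_prod (fun q : ℝ × ℝ =>
    stepFunction S c Δ q.swap.1 * partialDeriv 0 φ (planeEquiv q.swap)) hi.swap]
  simp only [Prod.swap_prod_mk]
  have hin : ∀ y : ℝ, ∫ x in Ioo (0 : ℝ) 1,
      stepFunction S c Δ x * partialDeriv 0 φ (planeEquiv (x, y)) =
      -∑ t ∈ S, Δ t * φ (planeEquiv (t, y)) := by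
    intro y
    exact integral_stepFunction_mul_deriv hS c Δ (fun x => hasDerivAt_comp_planeEquiv_zero hφ x y)
      ((continuous_partialDeriv hφ 0).comp (continuous_planeEquiv.comp
        (by fun_prop : Continuous fun x : ℝ => (x, y))))
      (eq_zero_of_notMem hsupp (by simp)) (eq_zero_of_notMem hsupp (by simp))
  simp_rw [hin]
  rw [integral_neg, integral_finsetSum]
  · simp_rw [integral_const_mul]
  · intro t _
    refine Integrable.const_mul ?_ _
    exact ((hφ.continuous.comp (continuous_planeEquiv.comp
      (by fun_prop : Continuous fun y : ℝ => (t, y)))).integrableOn_Icc (a := 0) (b := 1)).mono_set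
      Ioo_subset_Icc_self

end TestFunction

/-! ### Functions of one variable that are step functions -/

theorem abs_integral_Ioo_le {f : ℝ → ℝ} {C : ℝ} (h : ∀ y, |f y| ≤ C) :
    |∫ y in Ioo (0 : ℝ) 1, f y| ≤ C := by
  have := norm_setIntegral_le_of_norm_le_const (μ := (volume : Measure ℝ)) (s := Ioo (0 : ℝ) 1)
    (f := f) (C := C) (by simp) (fun y _ => h y)
  simpa using this

/-- The perimeter of a vertical strip. -/
theorem perimeter_strip_lt_top {J : Set ℝ} (hJ : MeasurableSet J)
    (hfin : (singularSet (J.indicator fun _ => (1 : ℝ))).Finite) :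
    perimeter {p : Plane | p ∈ openUnitSquare ∧ p 0 ∈ J} openUnitSquare < ⊤ := by
  obtain ⟨c, Δ, -, hstep⟩ := exists_ae_eq_stepFunction hfin
  set S := hfin.toFinset
  have hS : ∀ t ∈ S, t ∈ Ioo (0 : ℝ) 1 := fun t ht => (hfin.mem_toFinset.1 ht).1
  -- Integration by parts leaves integrals of the test field over unit segments, each at most 1 in
  -- modulus.
  refine lt_of_le_of_lt ?_ (ENNReal.ofReal_lt_top (r := ∑ t ∈ S, |Δ t|))
  unfold perimeter
  refine iSup₂_le fun φ hφ => ENNReal.ofReal_le_ofReal ?_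
  obtain ⟨h1, h2, h3, h4⟩ := hφ
  have hc : ∀ j, ContDiff ℝ 1 fun y => φ y j := fun j => by fun_prop
  have hs : ∀ j, tsupport (fun y => φ y j) ⊆ openUnitSquare := fun j => by
    refine (closure_mono ?_).trans h3
    intro x hx hx'
    rw [Function.mem_support] at hx
    exact hx (by simp [hx'])
  have e1 : ∫ x in {p : Plane | p ∈ openUnitSquare ∧ p 0 ∈ J}, divergence φ x =
      ∫ p in openUnitSquare, (stepFunction S c Δ (p 0) * partialDeriv 0 (fun y => φ y 0) p +
        stepFunction S c Δ (p 0) * partialDeriv 1 (fun y => φ y 1) p) := by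
    have hJ' : MeasurableSet {p : Plane | p 0 ∈ J} :=
      (by fun_prop : Measurable fun p : Plane => p 0) hJ
    have : {p : Plane | p ∈ openUnitSquare ∧ p 0 ∈ J} = openUnitSquare ∩ {p : Plane | p 0 ∈ J} := rfl
    rw [this, ← setIntegral_indicator hJ']
    refine integral_congr_ae ?_
    filter_upwards [(ae_openUnitSquare_iff_zero (P := fun x => J.indicator (fun _ => (1 : ℝ)) x =
      stepFunction S c Δ x)).2 hstep] with p hp
    rw [← hp]
    unfold divergence
    simp only [Fin.sum_univ_two]
    by_cases hpJ : p 0 ∈ J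
    · rw [indicator_of_mem (by exact hpJ), indicator_of_mem hpJ, one_mul, one_mul]
    · rw [indicator_of_notMem (by exact hpJ), indicator_of_notMem hpJ, zero_mul, zero_mul, add_zero]
  have i0 : ∀ j, IntegrableOn (fun p : Plane => stepFunction S c Δ (p 0) *
      partialDeriv j (fun y => φ y j) p) openUnitSquare := by
    intro j
    have := integrableOn_mul_partialDeriv (hc j) j (measurable_stepFunction S c Δ)
      (norm_stepFunction_le S c Δ)
    rw [← preimage_openUnitSquare] at this
    exact (measurePreserving_planeEquiv.integrableOn_comp_preimage
      planeEquiv.measurableEmbedding).1 this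
  rw [e1, integral_add (i0 0) (i0 1), integral_stepFunction_mul_partialDeriv_zero (hc 0) (hs 0) hS,
    integral_mul_partialDeriv_one (hc 1) (hs 1) (measurable_stepFunction S c Δ)
      (norm_stepFunction_le S c Δ), add_zero, ← Finset.sum_neg_distrib]
  refine Finset.sum_le_sum fun t _ => ?_
  refine (neg_le_abs _).trans ?_
  rw [abs_mul]
  refine mul_le_of_le_one_right (abs_nonneg _) (abs_integral_Ioo_le fun y => ?_)
  exact (PiLp.norm_apply_le (φ (planeEquiv (t, y))) 0).trans (h4 _)


/-! ### Functions of x with finitely many jumps: jump set, SBV, partition -/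

section Slices

variable {ζ : ℝ → Space3} {z : Plane → Space3}

theorem inner_sub_single_zero (x y : Plane) :
    inner ℝ (y - x) (EuclideanSpace.single 0 (1 : ℝ)) = y 0 - x 0 := by
  simp [EuclideanSpace.inner_single_right]

theorem abs_sub_lt_of_mem_ball {x y : Plane} {r : ℝ} (h : y ∈ Metric.ball x r) :
    |y 0 - x 0| < r := by
  rw [Metric.mem_ball, dist_eq_norm] at h
  exact (PiLp.norm_apply_le (y - x) 0).trans_lt h

/-- The jump set of a function of the first variable consists of vertical segments. -/
theorem jumpSet_eq (hz : ∀ᵐ p ∂volume.restrict openUnitSquare, z p = ζ (p 0))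
    (hS : (singularSet ζ).Finite) :
    jumpSet openUnitSquare z = {p | p ∈ openUnitSquare ∧ p 0 ∈ singularSet ζ} := by
  ext x
  constructor
  · rintro ⟨hx, a, b, ν, hab, hν, ha, hb⟩
    refine ⟨hx, hx 0, fun hc => hab ?_⟩
    obtain ⟨c, ε, hε, hc⟩ := hc
    have hzc : ∀ᵐ p ∂volume.restrict openUnitSquare,
        p 0 ∈ Ioo (x 0 - ε) (x 0 + ε) → z p = c := by
      filter_upwards [hz, (ae_openUnitSquare_iff_zero (P := fun s =>
        s ∈ Ioo (x 0 - ε) (x 0 + ε) → ζ s = c)).2 (hc.mono fun s hs _ => hs)] with p h1 h2 h3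
      rw [h1, h2 h3]
    -- Where z is a.e. equal to c, the averages over half balls of positive measure are |c - a|, so
    -- every one-sided limit is c.
    have key : ∀ (a : Space3) (H : ℝ → Set Plane), (∀ r, H r ⊆ Metric.ball x r) →
        (∀ r, IsOpen (H r)) → (∀ r > 0, (H r).Nonempty) →
        Tendsto (fun r : ℝ => ⨍ y in H r, ‖z y - a‖) (𝓝[>] 0) (𝓝 0) → c = a := by
      intro a H hsub hopen hne ha
      have : Tendsto (fun _ : ℝ => ‖c - a‖) (𝓝[>] 0) (𝓝 0) := by
        refine ha.congr' ?_
        filter_upwards [nhdsWithin_le_nhds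
          (eventually_ball_subset (isOpen_openUnitSquare.mem_nhds hx)), nhdsWithin_le_nhds (gt_mem_nhds hε),
          self_mem_nhdsWithin] with r hr hrε hr0
        have e : (fun y => ‖z y - a‖) =ᵐ[volume.restrict (H r)] fun _ => ‖c - a‖ := by
          have h1 := ae_restrict_of_ae_restrict_of_subset ((hsub r).trans hr) hzc
          filter_upwards [h1, ae_restrict_mem (hopen r).measurableSet] with y h2 h3
          have h4 := abs_lt.1 (abs_sub_lt_of_mem_ball (hsub r h3))
          rw [h2 ⟨by linarith [h4.1], by linarith [h4.2]⟩]
        rw [average_congr e, setAverage_const ((hopen r).measure_pos volume (hne r hr0)).ne'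
          ((measure_mono (hsub r)).trans_lt measure_ball_lt_top).ne]
      have h0 := tendsto_nhds_unique this tendsto_const_nhds
      exact sub_eq_zero.1 (norm_eq_zero.1 h0.symm)
    have hcont : Continuous fun y : Plane => inner ℝ (y - x) ν := by fun_prop
    have e1 : ∀ r > 0, x + (r / 2) • ν ∈ Metric.ball x r := by
      intro r hr
      rw [Metric.mem_ball, dist_eq_norm, add_sub_cancel_left, norm_smul, hν, mul_one,
        Real.norm_of_nonneg (by linarith)]
      linarith
    have e2 : ∀ r > 0, x - (r / 2) • ν ∈ Metric.ball x r := by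
      intro r hr
      rw [Metric.mem_ball, dist_eq_norm, sub_sub_cancel_left, norm_neg, norm_smul, hν, mul_one,
        Real.norm_of_nonneg (by linarith)]
      linarith
    have k1 := key a (fun r => {y | y ∈ Metric.ball x r ∧ 0 < inner ℝ (y - x) ν})
      (fun r y hy => hy.1) (fun r => Metric.isOpen_ball.inter (isOpen_lt continuous_const hcont))
      (fun r hr => ⟨x + (r / 2) • ν, e1 r hr, by
        rw [add_sub_cancel_left, real_inner_smul_left, real_inner_self_eq_norm_sq, hν]
        have : (0 : ℝ) < r := hr
        positivity⟩) ha
    have k2 := key b (fun r => {y | y ∈ Metric.ball x r ∧ inner ℝ (y - x) ν < 0})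
      (fun r y hy => hy.1) (fun r => Metric.isOpen_ball.inter (isOpen_lt hcont continuous_const))
      (fun r hr => ⟨x - (r / 2) • ν, e2 r hr, by
        rw [sub_sub_cancel_left, inner_neg_left, real_inner_smul_left, real_inner_self_eq_norm_sq,
          hν]
        have : (0 : ℝ) < r := hr
        linarith⟩) hb
    exact k1.symm.trans k2
  · rintro ⟨hx, hxS⟩
    obtain ⟨c, Δ, hΔ, hstep⟩ := exists_ae_eq_stepFunction hS
    obtain ⟨ε, hε, h1, h2⟩ := stepFunction_eventually hS.toFinset c Δ (x 0)
    rw [if_pos (hS.mem_toFinset.2 hxS)] at h2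
    have hzs : ∀ᵐ p ∂volume.restrict openUnitSquare, z p = stepFunction hS.toFinset c Δ (p 0) := by
      filter_upwards [hz, (ae_openUnitSquare_iff_zero (P := fun s =>
        ζ s = stepFunction hS.toFinset c Δ s)).2 hstep] with p h1 h2
      rw [h1, h2]
    have key : ∀ (a : Space3) (H : ℝ → Set Plane), (∀ r, H r ⊆ Metric.ball x r) →
        (∀ r, IsOpen (H r)) →
        (∀ r, r < ε → ∀ y ∈ H r, stepFunction hS.toFinset c Δ (y 0) = a) →
        Tendsto (fun r : ℝ => ⨍ y in H r, ‖z y - a‖) (𝓝[>] 0) (𝓝 0) := by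
      intro a H hsub hopen ha
      refine tendsto_const_nhds.congr' ?_
      filter_upwards [nhdsWithin_le_nhds
          (eventually_ball_subset (isOpen_openUnitSquare.mem_nhds hx)), nhdsWithin_le_nhds (gt_mem_nhds hε)] with r hr hrε
      have e : (fun y => ‖z y - a‖) =ᵐ[volume.restrict (H r)] fun _ => 0 := by
        have h1 := ae_restrict_of_ae_restrict_of_subset ((hsub r).trans hr) hzs
        filter_upwards [h1, ae_restrict_mem (hopen r).measurableSet] with y h2 h3
        rw [h2, ha r hrε y h3, sub_self, norm_zero]
      rw [average_congr e]
      simp [average_eq]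
    have hcont : Continuous fun y : Plane => inner ℝ (y - x) (EuclideanSpace.single 0 (1 : ℝ)) := by
      fun_prop
    -- The normal is e₁, so the value on the right comes first.
    refine ⟨hx, stepFunction hS.toFinset c Δ (x 0) + Δ (x 0), stepFunction hS.toFinset c Δ (x 0),
      EuclideanSpace.single 0 1, ?_, by simp, ?_, ?_⟩
    · intro h
      exact hΔ _ hxS (by simpa using h)
    · refine key _ _ (fun r y hy => hy.1)
        (fun r => Metric.isOpen_ball.inter (isOpen_lt continuous_const hcont)) ?_
      rintro r hr y ⟨hy1, hy2⟩
      rw [inner_sub_single_zero] at hy2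
      have := abs_lt.1 (abs_sub_lt_of_mem_ball hy1)
      exact h2 _ ⟨by linarith, by linarith [this.2]⟩
    · refine key _ _ (fun r y hy => hy.1)
        (fun r => Metric.isOpen_ball.inter (isOpen_lt hcont continuous_const)) ?_
      rintro r hr y ⟨hy1, hy2⟩
      rw [inner_sub_single_zero] at hy2
      have := abs_lt.1 (abs_sub_lt_of_mem_ball hy1)
      exact h1 _ ⟨by linarith [this.1], by linarith⟩

theorem isometry_segment (t : ℝ) : Isometry fun y : ℝ => planeEquiv (t, y) := by
  refine Isometry.of_dist_eq fun y y' => ?_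
  rw [EuclideanSpace.dist_eq, Fin.sum_univ_two]
  simp [Real.sqrt_sq_eq_abs, Real.dist_eq]

theorem hausdorffMeasure_segments (S : Finset ℝ) (hS : ∀ t ∈ S, t ∈ Ioo (0 : ℝ) 1) :
    Measure.hausdorffMeasure 1 {p : Plane | p ∈ openUnitSquare ∧ p 0 ∈ S} = S.card := by
  have e : {p : Plane | p ∈ openUnitSquare ∧ p 0 ∈ S} =
      ⋃ t ∈ S, (fun y : ℝ => planeEquiv (t, y)) '' Ioo (0 : ℝ) 1 := by
    ext p
    simp only [mem_ofPred_eq, mem_iUnion, mem_image, exists_prop]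
    constructor
    · rintro ⟨h1, h2⟩
      refine ⟨p 0, h2, p 1, h1 1, ?_⟩
      ext i
      fin_cases i <;> rfl
    · rintro ⟨t, ht, y, hy, rfl⟩
      refine ⟨?_, by simpa using ht⟩
      rw [← mem_preimage, preimage_openUnitSquare]
      exact ⟨hS t ht, hy⟩
  rw [e, measure_biUnion_finset]
  · have : ∀ t ∈ S, Measure.hausdorffMeasure 1
        ((fun y : ℝ => planeEquiv (t, y)) '' Ioo (0 : ℝ) 1) = 1 := by
      intro t _
      rw [(isometry_segment t).hausdorffMeasure_image (Or.inl zero_le_one), hausdorffMeasure_real,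
        Real.volume_Ioo]
      simp
    rw [Finset.sum_congr rfl this]
    simp
  · intro t _ t' _ hne
    simp only [Function.onFun]
    rw [Set.disjoint_left]
    rintro p ⟨y, _, rfl⟩ ⟨y', _, h⟩
    have := congrArg (fun p : Plane => p 0) h
    simp only [planeEquiv_zero] at this
    exact hne this.symm
  · intro t _
    exact (isometry_segment t).isClosedEmbedding.measurableEmbedding.measurableSet_image'
      measurableSet_Ioo

theorem hausdorffMeasure_jumpSet (hz : ∀ᵐ p ∂volume.restrict openUnitSquare, z p = ζ (p 0))
    (hS : (singularSet ζ).Finite) :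
    Measure.hausdorffMeasure 1 (jumpSet openUnitSquare z) = ((singularSet ζ).ncard : ℝ≥0∞) := by
  have e : {p : Plane | p ∈ openUnitSquare ∧ p 0 ∈ singularSet ζ} =
      {p | p ∈ openUnitSquare ∧ p 0 ∈ hS.toFinset} := by simp
  rw [jumpSet_eq hz hS, e, hausdorffMeasure_segments _ fun t ht => (hS.mem_toFinset.1 ht).1,
    Set.ncard_eq_toFinset_card _ hS]

/-- The gradient is explicit: |Δ t| times the length measure on the segment over each jump t, with
the density (Δ t / |Δ t|) ⊗ e₁. It is carried by the jump set. -/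
theorem isSBV_of_finite (hint : IntegrableOn z openUnitSquare)
    (hz : ∀ᵐ p ∂volume.restrict openUnitSquare, z p = ζ (p 0))
    (hfin : (singularSet ζ).Finite) : IsSBV openUnitSquare z := by
  obtain ⟨c, Δ₀, hΔ₀, hstep₀⟩ := exists_ae_eq_stepFunction hfin
  set S := hfin.toFinset with hSdef
  have hS : ∀ t ∈ S, t ∈ Ioo (0 : ℝ) 1 := fun t ht => (hfin.mem_toFinset.1 ht).1
  -- The jumps are set to 0 outside the finite set, since the density σ has to be measurable.
  obtain ⟨Δ, hΔm, hΔ, hstep⟩ : ∃ Δ : ℝ → Space3, Measurable Δ ∧ (∀ t ∈ S, Δ t ≠ 0) ∧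
      ∀ᵐ x : ℝ, x ∈ Ioo (0 : ℝ) 1 → ζ x = stepFunction S c Δ x := by
    refine ⟨fun t => ∑ s ∈ S, if t = s then Δ₀ s else 0, ?_, ?_, ?_⟩
    · exact Finset.measurable_fun_sum _ fun t _ =>
        Measurable.ite (measurableSet_singleton t) measurable_const measurable_const
    · intro t ht
      beta_reduce
      rw [Finset.sum_ite_eq, if_pos ht]
      exact hΔ₀ t (hfin.mem_toFinset.1 ht)
    · filter_upwards [hstep₀] with x hx hxI
      rw [hx hxI]
      unfold stepFunction
      congr 1
      refine Finset.sum_congr rfl fun t ht => ?_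
      beta_reduce
      rw [Finset.sum_ite_eq, if_pos ht]
  set seg : ℝ → Measure Plane := fun t =>
    Measure.map (fun y : ℝ => planeEquiv (t, y)) (volume.restrict (Ioo 0 1))
  have hsegm : ∀ t, Measurable fun y : ℝ => planeEquiv (t, y) := fun t =>
    (isometry_segment t).continuous.measurable
  set μ : Measure Plane := ∑ t ∈ S, ENNReal.ofReal ‖Δ t‖ • seg t with hμ
  set σ : Plane → Fin 3 → Fin 2 → ℝ := fun x i j =>
    if j = 0 then ‖Δ (x 0)‖⁻¹ * Δ (x 0) i else 0
  have μ_apply : ∀ s, MeasurableSet s → μ s = ∑ t ∈ S, ENNReal.ofReal ‖Δ t‖ *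
      volume.restrict (Ioo 0 1) ((fun y : ℝ => planeEquiv (t, y)) ⁻¹' s) := by
    intro s hs
    rw [hμ, Measure.finsetSum_apply]
    refine Finset.sum_congr rfl fun t _ => ?_
    rw [Measure.smul_apply, Measure.map_apply (hsegm t) hs, smul_eq_mul]
  have hμfin : IsFiniteMeasure μ := by
    refine ⟨?_⟩
    rw [μ_apply _ MeasurableSet.univ]
    refine ENNReal.sum_lt_top.2 fun t _ => ?_
    refine ENNReal.mul_lt_top ENNReal.ofReal_lt_top ?_
    simp
  have μ_null : ∀ s, MeasurableSet s → (∀ t ∈ S, ∀ y ∈ Ioo (0 : ℝ) 1, planeEquiv (t, y) ∉ s) →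
      μ s = 0 := by
    intro s hs h
    rw [μ_apply s hs]
    refine Finset.sum_eq_zero fun t ht => ?_
    rw [Measure.restrict_apply (hsegm t hs)]
    have : (fun y : ℝ => planeEquiv (t, y)) ⁻¹' s ∩ Ioo 0 1 = ∅ := by
      ext y
      simp only [mem_inter_iff, mem_preimage, mem_empty_iff_false, iff_false, not_and]
      exact fun h1 h2 => h t ht y h2 h1
    rw [this, measure_empty, mul_zero]
  have mem_sq : ∀ t ∈ S, ∀ y ∈ Ioo (0 : ℝ) 1, planeEquiv (t, y) ∈ openUnitSquare := by
    intro t ht y hy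
    rw [← mem_preimage, preimage_openUnitSquare]
    exact ⟨hS t ht, hy⟩
  have σm : Measurable σ := by
    refine measurable_pi_lambda _ fun i => measurable_pi_lambda _ fun j => ?_
    simp only [σ]
    split_ifs
    · have h1 : Measurable fun x : Plane => Δ (x 0) := hΔm.comp (by fun_prop)
      exact h1.norm.inv.mul ((by fun_prop : Measurable fun v : Space3 => v i).comp h1)
    · exact measurable_const
  have zstep : ∀ᵐ p ∂volume.restrict openUnitSquare, z p = stepFunction S c Δ (p 0) := by
    filter_upwards [hz, (ae_openUnitSquare_iff_zero (P := fun s =>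
      ζ s = stepFunction S c Δ s)).2 hstep] with p h1 h2
    rw [h1, h2]
  have comp : ∀ (i : Fin 3) (x : ℝ), stepFunction S c Δ x i =
      stepFunction S (c i) (fun t => Δ t i) x := by
    intro i x
    unfold stepFunction
    rw [PiLp.add_apply, WithLp.ofLp_sum, Finset.sum_apply]
    congr 1
    refine Finset.sum_congr rfl fun t _ => ?_
    split_ifs <;> rfl
  refine ⟨hint, μ, σ, ⟨hμfin, ?_, σm, ?_, ?_⟩, ?_⟩
  · exact μ_null _ measurableSet_openUnitSquare.compl fun t ht y hy h => h (mem_sq t ht y hy)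
  · have hm : MeasurableSet {x : Plane | ∑ i, ∑ j, σ x i j ^ 2 = 1} := by
      refine measurableSet_eq_fun ?_ measurable_const
      refine Finset.measurable_fun_sum _ fun i _ => Finset.measurable_fun_sum _ fun j _ => ?_
      exact (measurable_pi_iff.1 (measurable_pi_iff.1 σm i) j).pow_const 2
    refine μ_null _ hm.compl fun t ht y _ h => h ?_
    simp only [mem_ofPred_eq, σ, Fin.sum_univ_two, planeEquiv_zero, if_true]
    simp only [one_ne_zero, if_false, ne_eq, OfNat.ofNat_ne_zero, not_false_eq_true, zero_pow,
      add_zero, mul_pow]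
    rw [← Finset.mul_sum, Fin.sum_univ_three, ← norm_sq_eq_three, ← mul_pow,
      inv_mul_cancel₀ (norm_ne_zero_iff.2 (hΔ t ht)), one_pow]
  · intro i j φ hφ _ hsupp
    have hφ1 : ContDiff ℝ 1 φ := hφ.of_le (by exact_mod_cast le_top)
    have e1 : ∫ x in openUnitSquare, z x i * partialDeriv j φ x =
        ∫ x in openUnitSquare, stepFunction S (c i) (fun t => Δ t i) (x 0) * partialDeriv j φ x := by
      refine integral_congr_ae ?_
      filter_upwards [zstep] with x hx
      rw [hx, comp]
    rw [e1]
    by_cases hj : j = 0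
    · subst hj
      rw [integral_stepFunction_mul_partialDeriv_zero hφ1 hsupp hS, hμ]
      have hbd : ∀ t ∈ S, Integrable (fun x => φ x * σ x i 0) (ENNReal.ofReal ‖Δ t‖ • seg t) := by
        intro t _
        refine Integrable.smul_measure ?_ ENNReal.ofReal_ne_top
        rw [integrable_map_measure]
        · have e2 : (fun x => φ x * σ x i 0) ∘ (fun y : ℝ => planeEquiv (t, y)) =
              fun y => φ (planeEquiv (t, y)) * (‖Δ t‖⁻¹ * Δ t i) := by
            ext y; simp [σ]
          rw [e2]
          refine Integrable.mul_const ?_ _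
          exact ((hφ1.continuous.comp (isometry_segment t).continuous).integrableOn_Icc
            (a := 0) (b := 1)).mono_set Ioo_subset_Icc_self
        · exact (hφ1.continuous.measurable.mul
            (measurable_pi_iff.1 (measurable_pi_iff.1 σm i) 0)).aestronglyMeasurable
        · exact (hsegm t).aemeasurable
      rw [integral_finsetSum_measure hbd]
      congr 1
      refine Finset.sum_congr rfl fun t ht => ?_
      have hm : Measurable fun x => φ x * σ x i 0 :=
        hφ1.continuous.measurable.mul (measurable_pi_iff.1 (measurable_pi_iff.1 σm i) 0)
      have e3 : ∫ x, φ x * σ x i 0 ∂seg t =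
          ∫ y in Ioo (0 : ℝ) 1, φ (planeEquiv (t, y)) * σ (planeEquiv (t, y)) i 0 :=
        integral_map (hsegm t).aemeasurable hm.aestronglyMeasurable
      rw [integral_smul_measure, e3]
      simp only [σ, if_true, planeEquiv_zero]
      rw [integral_mul_const, ENNReal.toReal_ofReal (norm_nonneg _), smul_eq_mul]
      have := norm_ne_zero_iff.2 (hΔ t ht)
      field_simp
    · have hj1 : j = 1 := by omega
      subst hj1
      rw [integral_mul_partialDeriv_one hφ1 hsupp (measurable_stepFunction _ _ _)
        (C := ‖c i‖ + ∑ t ∈ S, ‖Δ t i‖)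
        (fun x => norm_stepFunction_le S (c i) (fun t => Δ t i) x)]
      simp [σ]
  · rw [jumpSet_eq hz hfin]
    have hm : MeasurableSet (openUnitSquare \
        {p : Plane | p ∈ openUnitSquare ∧ p 0 ∈ singularSet ζ}) := by
      refine measurableSet_openUnitSquare.diff (measurableSet_openUnitSquare.inter ?_)
      exact (by fun_prop : Measurable fun p : Plane => p 0) hfin.measurableSet
    refine le_antisymm ((Measure.singularPart_le μ volume _).trans (le_of_eq ?_)) zero_le
    refine μ_null _ hm fun t ht y hy h => h.2 ⟨mem_sq t ht y hy, ?_⟩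
    exact hfin.mem_toFinset.1 ht

theorem stepFunction_one (S : Finset ℝ) (x : ℝ) :
    stepFunction S (0 : ℝ) (fun _ => 1) x = ((S.filter (· < x)).card : ℝ) := by
  unfold stepFunction
  rw [zero_add, Finset.sum_ite]
  simp

/-- The two sets are nested. -/
theorem filter_lt_eq_of_card_eq {S : Finset ℝ} {x x' : ℝ}
    (h : (S.filter (· < x)).card = (S.filter (· < x')).card) :
    S.filter (· < x) = S.filter (· < x') := by
  rcases le_total x x' with hx | hx
  · refine Finset.eq_of_subset_of_card_le ?_ h.ge
    exact Finset.monotone_filter_right S fun t _ ht => lt_of_lt_of_le ht hx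
  · refine (Finset.eq_of_subset_of_card_le ?_ h.le).symm
    exact Finset.monotone_filter_right S fun t _ ht => lt_of_lt_of_le ht hx

theorem perimeter_empty {d : ℕ} (Ω : Set (EuclideanSpace ℝ (Fin d))) : perimeter ∅ Ω = 0 := by
  simp [perimeter]

/-- The elements are indexed by the number of jumps to the left of x, so all but finitely many are
empty. -/
theorem exists_partition_of_finite
    (hz : ∀ᵐ p ∂volume.restrict openUnitSquare, z p = ζ (p 0))
    (hfin : (singularSet ζ).Finite) :
    ∃ P : ℕ → Set Plane, IsCaccioppoliPartition openUnitSquare P ∧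
      ∀ α, ∃ c, ∀ᵐ x ∂volume.restrict (P α), z x = c := by
  obtain ⟨c, Δ, -, hstep⟩ := exists_ae_eq_stepFunction hfin
  set S := hfin.toFinset
  set J : ℕ → Set ℝ := fun j => {x | (S.filter (· < x)).card = j}
  set P : ℕ → Set Plane := fun j => {p | p ∈ openUnitSquare ∧ p 0 ∈ J j}
  have hJ : ∀ j, MeasurableSet (J j) := by
    intro j
    have : J j = {x | stepFunction S (0 : ℝ) (fun _ => 1) x = j} := by
      ext x
      simp only [J, mem_ofPred_eq, stepFunction_one, Nat.cast_inj]
    rw [this]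
    exact measurableSet_eq_fun (measurable_stepFunction _ _ _) measurable_const
  have hP : ∀ j, MeasurableSet (P j) := fun j =>
    measurableSet_openUnitSquare.inter ((by fun_prop : Measurable fun p : Plane => p 0) (hJ j))
  refine ⟨P, ⟨hP, fun j p hp => hp.1, ?_, ?_, ?_⟩, ?_⟩
  · intro i j hij
    rw [Set.disjoint_left]
    rintro p ⟨_, h1⟩ ⟨_, h2⟩
    exact hij (h1.symm.trans h2)
  · have : openUnitSquare \ ⋃ j, P j = ∅ := by
      ext p
      simp only [Set.mem_sdiff, mem_iUnion, mem_empty_iff_false, iff_false, not_and, not_not]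
      exact fun hp => ⟨_, hp, rfl⟩
    rw [this, measure_empty]
  · have hzero : ∀ j ∉ Finset.range (S.card + 1), perimeter (P j) openUnitSquare = 0 := by
      intro j hj
      have : P j = ∅ := by
        ext p
        simp only [mem_empty_iff_false, iff_false]
        rintro ⟨_, h⟩
        have h1 : (S.filter (· < p 0)).card = j := h
        have h2 : (S.filter (· < p 0)).card ≤ S.card := Finset.card_filter_le _ _
        rw [Finset.mem_range] at hj
        omega
      rw [this, perimeter_empty]
    rw [tsum_eq_sum hzero]
    refine ENNReal.sum_lt_top.2 fun j _ => perimeter_strip_lt_top (hJ j) ?_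
    refine hfin.subset fun t ht => ?_
    by_contra htS
    refine ht.2 ?_
    obtain ⟨ε, hε, h1, h2⟩ := stepFunction_eventually S (0 : ℝ) (fun _ => 1) t
    rw [if_neg (fun h => htS (hfin.mem_toFinset.1 h)), add_zero] at h2
    refine ⟨(J j).indicator (fun _ => 1) t, ε, hε, ?_⟩
    refine Eventually.of_forall fun x hx => ?_
    have e : stepFunction S (0 : ℝ) (fun _ => 1) x = stepFunction S (0 : ℝ) (fun _ => 1) t := by
      rcases lt_trichotomy x t with h | h | h
      · exact h1 x ⟨hx.1, h⟩
      · rw [h]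
      · exact h2 x ⟨h, hx.2⟩
    rw [stepFunction_one, stepFunction_one, Nat.cast_inj] at e
    have : x ∈ J j ↔ t ∈ J j := by simp only [J, mem_ofPred_eq, e]
    by_cases hx' : t ∈ J j
    · rw [indicator_of_mem hx', indicator_of_mem (this.2 hx')]
    · rw [indicator_of_notMem hx', indicator_of_notMem (fun h => hx' (this.1 h))]
  · intro j
    by_cases hne : (J j).Nonempty
    · obtain ⟨x₀, hx₀⟩ := hne
      refine ⟨stepFunction S c Δ x₀, ?_⟩
      have h1 : ∀ᵐ p ∂volume.restrict (P j), z p = stepFunction S c Δ (p 0) := by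
        refine ae_restrict_of_ae_restrict_of_subset (t := openUnitSquare) (fun p hp => hp.1) ?_
        filter_upwards [hz, (ae_openUnitSquare_iff_zero (P := fun s =>
          ζ s = stepFunction S c Δ s)).2 hstep] with p h1 h2
        rw [h1, h2]
      filter_upwards [h1, ae_restrict_mem (hP j)] with p h2 h3
      rw [h2]
      have h4 := filter_lt_eq_of_card_eq (S := S) (x := p 0) (x' := x₀) (h3.2.trans hx₀.symm)
      unfold stepFunction
      rw [← Finset.sum_filter, ← Finset.sum_filter, h4]
    · refine ⟨0, ?_⟩
      have : P j = ∅ := by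
        ext p
        simp only [mem_empty_iff_false, iff_false]
        exact fun h => hne ⟨_, h.2⟩
      rw [this]
      simp

theorem isBVpc_of_finite {K : Set Space3} (hint : IntegrableOn z openUnitSquare)
    (hz : ∀ᵐ p ∂volume.restrict openUnitSquare, z p = ζ (p 0))
    (hfin : (singularSet ζ).Finite) (hK : ∀ᵐ x : ℝ, x ∈ Ioo (0 : ℝ) 1 → ζ x ∈ K) :
    IsBVpc openUnitSquare K z := by
  refine ⟨isSBV_of_finite hint hz hfin, ?_, exists_partition_of_finite hz hfin⟩
  filter_upwards [hz, (ae_openUnitSquare_iff_zero (P := fun s => ζ s ∈ K)).2 hK] with p h1 h2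
  rwa [h1]

end Slices


/-! ### Caccioppoli partitions and functions of x -/

section BumpProfile

variable (ρ : ContDiffBump (0 : ℝ)) {x x' : ℝ}

/-- A smooth function that rises from `0` to `1` near `x` and falls back to `0` near `x'`. -/
def bumpProfile (x x' s : ℝ) : ℝ := ∫ u in (s - x')..(s - x), ρ.normed volume u

theorem hasDerivAt_bumpProfile (x x' s : ℝ) :
    HasDerivAt (bumpProfile ρ x x') (ρ.normed volume (s - x) - ρ.normed volume (s - x')) s := by
  have hi : ∀ a b : ℝ, IntervalIntegrable (ρ.normed volume) volume a b := fun a b =>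
    ρ.continuous_normed.intervalIntegrable a b
  have e : bumpProfile ρ x x' = fun s => (∫ u in (0 : ℝ)..(s - x), ρ.normed volume u) -
      ∫ u in (0 : ℝ)..(s - x'), ρ.normed volume u := by
    ext s
    unfold bumpProfile
    rw [intervalIntegral.integral_interval_sub_left (hi _ _) (hi _ _)]
  have d : ∀ x : ℝ, HasDerivAt (fun s => ∫ u in (0 : ℝ)..(s - x), ρ.normed volume u)
      (ρ.normed volume (s - x)) s := by
    intro x
    have h1 : HasDerivAt (fun s => ∫ u in (0 : ℝ)..s, ρ.normed volume u)
        (ρ.normed volume (s - x)) (s - x) :=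
      intervalIntegral.integral_hasDerivAt_right (hi _ _)
        (ρ.continuous_normed.stronglyMeasurableAtFilter _ _) ρ.continuous_normed.continuousAt
    exact h1.comp_sub_const s x
  rw [e]
  exact (d x).sub (d x')

theorem contDiff_bumpProfile : ContDiff ℝ 1 (bumpProfile ρ x x') := by
  rw [contDiff_one_iff_deriv]
  refine ⟨fun s => (hasDerivAt_bumpProfile ρ x x' s).differentiableAt, ?_⟩
  have : deriv (bumpProfile ρ x x') = fun s => ρ.normed volume (s - x) - ρ.normed volume (s - x') :=
    funext fun s => (hasDerivAt_bumpProfile ρ x x' s).deriv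
  rw [this]
  exact (ρ.continuous_normed.comp (continuous_sub_right x)).sub
    (ρ.continuous_normed.comp (continuous_sub_right x'))

theorem abs_bumpProfile_le (hxx : x ≤ x') (s : ℝ) : |bumpProfile ρ x x' s| ≤ 1 := by
  unfold bumpProfile
  have hle : s - x' ≤ s - x := by linarith
  rw [intervalIntegral.integral_of_le hle, abs_of_nonneg
    (integral_nonneg fun u => ρ.nonneg_normed u)]
  rw [← ρ.integral_normed (μ := volume)]
  exact setIntegral_le_integral ρ.integrable_normed
    (Eventually.of_forall fun u => ρ.nonneg_normed u)

theorem normed_eq_zero {u : ℝ} (hu : ρ.rOut ≤ |u|) : ρ.normed volume u = 0 := by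
  by_contra hc
  have : u ∈ Function.support (ρ.normed volume) := hc
  rw [ρ.support_normed_eq, Metric.mem_ball, Real.dist_eq, sub_zero] at this
  linarith

theorem bumpProfile_eq_zero (hxx : x ≤ x') {s : ℝ} (hs : s ≤ x - ρ.rOut ∨ x' + ρ.rOut ≤ s) :
    bumpProfile ρ x x' s = 0 := by
  unfold bumpProfile
  rw [intervalIntegral.integral_of_le (by linarith)]
  refine setIntegral_eq_zero_of_forall_eq_zero fun u hu => normed_eq_zero ρ ?_
  rcases hs with hs | hs
  · refine le_trans ?_ (neg_le_abs u)
    linarith [hu.2]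
  · refine le_trans ?_ (le_abs_self u)
    linarith [hu.1]

-- This brings mollified indicators into the form to which Lebesgue's differentiation theorem for
-- bump functions applies.
open scoped Convolution in
theorem integral_indicator_mul_normed {E : Set ℝ} (x : ℝ) :
    ∫ s, E.indicator (fun _ => (1 : ℝ)) s * ρ.normed volume (s - x) =
      (ρ.normed volume ⋆[ContinuousLinearMap.lsmul ℝ ℝ, volume] E.indicator fun _ => (1 : ℝ)) x := by
  rw [convolution_eq_swap]
  refine integral_congr_ae (Eventually.of_forall fun s => ?_)
  simp only [ContinuousLinearMap.lsmul_apply, smul_eq_mul]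
  rw [← ρ.normed_neg, neg_sub, mul_comm]

end BumpProfile

/-- A measurable function of the first variable that is constant on the elements of a Caccioppoli
partition has finitely many singular points. -/
theorem finite_singularSet_of_partition {ζ : ℝ → Space3} {z : Plane → Space3} (hζ : Measurable ζ)
    (hz : ∀ᵐ p ∂volume.restrict openUnitSquare, z p = ζ (p 0))
    {P : ℕ → Set Plane} (hP : IsCaccioppoliPartition openUnitSquare P)
    (hc : ∀ α, ∃ c, ∀ᵐ x ∂volume.restrict (P α), z x = c) : (singularSet ζ).Finite := by
  choose c hc using hc
  -- The cutoff in y, supported in [1/4, 3/4], keeps the test fields compactly supported in the open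
  -- square.
  set η : ContDiffBump (1 / 2 : ℝ) := ⟨1 / 8, 1 / 4, by norm_num, by norm_num⟩
  have hη0 : ∀ y, y ∉ Icc (1 / 4 : ℝ) (3 / 4) → η y = 0 := by
    intro y hy
    by_contra h
    have : y ∈ Function.support η := h
    rw [η.support_eq, Metric.mem_ball, Real.dist_eq] at this
    have := abs_lt.1 this
    have e : η.rOut = 1 / 4 := rfl
    rw [e] at this
    exact hy ⟨by linarith, by linarith⟩
  set κ := ∫ y in Ioo (0 : ℝ) 1, η y
  have hκ : 0 < κ := by
    have : κ = ∫ y, η y := by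
      refine setIntegral_eq_integral_of_forall_compl_eq_zero fun y hy => hη0 y fun hy' => hy ?_
      exact ⟨by linarith [hy'.1], by linarith [hy'.2]⟩
    rw [this]
    exact η.integral_pos
  -- Several elements of the partition may share a value, so the strip over a level set is in
  -- general a union of elements.
  set E : ℕ → Set ℝ := fun α => {s | s ∈ Ioo (0 : ℝ) 1 ∧ ζ s = c α}
  have hE : ∀ α, MeasurableSet (E α) := fun α =>
    measurableSet_Ioo.inter (hζ (measurableSet_singleton (c α)))
  have hpt : ∀ᵐ p ∂volume.restrict openUnitSquare, ∃ α, p ∈ P α ∧ z p = c α ∧ ζ (p 0) = c α := by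
    have h1 : ∀ᵐ p ∂volume.restrict openUnitSquare, p ∈ ⋃ α, P α := by
      rw [ae_iff, Measure.restrict_apply₀']
      · refine measure_mono_null ?_ hP.null_compl
        rintro p ⟨h1, h2⟩
        exact ⟨h2, h1⟩
      · exact measurableSet_openUnitSquare.nullMeasurableSet
    have h2 : ∀ᵐ p ∂volume.restrict openUnitSquare, ∀ α, p ∈ P α → z p = c α := by
      rw [ae_all_iff]
      intro α
      have := hc α
      rw [ae_restrict_iff' (hP.measurableSet α)] at this
      exact ae_restrict_of_ae this
    filter_upwards [h1, h2, hz] with p h1 h2 h3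
    obtain ⟨α, hα⟩ := mem_iUnion.1 h1
    exact ⟨α, hα, h2 α hα, h3.symm.trans (h2 α hα)⟩
  have hlevel : ∀ᵐ s : ℝ, s ∈ Ioo (0 : ℝ) 1 → ∃ α, ζ s = c α := by
    rw [← ae_openUnitSquare_iff_zero (P := fun s => ∃ α, ζ s = c α)]
    filter_upwards [hpt] with p hp
    obtain ⟨α, _, _, h⟩ := hp
    exact ⟨α, h⟩
  set ρ : ℕ → ContDiffBump (0 : ℝ) := fun n => ⟨1 / (n + 1) / 2, 1 / (n + 1), by positivity,
    half_lt_self (by positivity)⟩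
  have hρ : Tendsto (fun n => (ρ n).rOut) atTop (𝓝 0) := tendsto_one_div_add_atTop_nhds_zero_nat
  -- Almost every point is a density point of each level set or of its complement, for the countably
  -- many α at once.
  have hdens : ∀ᵐ s : ℝ, ∀ α, Tendsto (fun n => ∫ u, (E α).indicator (fun _ => (1 : ℝ)) u *
      (ρ n).normed volume (u - s)) atTop (𝓝 ((E α).indicator (fun _ => (1 : ℝ)) s)) := by
    rw [ae_all_iff]
    intro α
    have hg : LocallyIntegrable ((E α).indicator fun _ => (1 : ℝ)) volume :=
      (locallyIntegrable_const (1 : ℝ)).indicator (hE α)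
    have := ContDiffBump.ae_convolution_tendsto_right_of_locallyIntegrable (φ := ρ) (K := 2) hρ
      (Eventually.of_forall fun n => by simp only [ρ]; linarith) hg
    filter_upwards [this] with s hs
    refine hs.congr fun n => ?_
    rw [integral_indicator_mul_normed]
  -- Each singular point uses up κ/2 of the perimeter. Near t there are x < x' such that the level
  -- set of ζ(x) has density 1 at x and 0 at x'; a profile rising at x and falling at x', times the
  -- cutoff in y, detects this. The profiles of different t have disjoint supports, so one test
  -- field of norm at most 1 serves all t, with signs chosen for each element of the partition.
  have main : ∀ T : Finset ℝ, (T : Set ℝ) ⊆ singularSet ζ →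
      (T.card : ℝ≥0∞) * ENNReal.ofReal (κ / 2) ≤ ∑' α, perimeter (P α) openUnitSquare := by
    intro T hT
    obtain ⟨ε, hε, hε1, hε2⟩ := exists_separation T fun t ht => (hT ht).1
    have pairs : ∀ t ∈ T, ∃ (x x' : ℝ) (α : ℕ), t - ε < x ∧ x < x' ∧ x' < t + ε ∧
        (Tendsto (fun n => ∫ u, (E α).indicator (fun _ => (1 : ℝ)) u *
          (ρ n).normed volume (u - x)) atTop (𝓝 1)) ∧
        (Tendsto (fun n => ∫ u, (E α).indicator (fun _ => (1 : ℝ)) u *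
          (ρ n).normed volume (u - x')) atTop (𝓝 0)) := by
      intro t ht
      obtain ⟨e1, e2⟩ := hε1 t ht
      have hD : ∀ᵐ s : ℝ, s ∈ Ioo (t - ε) (t + ε) → s ∈ {s | s ∈ Ioo (0 : ℝ) 1 ∧ (∃ α, ζ s = c α) ∧
          ∀ α, Tendsto (fun n => ∫ u, (E α).indicator (fun _ => (1 : ℝ)) u *
          (ρ n).normed volume (u - s)) atTop (𝓝 ((E α).indicator (fun _ => (1 : ℝ)) s))} := by
        filter_upwards [hlevel, hdens] with s h1 h2 hs
        have hs' : s ∈ Ioo (0 : ℝ) 1 := ⟨by linarith [hs.1], by linarith [hs.2]⟩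
        exact ⟨hs', h1 hs', h2⟩
      obtain ⟨x, x', ⟨h1, ⟨α, h2⟩, h3⟩, ⟨h1', -, h3'⟩, hx1, hx2, hx3, hne⟩ :=
        exists_pair_of_not_aeConstAt (hT ht).2 hε hD
      refine ⟨x, x', α, hx1, hx2, hx3, ?_, ?_⟩
      · have := h3 α
        rwa [indicator_of_mem (show x ∈ E α from ⟨h1, h2⟩)] at this
      · have := h3' α
        rwa [indicator_of_notMem (fun h : x' ∈ E α => hne (h2.trans h.2.symm))] at this
    choose! x x' β hx1 hx2 hx3 hx4 hx5 using pairs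
    have ev : ∀ᶠ n in atTop, ∀ t ∈ T, t - ε < x t - (ρ n).rOut ∧ x' t + (ρ n).rOut < t + ε ∧
        3 / 4 < ∫ u, (E (β t)).indicator (fun _ => (1 : ℝ)) u * (ρ n).normed volume (u - x t) ∧
        ∫ u, (E (β t)).indicator (fun _ => (1 : ℝ)) u * (ρ n).normed volume (u - x' t) < 1 / 4 := by
      rw [Filter.eventually_all_finset]
      intro t ht
      have hx1 := hx1 t ht
      have hx3 := hx3 t ht
      filter_upwards [hρ.eventually (gt_mem_nhds (by linarith : 0 < x t - (t - ε))),
        hρ.eventually (gt_mem_nhds (by linarith : 0 < t + ε - x' t)),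
        (hx4 t ht).eventually (lt_mem_nhds (by norm_num : (3 / 4 : ℝ) < 1)),
        (hx5 t ht).eventually (gt_mem_nhds (by norm_num : (0 : ℝ) < 1 / 4))] with n h1 h2 h3 h4
      exact ⟨by linarith, by linarith, h3, h4⟩
    obtain ⟨n, hn⟩ := ev.exists
    set r := (ρ n).rOut
    set ψ : ℝ → ℝ → ℝ := fun t => bumpProfile (ρ n) (x t) (x' t)
    set ψ' : ℝ → ℝ → ℝ := fun t s =>
      (ρ n).normed volume (s - x t) - (ρ n).normed volume (s - x' t)
    have hψ'c : ∀ t, Continuous (ψ' t) := fun t =>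
      ((ρ n).continuous_normed.comp (continuous_sub_right _)).sub
        ((ρ n).continuous_normed.comp (continuous_sub_right _))
    have hψ0 : ∀ t ∈ T, ∀ s, s ∉ Icc (t - ε) (t + ε) → ψ t s = 0 := by
      intro t ht s hs
      obtain ⟨h1, h2, -, -⟩ := hn t ht
      refine bumpProfile_eq_zero _ (hx2 t ht).le ?_
      by_contra! hcon
      exact hs ⟨by linarith [hcon.1], by linarith [hcon.2]⟩
    set I : ℕ → ℝ → ℝ := fun α t => ∫ p in P α, ψ' t (p 0) * η (p 1)
    have hFint : ∀ t, IntegrableOn (fun p : Plane => ψ' t (p 0) * η (p 1)) openUnitSquare := by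
      intro t
      have hcont : Continuous fun p : Plane => ψ' t (p 0) * η (p 1) :=
        ((hψ'c t).comp (by fun_prop)).mul (η.continuous.comp (by fun_prop))
      have hcp : IsCompact (planeEquiv '' (Icc (0 : ℝ) 1 ×ˢ Icc (0 : ℝ) 1)) :=
        (isCompact_Icc.prod isCompact_Icc).image continuous_planeEquiv
      refine (hcont.continuousOn.integrableOn_compact hcp).mono_set ?_
      rintro p hp
      refine ⟨(p 0, p 1), ⟨Ioo_subset_Icc_self (hp 0), Ioo_subset_Icc_self (hp 1)⟩, ?_⟩
      ext i
      fin_cases i <;> rfl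
    have upper : ∀ α, ∑ t ∈ T, ‖I α t‖ₑ ≤ perimeter (P α) openUnitSquare := by
      intro α
      set sg : ℝ → ℝ := fun t => if 0 ≤ I α t then 1 else -1
      have hsg : ∀ t, sg t * I α t = ‖I α t‖ := by
        intro t
        simp only [sg]
        split_ifs with h
        · rw [one_mul, Real.norm_of_nonneg h]
        · rw [Real.norm_of_nonpos (not_le.1 h).le]; ring
      have hsg1 : ∀ t, |sg t| = 1 := by
        intro t
        simp only [sg]
        split_ifs <;> simp
      set G : ℝ → ℝ := fun s => ∑ t ∈ T, sg t * ψ t s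
      have hG : ContDiff ℝ 1 G := ContDiff.sum fun t _ =>
        contDiff_const.mul (contDiff_bumpProfile (ρ n))
      have hG' : ∀ s, HasDerivAt G (∑ t ∈ T, sg t * ψ' t s) s := by
        intro s
        have := HasDerivAt.fun_sum (u := T) (A := fun t s => sg t * ψ t s)
          (A' := fun t => sg t * ψ' t s) (x := s)
          fun t _ => (hasDerivAt_bumpProfile (ρ n) (x t) (x' t) s).const_mul (sg t)
        exact this
      have hG1 : ∀ s, |G s| ≤ 1 := by
        intro s
        by_cases hs : ∃ t ∈ T, s ∈ Icc (t - ε) (t + ε)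
        · obtain ⟨t, ht, hst⟩ := hs
          have : G s = sg t * ψ t s := by
            refine Finset.sum_eq_single_of_mem t ht fun t' ht' hne => ?_
            rw [hψ0 t' ht' s, mul_zero]
            intro hst'
            rcases lt_or_gt_of_ne hne with hlt | hlt
            · have := hε2 t' ht' t ht hlt
              linarith [hst'.2, hst.1]
            · have := hε2 t ht t' ht' hlt
              linarith [hst.2, hst'.1]
          rw [this, abs_mul, hsg1, one_mul]
          exact abs_bumpProfile_le _ (hx2 t ht).le s
        · push Not at hs
          have : G s = 0 := Finset.sum_eq_zero fun t ht => by rw [hψ0 t ht s (hs t ht), mul_zero]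
          rw [this, abs_zero]
          exact zero_le_one
      have hG0 : ∀ s, s ∉ ⋃ t ∈ T, Icc (t - ε) (t + ε) → G s = 0 := by
        intro s hs
        refine Finset.sum_eq_zero fun t ht => ?_
        rw [hψ0 t ht s fun h => hs (mem_biUnion ht h), mul_zero]
      set φ : Plane → Plane := fun p => (G (p 0) * η (p 1)) • EuclideanSpace.single 0 (1 : ℝ)
      set Kc : Set (ℝ × ℝ) := (⋃ t ∈ T, Icc (t - ε) (t + ε)) ×ˢ Icc (1 / 4 : ℝ) (3 / 4)
      have hKc : IsCompact (planeEquiv '' Kc) :=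
        ((T.isCompact_biUnion fun t _ => isCompact_Icc).prod isCompact_Icc).image
          continuous_planeEquiv
      have hsupp : Function.support φ ⊆ planeEquiv '' Kc := by
        intro p hp
        refine ⟨(p 0, p 1), ⟨?_, ?_⟩, ?_⟩
        · by_contra h
          exact hp (by simp only [φ]; rw [hG0 _ h, zero_mul, zero_smul])
        · by_contra h
          exact hp (by simp only [φ]; rw [hη0 _ h, mul_zero, zero_smul])
        · ext i
          fin_cases i <;> rfl
      have htsupp : tsupport φ ⊆ planeEquiv '' Kc := closure_minimal hsupp hKc.isClosed
      have hφ : ContDiff ℝ 1 φ := by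
        refine ContDiff.smul (ContDiff.mul (hG.comp (by fun_prop)) ?_) contDiff_const
        exact (η.contDiff (n := 1)).comp (by fun_prop)
      have hKΩ : planeEquiv '' Kc ⊆ openUnitSquare := by
        rintro _ ⟨⟨a, b⟩, ⟨ha, hb⟩, rfl⟩
        rw [← mem_preimage, preimage_openUnitSquare]
        simp only [mem_iUnion, exists_prop] at ha
        obtain ⟨t, ht, hat⟩ := ha
        obtain ⟨e1, e2⟩ := hε1 t ht
        exact ⟨⟨by linarith [hat.1], by linarith [hat.2]⟩, ⟨by linarith [hb.1], by linarith [hb.2]⟩⟩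
      have hle : ENNReal.ofReal (∫ p in P α, divergence φ p) ≤ perimeter (P α) openUnitSquare := by
        refine le_iSup₂_of_le φ ⟨hφ, ?_, htsupp.trans hKΩ, ?_⟩ le_rfl
        · exact hKc.of_isClosed_subset (isClosed_tsupport φ) htsupp
        · intro p
          simp only [φ]
          rw [norm_smul]
          simp only [PiLp.norm_single, norm_one, mul_one, norm_mul, Real.norm_eq_abs]
          have := hG1 (p 0)
          have h1 : |η (p 1)| ≤ 1 := by rw [abs_of_nonneg η.nonneg]; exact η.le_one
          nlinarith [abs_nonneg (G (p 0)), abs_nonneg (η (p 1))]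
      have hdiv : ∀ p : Plane, divergence φ p = ∑ t ∈ T, sg t * (ψ' t (p 0) * η (p 1)) := by
        intro p
        have e0 : (fun y => φ y 0) = fun p : Plane => G (p 0) * η (p 1) := by
          ext y; simp [φ]
        have e1 : (fun y => φ y 1) = fun _ => 0 := by
          ext y; simp [φ]
        unfold divergence
        rw [Fin.sum_univ_two, e0, e1]
        have d1 : partialDeriv 1 (fun _ : Plane => (0 : ℝ)) p = 0 := by
          simp [partialDeriv]
        have hGη : ContDiff ℝ 1 fun p : Plane => G (p 0) * η (p 1) :=
          ContDiff.mul (hG.comp (by fun_prop)) ((η.contDiff (n := 1)).comp (by fun_prop))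
        have d0 := hasDerivAt_comp_planeEquiv_zero hGη (p 0) (p 1)
        have ep : planeEquiv (p 0, p 1) = p := by
          ext i
          fin_cases i <;> rfl
        rw [ep] at d0
        have d0' : HasDerivAt (fun s => G (planeEquiv (s, p 1) 0) * η (planeEquiv (s, p 1) 1))
            ((∑ t ∈ T, sg t * ψ' t (p 0)) * η (p 1)) (p 0) := by
          simp only [planeEquiv_zero, planeEquiv_one]
          exact (hG' (p 0)).mul_const _
        rw [d0.unique d0', d1, add_zero, Finset.sum_mul]
        exact Finset.sum_congr rfl fun t _ => by ring
      have e3 : ∫ p in P α, divergence φ p = ∑ t ∈ T, ‖I α t‖ := by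
        simp_rw [hdiv]
        rw [integral_finsetSum]
        · refine Finset.sum_congr rfl fun t _ => ?_
          rw [integral_const_mul, hsg]
        · intro t _
          exact ((hFint t).mono_set (hP.subset α)).const_mul _
      rw [e3, ENNReal.ofReal_sum_of_nonneg fun t _ => norm_nonneg _] at hle
      simpa only [ofReal_norm] using hle
    have lower : ∀ t ∈ T, ENNReal.ofReal (κ / 2) ≤ ∑' α, ‖I α t‖ₑ := by
      intro t ht
      obtain ⟨-, -, h3, h4⟩ := hn t ht
      classical
      -- Up to a null set, these elements fill the strip over the level set `E (β t)`. The integral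
      -- is at least κ/2 on the strip, and the triangle inequality distributes it over the elements.
      set P' : ℕ → Set Plane := fun α => if c α = c (β t) then P α else ∅
      have hP'm : ∀ α, MeasurableSet (P' α) := by
        intro α
        simp only [P']
        split_ifs
        · exact hP.measurableSet α
        · exact MeasurableSet.empty
      have hP'sub : ∀ α, P' α ⊆ P α := by
        intro α
        simp only [P']
        split_ifs
        · exact subset_rfl
        · exact empty_subset _
      have hdisj : Pairwise (Function.onFun Disjoint P') := fun a b hab =>
        (hP.disjoint hab).mono (hP'sub a) (hP'sub b)
      have hsubΩ : (⋃ α, P' α) ⊆ openUnitSquare :=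
        iUnion_subset fun α => (hP'sub α).trans (hP.subset α)
      have hsum := hasSum_integral_iUnion hP'm hdisj ((hFint t).mono_set hsubΩ)
      have hval : ∫ p in ⋃ α, P' α, ψ' t (p 0) * η (p 1) =
          (∫ s, (E (β t)).indicator (fun _ => (1 : ℝ)) s * ψ' t s) * κ := by
        have e1 : ∫ p in ⋃ α, P' α, ψ' t (p 0) * η (p 1) = ∫ p in openUnitSquare,
            ((E (β t)).indicator (fun _ => (1 : ℝ)) (p 0) * ψ' t (p 0)) * η (p 1) := by
          rw [← inter_eq_self_of_subset_right hsubΩ,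
            ← setIntegral_indicator (MeasurableSet.iUnion hP'm)]
          refine integral_congr_ae ?_
          filter_upwards [hpt, ae_restrict_mem measurableSet_openUnitSquare] with p hp hpΩ
          obtain ⟨γ, hγ, h1, h2⟩ := hp
          have hiff : p ∈ ⋃ α, P' α ↔ p 0 ∈ E (β t) := by
            constructor
            · intro h
              obtain ⟨α, hα⟩ := mem_iUnion.1 h
              have hαγ : α = γ := by
                by_contra hne
                exact Set.disjoint_left.1 (hP.disjoint hne) (hP'sub α hα) hγ
              refine ⟨hpΩ 0, ?_⟩
              rw [h2, ← hαγ]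
              by_contra hne
              simp only [P', if_neg hne] at hα
              exact hα
            · intro h
              refine mem_iUnion.2 ⟨γ, ?_⟩
              simp only [P']
              rwa [if_pos (h2.symm.trans h.2)]
          by_cases hin : p 0 ∈ E (β t)
          · rw [indicator_of_mem (hiff.2 hin), indicator_of_mem hin, one_mul]
          · rw [indicator_of_notMem (fun h => hin (hiff.1 h)), indicator_of_notMem hin, zero_mul,
              zero_mul]
        rw [e1, integral_openUnitSquare]
        simp only [planeEquiv_zero, planeEquiv_one]
        rw [Measure.volume_eq_prod, setIntegral_prod_mul
          (fun s => (E (β t)).indicator (fun _ => (1 : ℝ)) s * ψ' t s) (fun y => η y)]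
        congr 1
        refine setIntegral_eq_integral_of_forall_compl_eq_zero fun s hs => ?_
        rw [indicator_of_notMem (fun h => hs h.1), zero_mul]
      have hconv : 1 / 2 ≤ ∫ s, (E (β t)).indicator (fun _ => (1 : ℝ)) s * ψ' t s := by
        have hint : ∀ y : ℝ, Integrable fun s => (E (β t)).indicator (fun _ => (1 : ℝ)) s *
            (ρ n).normed volume (s - y) := by
          intro y
          refine ((ρ n).integrable_normed.comp_sub_right y).bdd_mul (c := 1)
            ((measurable_const.indicator (hE _)).aestronglyMeasurable) ?_
          refine Eventually.of_forall fun s => ?_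
          refine (norm_indicator_le_norm_self _ _).trans ?_
          simp
        simp only [ψ', mul_sub]
        rw [integral_sub (hint _) (hint _)]
        linarith
      have hfin : κ / 2 ≤ ∫ p in ⋃ α, P' α, ψ' t (p 0) * η (p 1) := by
        rw [hval]
        nlinarith
      calc ENNReal.ofReal (κ / 2) ≤ ‖∫ p in ⋃ α, P' α, ψ' t (p 0) * η (p 1)‖ₑ := by
            rw [Real.enorm_eq_ofReal_abs]
            exact ENNReal.ofReal_le_ofReal (hfin.trans (le_abs_self _))
        _ ≤ ∑' α, ‖∫ p in P' α, ψ' t (p 0) * η (p 1)‖ₑ := by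
            rw [← hsum.tsum_eq]
            exact enorm_tsum_le_tsum_enorm
        _ ≤ ∑' α, ‖I α t‖ₑ := by
            refine ENNReal.tsum_le_tsum fun α => ?_
            simp only [P', I]
            split_ifs
            · exact le_rfl
            · simp
    calc (T.card : ℝ≥0∞) * ENNReal.ofReal (κ / 2) = ∑ t ∈ T, ENNReal.ofReal (κ / 2) := by
          rw [Finset.sum_const, nsmul_eq_mul]
      _ ≤ ∑ t ∈ T, ∑' α, ‖I α t‖ₑ := Finset.sum_le_sum lower
      _ = ∑' α, ∑ t ∈ T, ‖I α t‖ₑ :=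
          (Summable.tsum_finsetSum fun t _ => ENNReal.summable).symm
      _ ≤ _ := ENNReal.tsum_le_tsum upper
  by_contra hinf
  obtain ⟨M, hM⟩ := ENNReal.exists_nat_mul_gt (a := ENNReal.ofReal (κ / 2))
    (ENNReal.ofReal_pos.2 (half_pos hκ)).ne' hP.perimeter_lt_top.ne
  obtain ⟨T, hT, hcard⟩ := Set.Infinite.exists_subset_card_eq hinf M
  have := main T hT
  rw [hcard] at this
  exact absurd this (not_le.2 hM)


/-! ### Fields of bounded energy -/

/-- A sequence of spin fields, written row by row, of bounded energy. -/
structure IsFieldSequence (h lam : ℕ → ℝ) (Q : ℕ → Finset Space3) (u : ℕ → ℕ → ℕ → Space3)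
    (C D : ℝ) : Prop where
  norm_eq : ∀ n, ∀ m ≤ ⌊1 / lam n⌋₊, ∀ i ≤ ⌊1 / lam n⌋₊, ‖u n m i‖ = 1
  circle : ∀ n, ∀ m ≤ ⌊1 / lam n⌋₊, ∀ i ≤ ⌊1 / lam n⌋₊, ∃ q ∈ Q n, inner ℝ (u n m i) q = 0
  energy_le : ∀ n,
    ∑ m ∈ Finset.range (⌊1 / lam n⌋₊ + 1), lam n * rowEnergy (h n) ⌊1 / lam n⌋₊ (u n m) ≤ C
  vertical_le : ∀ n, ∑ m ∈ Finset.range ⌊1 / lam n⌋₊, ∑ i ∈ Finset.range (⌊1 / lam n⌋₊ + 1),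
    ‖u n (m + 1) i - u n m i‖ ^ 2 ≤ D * h n ^ 2

theorem lintegral_ofReal_floor_le {lam : ℝ} (hl : 0 < lam) (f : ℕ → ℝ)
    (hf : ∀ m, 0 ≤ f m) {C : ℝ} (hC : ∑ m ∈ Finset.range (⌊1 / lam⌋₊ + 1), lam * f m ≤ C) :
    ∫⁻ y in Ioo (0 : ℝ) 1, ENNReal.ofReal (f ⌊y / lam⌋₊) ≤ ENNReal.ofReal C := by
  have h1 := lintegral_floor hl (fun m => ENNReal.ofReal (f m)) (Nat.zero_le (⌊1 / lam⌋₊ + 1))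
  calc ∫⁻ y in Ioo (0 : ℝ) 1, ENNReal.ofReal (f ⌊y / lam⌋₊)
      ≤ ∫⁻ y in Ico (lam * (0 : ℕ)) (lam * ((⌊1 / lam⌋₊ + 1 : ℕ) : ℝ)),
          ENNReal.ofReal (f ⌊y / lam⌋₊) := by
        refine lintegral_mono_set ?_
        rintro y ⟨h0, h1⟩
        refine ⟨by simpa using h0.le, h1.trans_le ?_⟩
        have := (Nat.lt_floor_add_one (1 / lam)).le
        rw [div_le_iff₀ hl] at this
        push_cast
        linarith
    _ = ∑ m ∈ Finset.range (⌊1 / lam⌋₊ + 1), ENNReal.ofReal (lam * f m) := by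
        rw [h1, ← Finset.range_eq_Ico]
        exact Finset.sum_congr rfl fun m _ => (ENNReal.ofReal_mul hl.le).symm
    _ = ENNReal.ofReal (∑ m ∈ Finset.range (⌊1 / lam⌋₊ + 1), lam * f m) :=
        (ENNReal.ofReal_sum_of_nonneg fun m _ => mul_nonneg hl.le (hf m)).symm
    _ ≤ ENNReal.ofReal C := ENNReal.ofReal_le_ofReal hC

theorem norm_sub_sq_le_card_mul_sum {E : Type*} [NormedAddCommGroup E] (f : ℕ → E) {M a b : ℕ}
    (hab : a ≤ b) (hb : b ≤ M) :
    ‖f b - f a‖ ^ 2 ≤ M * ∑ m ∈ Finset.range M, ‖f (m + 1) - f m‖ ^ 2 := by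
  have h1 : ‖f b - f a‖ ≤ ∑ m ∈ Finset.Ico a b, ‖f (m + 1) - f m‖ := by
    rw [← Finset.sum_Ico_sub f hab]
    exact norm_sum_le _ _
  calc ‖f b - f a‖ ^ 2 ≤ (∑ m ∈ Finset.Ico a b, ‖f (m + 1) - f m‖) ^ 2 := by gcongr
    _ ≤ (Finset.Ico a b).card * ∑ m ∈ Finset.Ico a b, ‖f (m + 1) - f m‖ ^ 2 :=
        sq_sum_le_card_mul_sum_sq
    _ ≤ M * ∑ m ∈ Finset.range M, ‖f (m + 1) - f m‖ ^ 2 := by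
        have hs : Finset.Ico a b ⊆ Finset.range M := fun m hm => by
          rw [Finset.mem_Ico] at hm; rw [Finset.mem_range]; omega
        have hc : ((Finset.Ico a b).card : ℝ) ≤ M := by
          rw [Nat.card_Ico]; exact_mod_cast (Nat.sub_le b a).trans hb
        gcongr

/-- Cauchy–Schwarz over at most N vertical steps produces a factor N, which λ cancels since λN ≤ 1.
The bound does not depend on the distance of the two rows. -/
theorem IsFieldSequence.lam_mul_sum_norm_sub_sq_le {h lam : ℕ → ℝ} {k : ℕ → ℕ}
    {Q : ℕ → Finset Space3} {u : ℕ → ℕ → ℕ → Space3} {C D : ℝ} (H : IsScaling h lam k Q)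
    (A : IsFieldSequence h lam Q u C D) (n : ℕ) {a b : ℕ} (ha : a ≤ ⌊1 / lam n⌋₊)
    (hb : b ≤ ⌊1 / lam n⌋₊) :
    lam n * ∑ i ∈ Finset.range (⌊1 / lam n⌋₊ + 1), ‖u n a i - u n b i‖ ^ 2 ≤ D * h n ^ 2 := by
  set N := ⌊1 / lam n⌋₊ with hN
  have hl := H.lam_pos n
  have hNl : lam n * N ≤ 1 := by
    have := Nat.floor_le (show 0 ≤ 1 / lam n by positivity)
    rw [le_div_iff₀ hl] at this
    linarith
  have key : ∀ i, ‖u n a i - u n b i‖ ^ 2 ≤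
      N * ∑ m ∈ Finset.range N, ‖u n (m + 1) i - u n m i‖ ^ 2 := by
    intro i
    rcases le_total a b with hab | hab
    · rw [norm_sub_rev]
      exact norm_sub_sq_le_card_mul_sum (fun m => u n m i) hab hb
    · exact norm_sub_sq_le_card_mul_sum (fun m => u n m i) hab ha
  calc lam n * ∑ i ∈ Finset.range (N + 1), ‖u n a i - u n b i‖ ^ 2
      ≤ lam n * ∑ i ∈ Finset.range (N + 1),
          (N * ∑ m ∈ Finset.range N, ‖u n (m + 1) i - u n m i‖ ^ 2) := by
        gcongr with i _; exact key i
    _ = (lam n * N) * ∑ m ∈ Finset.range N, ∑ i ∈ Finset.range (N + 1),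
          ‖u n (m + 1) i - u n m i‖ ^ 2 := by
        rw [← Finset.mul_sum, Finset.sum_comm, mul_assoc]
    _ ≤ 1 * ∑ m ∈ Finset.range N, ∑ i ∈ Finset.range (N + 1),
          ‖u n (m + 1) i - u n m i‖ ^ 2 := by gcongr
    _ ≤ D * h n ^ 2 := by rw [one_mul]; exact A.vertical_le n

theorem IsFieldSequence.comp {h lam : ℕ → ℝ}
    {Q : ℕ → Finset Space3} {u : ℕ → ℕ → ℕ → Space3} {C D : ℝ}
    (A : IsFieldSequence h lam Q u C D) (φ : ℕ → ℕ) :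
    IsFieldSequence (h ∘ φ) (lam ∘ φ) (Q ∘ φ) (u ∘ φ) C D where
  norm_eq _ := A.norm_eq _
  circle _ := A.circle _
  energy_le _ := A.energy_le _
  vertical_le _ := A.vertical_le _

theorem floor_div_le_floor {lam y : ℝ} (hl : 0 < lam) (hy : y ∈ Ioo (0 : ℝ) 1) :
    ⌊y / lam⌋₊ ≤ ⌊1 / lam⌋₊ := Nat.floor_mono (by have := hy.2.le; gcongr)

theorem IsFieldSequence.isRowSequence {h lam : ℕ → ℝ} {k : ℕ → ℕ}
    {Q : ℕ → Finset Space3} {u : ℕ → ℕ → ℕ → Space3} {C D B : ℝ} (H : IsScaling h lam k Q)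
    (A : IsFieldSequence h lam Q u C D) {y : ℝ} (hy : y ∈ Ioo (0 : ℝ) 1)
    (hB : ∀ n, rowEnergy (h n) ⌊1 / lam n⌋₊ (u n ⌊y / lam n⌋₊) ≤ B) :
    IsRowSequence h lam Q (fun n => u n ⌊y / lam n⌋₊) B where
  norm_eq n := A.norm_eq n _ (floor_div_le_floor (H.lam_pos n) hy)
  circle n := A.circle n _ (floor_div_le_floor (H.lam_pos n) hy)
  energy_le := hB

theorem IsFieldSequence.lintegral_liminf_le {h lam : ℕ → ℝ} {k : ℕ → ℕ}
    {Q : ℕ → Finset Space3} {u : ℕ → ℕ → ℕ → Space3} {C D : ℝ} (H : IsScaling h lam k Q)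
    (A : IsFieldSequence h lam Q u C D) :
    ∫⁻ y in Ioo (0 : ℝ) 1, liminf (fun n =>
      ENNReal.ofReal (rowEnergy (h n) ⌊1 / lam n⌋₊ (u n ⌊y / lam n⌋₊))) atTop ≤ ENNReal.ofReal C := by
  have hm : ∀ n, Measurable fun y : ℝ =>
      ENNReal.ofReal (rowEnergy (h n) ⌊1 / lam n⌋₊ (u n ⌊y / lam n⌋₊)) := fun n =>
    (measurable_from_nat (f := fun m => ENNReal.ofReal (rowEnergy (h n) ⌊1 / lam n⌋₊ (u n m)))).comp
      (Nat.measurable_floor.comp (measurable_id.div_const _))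
  refine (MeasureTheory.lintegral_liminf_le hm).trans ?_
  refine (liminf_le_liminf (Eventually.of_forall fun n =>
    lintegral_ofReal_floor_le (H.lam_pos n)
    (fun m => rowEnergy (h n) ⌊1 / lam n⌋₊ (u n m)) (fun m => rowEnergy_nonneg (H.h_pos n))
    (A.energy_le n))).trans ?_
  simp

/-- From a finite lower limit one extracts a bounded subsequence. -/
theorem exists_subseq_le_of_liminf_lt {f : ℕ → ℝ} {B : ℝ}
    (hB : liminf (fun n => ENNReal.ofReal (f n)) atTop < ENNReal.ofReal B) :
    ∃ φ : ℕ → ℕ, StrictMono φ ∧ ∀ n, f (φ n) ≤ B := by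
  obtain ⟨φ, h1, h2⟩ := extraction_of_frequently_atTop (frequently_lt_of_liminf_lt (by isBoundedDefault) hB)
  refine ⟨φ, h1, fun n => ?_⟩
  have h3 := h2 n
  by_contra! hc
  exact absurd h3 (not_lt.2 (ENNReal.ofReal_le_ofReal hc.le))

/-- The upper Kuratowski limit passes to subsequences: a selection along φ is completed by arbitrary
elements of the other sets, which keeps its cluster points. -/
theorem mapClusterPt_extend {Q : ℕ → Finset Space3} {Qbar : Set Space3} (hne : ∀ n, (Q n).Nonempty)
    (hQbar : ∀ x : ℕ → Space3, (∀ n, x n ∈ Q n) → ∀ a, MapClusterPt a atTop x → a ∈ Qbar)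
    {φ : ℕ → ℕ} (hφ : StrictMono φ) (x : ℕ → Space3) (hx : ∀ n, x n ∈ (Q ∘ φ) n) (a : Space3)
    (ha : MapClusterPt a atTop x) : a ∈ Qbar := by
  classical
  have hinj := hφ.injective
  choose y hy using hne
  refine hQbar (fun m => if hm : ∃ n, φ n = m then x hm.choose else y m) ?_ a ?_
  · intro m
    by_cases hm : ∃ n, φ n = m
    · simp only [hm, dif_pos]
      have := hx hm.choose
      simp only [Function.comp, hm.choose_spec] at this
      exact this
    · simp only [hm, dif_neg, not_false_iff]; exact hy m
  · refine MapClusterPt.of_comp hφ.tendsto_atTop (x := a) ?_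
    convert ha using 1
    funext n
    have hm : ∃ n', φ n' = φ n := ⟨n, rfl⟩
    simp only [Function.comp, hm, dif_pos]
    congr 1
    exact hinj hm.choose_spec

/-- Compactness and lower bound for fields of bounded energy. -/
theorem IsFieldSequence.limit {h lam : ℕ → ℝ} {k : ℕ → ℕ}
    {Q : ℕ → Finset Space3} {u : ℕ → ℕ → ℕ → Space3} {C D C' : ℝ} (H : IsScaling h lam k Q)
    (A : IsFieldSequence h lam Q u C D) (hC : 0 ≤ C) (hCC' : C < C') {Qbar : Set Space3}
    (hQbar : ∀ x : ℕ → Space3, (∀ n, x n ∈ Q n) → ∀ a, MapClusterPt a atTop x → a ∈ Qbar)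
    {z : Plane → Space3} (hzm : Measurable z)
    (hz : ∀ᵐ q : ℝ × ℝ, q.1 ∈ Ioo (0 : ℝ) 1 → q.2 ∈ Ioo (0 : ℝ) 1 →
      Tendsto (fun n => rowChir (h n) (u n ⌊q.2 / lam n⌋₊) ⌊q.1 / lam n⌋₊) atTop
        (𝓝 (z (planeEquiv q)))) :
    ∃ ζ : ℝ → Space3, (∀ᵐ p ∂volume.restrict openUnitSquare, z p = ζ (p 0)) ∧
      (singularSet ζ).Finite ∧ 8 / 3 * ((singularSet ζ).ncard : ℝ) ≤ C' ∧
      ∀ᵐ x : ℝ, x ∈ Ioo (0 : ℝ) 1 → ζ x ∈ Qbar ∪ {q | -q ∈ Qbar} := by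
  have hne : ∀ n, (Q n).Nonempty := fun n => by
    rw [← Finset.card_pos, H.card_eq]; exact H.k_pos n
  have hz' : ∀ᵐ q : ℝ × ℝ, q.1 ∈ Ioo (0 : ℝ) 1 → q.2 ∈ Ioo (0 : ℝ) 1 →
      Tendsto (fun n => rowChir (h n) (u n ⌊q.1 / lam n⌋₊) ⌊q.2 / lam n⌋₊) atTop
        (𝓝 (z (planeEquiv q.swap))) := by
    have := (Measure.measurePreserving_swap (μ := (volume : Measure ℝ))
      (ν := (volume : Measure ℝ))).quasiMeasurePreserving.ae hz
    filter_upwards [this] with q hq h1 h2 using hq h2 h1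
  have hslice : ∀ᵐ y : ℝ, y ∈ Ioo (0 : ℝ) 1 → ∀ᵐ x : ℝ, x ∈ Ioo (0 : ℝ) 1 →
      Tendsto (fun n => rowChir (h n) (u n ⌊y / lam n⌋₊) ⌊x / lam n⌋₊) atTop
        (𝓝 (z (planeEquiv (x, y)))) := by
    filter_upwards [Measure.ae_ae_of_ae_prod hz'] with y hy hyI
    filter_upwards [hy] with x hx hxI using hx hyI hxI
  -- a good row
  have hgood : ∃ y₀ ∈ Ioo (0 : ℝ) 1, (∀ᵐ x : ℝ, x ∈ Ioo (0 : ℝ) 1 →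
      Tendsto (fun n => rowChir (h n) (u n ⌊y₀ / lam n⌋₊) ⌊x / lam n⌋₊) atTop
        (𝓝 (z (planeEquiv (x, y₀))))) ∧ liminf (fun n =>
      ENNReal.ofReal (rowEnergy (h n) ⌊1 / lam n⌋₊ (u n ⌊y₀ / lam n⌋₊))) atTop <
        ENNReal.ofReal C' := by
    -- If no row were good, the lower limit would be at least C' on almost every row, against the
    -- bound C < C' of its integral.
    by_contra! hc
    have h1 : ∀ᵐ y ∂volume.restrict (Ioo (0 : ℝ) 1), ENNReal.ofReal C' ≤ liminf (fun n =>
        ENNReal.ofReal (rowEnergy (h n) ⌊1 / lam n⌋₊ (u n ⌊y / lam n⌋₊))) atTop := by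
      rw [ae_restrict_iff' measurableSet_Ioo]
      filter_upwards [hslice] with y hy hyI using hc y hyI (hy hyI)
    have h2 := (lintegral_mono_ae h1).trans (A.lintegral_liminf_le H)
    rw [setLIntegral_const, Real.volume_Ioo, sub_zero, ENNReal.ofReal_one, mul_one,
      ENNReal.ofReal_le_ofReal_iff hC] at h2
    linarith
  obtain ⟨y₀, hy₀, hconv, hlim⟩ := hgood
  obtain ⟨φ, hφ, hφB⟩ := exists_subseq_le_of_liminf_lt hlim
  have Hφ := H.comp hφ
  have Aφ := A.comp φ
  have R₀ : IsRowSequence (h ∘ φ) (lam ∘ φ) (Q ∘ φ) (fun n => (u ∘ φ) n ⌊y₀ / (lam ∘ φ) n⌋₊) C' :=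
    Aφ.isRowSequence Hφ hy₀ hφB
  have hconv₀ : ∀ᵐ x : ℝ, x ∈ Ioo (0 : ℝ) 1 →
      Tendsto (fun n => rowChir ((h ∘ φ) n) ((u ∘ φ) n ⌊y₀ / (lam ∘ φ) n⌋₊) ⌊x / (lam ∘ φ) n⌋₊)
        atTop (𝓝 (z (planeEquiv (x, y₀)))) := by
    filter_upwards [hconv] with x hx hxI using (hx hxI).comp hφ.tendsto_atTop
  set ζ : ℝ → Space3 := fun x => z (planeEquiv (x, y₀)) with hζ
  refine ⟨ζ, ?_, (R₀.finite_singularSet Hφ hconv₀).1, (R₀.finite_singularSet Hφ hconv₀).2,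
    R₀.ae_mem Hφ (fun x hx a ha => mapClusterPt_extend hne hQbar hφ x hx a ha) hconv₀⟩
  rw [ae_openUnitSquare_iff]
  -- For almost every y a further subsequence bounds the energy of the row at y. Both this
  -- subsequence and the bound depend on y, which is enough for the comparison with the row at y₀.
  have hrow : ∀ᵐ y : ℝ, y ∈ Ioo (0 : ℝ) 1 → ∀ᵐ x : ℝ, x ∈ Ioo (0 : ℝ) 1 →
      z (planeEquiv (x, y)) = ζ x := by
    have h1 : ∀ᵐ y ∂volume.restrict (Ioo (0 : ℝ) 1), liminf (fun n => ENNReal.ofReal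
        (rowEnergy ((h ∘ φ) n) ⌊1 / (lam ∘ φ) n⌋₊ ((u ∘ φ) n ⌊y / (lam ∘ φ) n⌋₊))) atTop < ⊤ := by
      refine ae_lt_top (Measurable.liminf fun n => ?_)
        ((Aφ.lintegral_liminf_le Hφ).trans_lt ENNReal.ofReal_lt_top).ne
      exact ((measurable_from_nat (f := fun m => ENNReal.ofReal (rowEnergy ((h ∘ φ) n)
        ⌊1 / (lam ∘ φ) n⌋₊ ((u ∘ φ) n m)))).comp
        (Nat.measurable_floor.comp (measurable_id.div_const _)))
    rw [ae_restrict_iff' measurableSet_Ioo] at h1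
    filter_upwards [h1, hslice] with y hy hyc hyI
    obtain ⟨B, hB⟩ : ∃ B : ℝ, liminf (fun n => ENNReal.ofReal
        (rowEnergy ((h ∘ φ) n) ⌊1 / (lam ∘ φ) n⌋₊ ((u ∘ φ) n ⌊y / (lam ∘ φ) n⌋₊))) atTop <
          ENNReal.ofReal B := by
      obtain ⟨r, hr, -⟩ := ENNReal.lt_iff_exists_nnreal_btwn.1 (hy hyI)
      exact ⟨r, by rwa [ENNReal.ofReal_coe_nnreal]⟩
    obtain ⟨ψ, hψ, hψB⟩ := exists_subseq_le_of_liminf_lt hB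
    have Hψ := Hφ.comp hψ
    have Aψ := Aφ.comp ψ
    have R : IsRowSequence ((h ∘ φ) ∘ ψ) ((lam ∘ φ) ∘ ψ) ((Q ∘ φ) ∘ ψ)
        (fun n => ((u ∘ φ) ∘ ψ) n ⌊y / ((lam ∘ φ) ∘ ψ) n⌋₊) B := Aψ.isRowSequence Hψ hyI hψB
    have R' : IsRowSequence ((h ∘ φ) ∘ ψ) ((lam ∘ φ) ∘ ψ) ((Q ∘ φ) ∘ ψ)
        (fun n => ((u ∘ φ) ∘ ψ) n ⌊y₀ / ((lam ∘ φ) ∘ ψ) n⌋₊) C' :=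
      Aψ.isRowSequence Hψ hy₀ fun n => hφB (ψ n)
    refine R.ae_eq Hψ R' (C := D) (fun n => Aψ.lam_mul_sum_norm_sub_sq_le Hψ n
      (floor_div_le_floor (Hψ.lam_pos n) hyI) (floor_div_le_floor (Hψ.lam_pos n) hy₀)) ?_ ?_
    · filter_upwards [hyc hyI] with x hx hxI
      exact ((hx hxI).comp hφ.tendsto_atTop).comp hψ.tendsto_atTop
    · filter_upwards [hconv₀] with x hx hxI using (hx hxI).comp hψ.tendsto_atTop
  -- Passing from almost every slice to almost every point needs a measurable set; this is why z is
  -- taken measurable.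
  have hmeas : MeasurableSet {q : ℝ × ℝ | q.1 ∈ Ioo (0 : ℝ) 1 → q.2 ∈ Ioo (0 : ℝ) 1 →
      z (planeEquiv q.swap) = ζ q.2} := by
    have e : {q : ℝ × ℝ | q.1 ∈ Ioo (0 : ℝ) 1 → q.2 ∈ Ioo (0 : ℝ) 1 →
        z (planeEquiv q.swap) = ζ q.2} = (Prod.fst ⁻¹' Ioo (0 : ℝ) 1)ᶜ ∪
          ((Prod.snd ⁻¹' Ioo (0 : ℝ) 1)ᶜ ∪ {q | z (planeEquiv q.swap) = ζ q.2}) := by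
      ext q; simp only [mem_union, mem_compl_iff, mem_preimage, mem_ofPred_eq]; tauto
    rw [e]
    refine (measurable_fst measurableSet_Ioo).compl.union
      ((measurable_snd measurableSet_Ioo).compl.union (measurableSet_eq_fun ?_ ?_))
    · exact hzm.comp (planeEquiv.measurable.comp measurable_swap)
    · exact (hzm.comp (planeEquiv.measurable.comp (measurable_id.prodMk measurable_const))).comp
        measurable_snd
  have hsw : ∀ᵐ q : ℝ × ℝ, q.1 ∈ Ioo (0 : ℝ) 1 → q.2 ∈ Ioo (0 : ℝ) 1 →
      z (planeEquiv q.swap) = ζ q.2 := by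
    refine (Measure.ae_prod_iff_ae_ae hmeas).2 ?_
    filter_upwards [hrow] with y hy
    by_cases hyI : y ∈ Ioo (0 : ℝ) 1
    · filter_upwards [hy hyI] with x hx _ hxI using hx hxI
    · exact Eventually.of_forall fun x h => absurd h hyI
  filter_upwards [(Measure.measurePreserving_swap (μ := (volume : Measure ℝ))
      (ν := (volume : Measure ℝ))).quasiMeasurePreserving.ae hsw] with q hq h1 h2
  rw [planeEquiv_zero]
  exact hq h2 h1


/-! ### From the lattice to rows; the limit functional and the lower bound -/

theorem floor_eq_natFloor {lam : ℝ} (hl : 0 < lam) : ⌊1 / lam⌋ = (⌊1 / lam⌋₊ : ℤ) :=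
  (Int.natCast_floor_eq_floor (by positivity)).symm

/-- The pairs of natural numbers as points of the lattice `ℤ²`. -/
def natPair : ℕ × ℕ ↪ ℤ × ℤ := (Nat.castEmbedding.prodMap Nat.castEmbedding)

theorem natPair_apply (p : ℕ × ℕ) : natPair p = ((p.1 : ℤ), (p.2 : ℤ)) := rfl

theorem mem_map_natPair (s t : Finset ℕ) (i : ℤ × ℤ) :
    i ∈ (s ×ˢ t).map natPair ↔ 0 ≤ i.1 ∧ 0 ≤ i.2 ∧ i.1.toNat ∈ s ∧ i.2.toNat ∈ t := by
  rw [Finset.mem_map]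
  constructor
  · rintro ⟨⟨a, b⟩, hp, rfl⟩
    simpa [natPair_apply] using hp
  · rintro ⟨h1, h2, h3, h4⟩
    exact ⟨(i.1.toNat, i.2.toNat), by simp [h3, h4], by
      rw [natPair_apply]; ext <;> simp [h1, h2]⟩

theorem latticeR1_eq {lam : ℝ} (hl : 0 < lam) :
    latticeR1 lam =
      (Finset.range (⌊1 / lam⌋₊ - 1) ×ˢ Finset.range (⌊1 / lam⌋₊ + 1)).map natPair := by
  ext i
  rw [mem_map_natPair, latticeR1, lattice, floor_eq_natFloor hl]
  simp only [Finset.mem_filter, Finset.mem_product, Finset.mem_Icc, Finset.mem_range]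
  omega

theorem latticeR2_eq {lam : ℝ} (hl : 0 < lam) :
    latticeR2 lam =
      (Finset.range (⌊1 / lam⌋₊ + 1) ×ˢ Finset.range ⌊1 / lam⌋₊).map natPair := by
  ext i
  rw [mem_map_natPair, latticeR2, lattice, floor_eq_natFloor hl]
  simp only [Finset.mem_filter, Finset.mem_product, Finset.mem_Icc, Finset.mem_range]
  omega

/-- The rows of a spin field. -/
def spinRow (u : ℤ × ℤ → Space3) (m i : ℕ) : Space3 := u ((i : ℤ), (m : ℤ))

/-- As h³ = 2√2 δ^{3/2}, the horizontal terms become λ|·|²/h³, that is, a Riemann sum in y of row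
energies. In the vertical term the factor J λ/√δ appears, which is bounded below by hypothesis in
the lower bound. -/
theorem spinEnergy_div {lam δ J : ℝ} (hl : 0 < lam) (hδ : 0 < δ) (u : ℤ × ℤ → Space3) :
    spinEnergy lam δ J u / (√2 * lam * δ ^ (3 / 2 : ℝ)) =
      ∑ m ∈ Finset.range (⌊1 / lam⌋₊ + 1), lam * rowEnergy √(2 * δ) ⌊1 / lam⌋₊ (spinRow u m) +
      J * (lam / √δ) / (√2 * √(2 * δ) ^ 2) * ∑ m ∈ Finset.range ⌊1 / lam⌋₊,
        ∑ i ∈ Finset.range (⌊1 / lam⌋₊ + 1), ‖spinRow u (m + 1) i - spinRow u m i‖ ^ 2 := by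
  set N := ⌊1 / lam⌋₊
  set h := √(2 * δ) with hh
  have hh0 : 0 < h := Real.sqrt_pos.2 (by positivity)
  have hh2 : h ^ 2 = 2 * δ := Real.sq_sqrt (by positivity)
  have hs : h = √2 * √δ := Real.sqrt_mul (by norm_num) δ
  have hsδ : 0 < √δ := Real.sqrt_pos.2 hδ
  have h2 : √2 ^ 2 = 2 := Real.sq_sqrt (by norm_num)
  have hδs : √δ ^ 2 = δ := Real.sq_sqrt hδ.le
  have h20 : (0 : ℝ) < √2 := by positivity
  have hδ32 : δ ^ (3 / 2 : ℝ) = √δ ^ 3 := by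
    rw [Real.sqrt_eq_rpow, ← Real.rpow_natCast, ← Real.rpow_mul hδ.le]; norm_num
  have e1 : ∑ i ∈ latticeR1 lam,
      lam ^ 2 * ‖u i - (2 * (1 - δ)) • u (i.1 + 1, i.2) + u (i.1 + 2, i.2)‖ ^ 2 =
      lam * h ^ 3 * ∑ m ∈ Finset.range (N + 1), lam * rowEnergy h N (spinRow u m) := by
    rw [latticeR1_eq hl, Finset.sum_map, Finset.sum_product, Finset.sum_comm, Finset.mul_sum]
    refine Finset.sum_congr rfl fun m _ => ?_
    rw [rowEnergy, Finset.mul_sum, Finset.mul_sum]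
    refine Finset.sum_congr rfl fun i _ => ?_
    have hc : 2 * (1 - δ) = 2 - h ^ 2 := by rw [hh2]; ring
    rw [hc, natPair_apply]
    simp only [spinRow]
    push_cast
    field_simp
  have e2 : ∑ i ∈ latticeR2 lam, lam ^ 2 * ‖u (i.1, i.2 + 1) - u i‖ ^ 2 =
      lam ^ 2 * ∑ m ∈ Finset.range N, ∑ i ∈ Finset.range (N + 1),
        ‖spinRow u (m + 1) i - spinRow u m i‖ ^ 2 := by
    rw [latticeR2_eq hl, Finset.sum_map, Finset.sum_product, Finset.sum_comm, Finset.mul_sum]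
    refine Finset.sum_congr rfl fun m _ => ?_
    rw [Finset.mul_sum]
    refine Finset.sum_congr rfl fun i _ => ?_
    rw [natPair_apply]
    simp only [spinRow]
    push_cast
    rfl
  rw [spinEnergy, e1, e2, hδ32]
  set S1 := ∑ m ∈ Finset.range (N + 1), lam * rowEnergy h N (spinRow u m)
  set S2 := ∑ m ∈ Finset.range N, ∑ i ∈ Finset.range (N + 1),
        ‖spinRow u (m + 1) i - spinRow u m i‖ ^ 2
  rw [hs]
  -- The roots become indeterminates with known squares, and only powers of √2 remain to be reduced.
  generalize √δ = s at *
  generalize √2 = r at *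
  field_simp
  have h5 : r ^ 5 = 4 * r := by rw [show r ^ 5 = (r ^ 2) ^ 2 * r by ring, h2]; norm_num
  have h3 : r ^ 3 = 2 * r := by rw [show r ^ 3 = r ^ 2 * r by ring, h2]
  ring_nf
  simp only [h5, h3, h2]
  ring

/-- The minimum is the convention for the last column; `1 ≤ N` lets the natural subtraction agree
with that of the integers. -/
theorem chiralityField_eq {lam δ : ℝ} (hl : 0 < lam) (u : ℤ × ℤ → Space3) {p : Plane}
    (h0 : 0 ≤ p 0) (h1 : 0 ≤ p 1) (hN : 1 ≤ ⌊1 / lam⌋₊) :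
    chiralityField lam δ u p =
      rowChir √(2 * δ) (spinRow u ⌊p 1 / lam⌋₊) (min ⌊p 0 / lam⌋₊ (⌊1 / lam⌋₊ - 1)) := by
  rw [chiralityField, chirality, rowChir, floor_eq_natFloor hl,
    ← Int.natCast_floor_eq_floor (show 0 ≤ p 0 / lam by positivity),
    ← Int.natCast_floor_eq_floor (show 0 ≤ p 1 / lam by positivity)]
  have : min (⌊p 0 / lam⌋₊ : ℤ) (⌊1 / lam⌋₊ - 1) =
      ((min ⌊p 0 / lam⌋₊ (⌊1 / lam⌋₊ - 1) : ℕ) : ℤ) := by omega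
  simp only [this, spinRow]
  push_cast
  rfl

/-- The hypotheses translate through h = √2 √δ and √h = 2^{1/4} δ^{1/4}. -/
theorem isScaling_of_tendsto {lam δ : ℕ → ℝ} {k : ℕ → ℕ} {Q : ℕ → Finset Space3}
    (hlam : ∀ n, 0 < lam n) (hδ : ∀ n, 0 < δ n)
    (hlam0 : Tendsto lam atTop (𝓝 0)) (hδ0 : Tendsto δ atTop (𝓝 0))
    (hk : ∀ n, 0 < k n) (hQk : ∀ n, (Q n).card = k n) (hQ : ∀ n, ∀ q ∈ Q n, ‖q‖ = 1)
    (hkδ : Tendsto (fun n => (k n : ℝ) * δ n ^ (1 / 4 : ℝ)) atTop (𝓝 0))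
    (hlamδ : Tendsto (fun n => lam n / √(δ n)) atTop (𝓝 0)) :
    IsScaling (fun n => √(2 * δ n)) lam k Q where
  h_pos n := Real.sqrt_pos.2 (by have := hδ n; positivity)
  h_tendsto := by
    have : Tendsto (fun n => √(2 * δ n)) atTop (𝓝 √(2 * 0)) :=
      (Real.continuous_sqrt.tendsto _).comp (hδ0.const_mul 2)
    simpa using this
  lam_pos := hlam
  lam_tendsto := hlam0
  ratio_tendsto := by
    have := hlamδ.const_mul (√2)⁻¹
    rw [mul_zero] at this
    refine this.congr fun n => ?_
    rw [Real.sqrt_mul (by norm_num)]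
    have := Real.sqrt_pos.2 (hδ n)
    field_simp
  k_pos := hk
  k_tendsto := by
    have := hkδ.const_mul (√√2)
    rw [mul_zero] at this
    refine this.congr fun n => ?_
    rw [Real.sqrt_mul (by norm_num), Real.sqrt_mul (by positivity)]
    have : δ n ^ (1 / 4 : ℝ) = √√(δ n) := by
      rw [Real.sqrt_eq_rpow, Real.sqrt_eq_rpow, ← Real.rpow_mul (hδ n).le]; norm_num
    rw [this]; ring
  card_eq := hQk
  norm_eq := hQ

theorem ae_unitSquare_iff {P : Plane → Prop} :
    (∀ᵐ p ∂volume.restrict unitSquare, P p) ↔ ∀ᵐ p ∂volume.restrict openUnitSquare, P p := by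
  rw [restrict_unitSquare]

theorem measurable_coeFn (z : L1Square) : Measurable (z : Plane → Space3) :=
  (Lp.stronglyMeasurable z).measurable

theorem integrableOn_coeFn (z : L1Square) : IntegrableOn (z : Plane → Space3) openUnitSquare := by
  have : IntegrableOn (z : Plane → Space3) unitSquare := L1.integrable_coeFn z
  exact this.congr_set_ae unitSquare_ae_eq.symm

theorem limitEnergy_of_ae_eq {K : Set Space3} {z : L1Square} {ζ : ℝ → Space3}
    (hz : ∀ᵐ p ∂volume.restrict openUnitSquare, z p = ζ (p 0))
    (hfin : (singularSet ζ).Finite) (hK : ∀ᵐ x : ℝ, x ∈ Ioo (0 : ℝ) 1 → ζ x ∈ K) :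
    limitEnergy K z = 8 / 3 * ((singularSet ζ).ncard : ℝ≥0∞) := by
  rw [limitEnergy, if_pos ⟨isBVpc_of_finite (integrableOn_coeFn z) hz hfin hK, ζ,
    ae_unitSquare_iff.2 hz⟩, hausdorffMeasure_jumpSet hz hfin]

/-- The structure of the functions on which the limit functional is finite. -/
theorem exists_profile {K : Set Space3} {z : L1Square} (hz : IsBVpc openUnitSquare K z)
    (hy : IndependentOfY z) :
    ∃ ζ : ℝ → Space3, (∀ᵐ p ∂volume.restrict openUnitSquare, z p = ζ (p 0)) ∧
      (singularSet ζ).Finite ∧ ∀ᵐ x : ℝ, x ∈ Ioo (0 : ℝ) 1 → ζ x ∈ K := by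
  obtain ⟨ζ₀, h0⟩ := hy
  replace h0 := ae_unitSquare_iff.1 h0
  have h1 := ae_openUnitSquare_iff.1 h0
  -- `IndependentOfY` does not ask for a measurable profile; the restriction of z to a suitable
  -- horizontal line is one.
  obtain ⟨ζ, hζm, hζ⟩ : ∃ ζ : ℝ → Space3, Measurable ζ ∧
      ∀ᵐ x : ℝ, x ∈ Ioo (0 : ℝ) 1 → ζ₀ x = ζ x := by
    have h2 : ∀ᵐ q : ℝ × ℝ, q.2 ∈ Ioo (0 : ℝ) 1 → q.1 ∈ Ioo (0 : ℝ) 1 →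
        z (planeEquiv q.swap) = ζ₀ q.2 := by
      filter_upwards [(Measure.measurePreserving_swap (μ := (volume : Measure ℝ))
        (ν := (volume : Measure ℝ))).quasiMeasurePreserving.ae h1] with q hq a b
      have := hq a b
      rwa [planeEquiv_zero] at this
    have h3 := Measure.ae_ae_of_ae_prod h2
    have hpos : volume (Ioo (0 : ℝ) 1) ≠ 0 := by simp
    obtain ⟨y, hyI, hyc⟩ := ((frequently_ae_mem_iff.2 hpos).and_eventually h3).exists
    refine ⟨fun x => z (planeEquiv (x, y)), (measurable_coeFn z).comp
      (planeEquiv.measurable.comp (measurable_id.prodMk measurable_const)), ?_⟩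
    filter_upwards [hyc] with x hx hxI using (hx hxI hyI).symm
  have hzζ : ∀ᵐ p ∂volume.restrict openUnitSquare, z p = ζ (p 0) := by
    filter_upwards [h0, (ae_openUnitSquare_iff_zero (P := fun s => ζ₀ s = ζ s)).2 hζ] with p a b
    rw [a, b]
  obtain ⟨P, hP, hc⟩ := hz.2.2
  refine ⟨ζ, hzζ, finite_singularSet_of_partition hζm hzζ hP hc, ?_⟩
  refine (ae_openUnitSquare_iff_zero (P := fun s => ζ s ∈ K)).1 ?_
  filter_upwards [hzζ, hz.2.1] with p a b
  rwa [← a]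

/-- The definition alone would allow a jump set of infinite length; finiteness comes from
`exists_profile`. -/
theorem limitEnergy_lt_top_iff {K : Set Space3} {z : L1Square} :
    limitEnergy K z < ⊤ ↔ IsBVpc openUnitSquare K z ∧ IndependentOfY z := by
  constructor
  · intro h
    by_contra hc
    rw [limitEnergy, if_neg hc] at h
    exact lt_irrefl _ h
  · rintro ⟨h1, h2⟩
    obtain ⟨ζ, a, b, c⟩ := exists_profile h1 h2
    rw [limitEnergy_of_ae_eq a b c]
    refine ENNReal.mul_lt_top ?_ (ENNReal.natCast_lt_top _)
    exact ENNReal.div_lt_top (by norm_num) (by norm_num)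

/-- The lower bound. -/
theorem limitEnergy_le_liminf {lam δ J₂ : ℕ → ℝ} {k : ℕ → ℕ} {Q : ℕ → Finset Space3}
    {Qbar : Set Space3} (hδ : ∀ n, 0 < δ n) (H : IsScaling (fun n => √(2 * δ n)) lam k Q)
    (hQbar : ∀ x : ℕ → Space3, (∀ n, x n ∈ Q n) → ∀ a, MapClusterPt a atTop x → a ∈ Qbar)
    {c : ℝ} (hc : 0 < c) (hJ : ∀ n, c ≤ J₂ n * (lam n / √(δ n)))
    (z : L1Square) (zs : ℕ → L1Square) (hzs : Tendsto zs atTop (𝓝 z)) :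
    limitEnergy (Qbar ∪ {q | -q ∈ Qbar}) z ≤
      liminf (fun n => constrainedEnergy (lam n) (δ n) (J₂ n) (Q n) (zs n) /
          ENNReal.ofReal (√2 * lam n * δ n ^ (3 / 2 : ℝ))) atTop := by
  by_contra! hlt
  -- C bounds the energies along a subsequence, and C' > C leaves room for choosing a good row.
  obtain ⟨C, hC1, hC2⟩ := ENNReal.lt_iff_exists_nnreal_btwn.1 hlt
  obtain ⟨C', hC'1, hC'2⟩ := ENNReal.lt_iff_exists_nnreal_btwn.1 hC2
  obtain ⟨φ, hφ, hφC⟩ := extraction_of_frequently_atTop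
    (frequently_lt_of_liminf_lt (by isBoundedDefault) hC1)
  obtain ⟨ψ, hψ, hae⟩ := (tendstoInMeasure_of_tendsto_Lp
    (hzs.comp hφ.tendsto_atTop)).exists_seq_tendsto_ae
  set θ : ℕ → ℕ := φ ∘ ψ with hθ
  have hθm : StrictMono θ := hφ.comp hψ
  have hex : ∀ n, ∃ u : ℤ × ℤ → Space3, IsAdmissibleSpin (lam (θ n)) (circleUnion (Q (θ n))) u ∧
      zs (θ n) =ᵐ[volume.restrict unitSquare] chiralityField (lam (θ n)) (δ (θ n)) u ∧
      spinEnergy (lam (θ n)) (δ (θ n)) (J₂ (θ n)) u /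
        (√2 * lam (θ n) * δ (θ n) ^ (3 / 2 : ℝ)) ≤ C := by
    intro n
    have h1 := hφC (ψ n)
    have hpos : 0 < √2 * lam (θ n) * δ (θ n) ^ (3 / 2 : ℝ) := by
      have := H.lam_pos (θ n); have := hδ (θ n); positivity
    have h2 : constrainedEnergy (lam (θ n)) (δ (θ n)) (J₂ (θ n)) (Q (θ n)) (zs (θ n)) <
        C * ENNReal.ofReal (√2 * lam (θ n) * δ (θ n) ^ (3 / 2 : ℝ)) := by
      rwa [← ENNReal.div_lt_iff (Or.inl (by simpa using hpos)) (Or.inl ENNReal.ofReal_ne_top)]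
    simp only [constrainedEnergy, iInf_lt_iff] at h2
    obtain ⟨u, hu, hzu, hlt⟩ := h2
    refine ⟨u, hu, hzu, ?_⟩
    rw [div_le_iff₀ hpos]
    by_contra! hc
    refine absurd hlt (not_lt.2 ?_)
    rw [← ENNReal.ofReal_coe_nnreal, ← ENNReal.ofReal_mul C.coe_nonneg]
    exact ENNReal.ofReal_le_ofReal hc.le
  choose u hadm hzu hen using hex
  have Hθ := H.comp hθm
  have hrow : ∀ n, 0 ≤ ∑ m ∈ Finset.range (⌊1 / lam (θ n)⌋₊ + 1), lam (θ n) *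
      rowEnergy √(2 * δ (θ n)) ⌊1 / lam (θ n)⌋₊ (spinRow (u n) m) := fun n =>
    Finset.sum_nonneg fun m _ => mul_nonneg (H.lam_pos _).le (rowEnergy_nonneg (H.h_pos _))
  have hvert : ∀ n, 0 ≤ ∑ m ∈ Finset.range ⌊1 / lam (θ n)⌋₊,
      ∑ i ∈ Finset.range (⌊1 / lam (θ n)⌋₊ + 1),
        ‖spinRow (u n) (m + 1) i - spinRow (u n) m i‖ ^ 2 := fun n =>
    Finset.sum_nonneg fun m _ => Finset.sum_nonneg fun i _ => sq_nonneg _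
  -- Both parts of the energy are nonnegative, so each is at most C; the constant √2 C/c comes from
  -- c ≤ J₂ λ/√δ.
  have A : IsFieldSequence ((fun n => √(2 * δ n)) ∘ θ) (lam ∘ θ) (Q ∘ θ)
      (fun n => spinRow (u n)) C (√2 * C / c) := by
    have hmem : ∀ n, ∀ m ≤ ⌊1 / (lam ∘ θ) n⌋₊, ∀ i ≤ ⌊1 / (lam ∘ θ) n⌋₊,
        spinRow (u n) m i ∈ circleUnion (Q (θ n)) := by
      intro n m hm i hi
      refine (hadm n).mem _ ?_
      rw [lattice, floor_eq_natFloor (H.lam_pos _)]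
      simp only [Function.comp] at hm hi
      simp only [Finset.mem_product, Finset.mem_Icc]
      omega
    refine ⟨fun n m hm i hi => (hmem n m hm i hi).1, fun n m hm i hi => (hmem n m hm i hi).2,
      fun n => ?_, fun n => ?_⟩
    · have h1 := hen n
      rw [spinEnergy_div (H.lam_pos _) (hδ _)] at h1
      have h2 : 0 ≤ J₂ (θ n) * (lam (θ n) / √(δ (θ n))) := hc.le.trans (hJ _)
      have h3 := mul_nonneg (div_nonneg h2 (show 0 ≤ √2 * √(2 * δ (θ n)) ^ 2 by positivity)) (hvert n)
      simp only [Function.comp]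
      linarith
    · have h1 := hen n
      rw [spinEnergy_div (H.lam_pos _) (hδ _)] at h1
      have h2 := hrow n
      have h3 := hvert n
      have hp : 0 < √2 * √(2 * δ (θ n)) ^ 2 := by
        have := H.h_pos (θ n); positivity
      have h4 : c / (√2 * √(2 * δ (θ n)) ^ 2) * (∑ m ∈ Finset.range ⌊1 / lam (θ n)⌋₊,
          ∑ i ∈ Finset.range (⌊1 / lam (θ n)⌋₊ + 1),
          ‖spinRow (u n) (m + 1) i - spinRow (u n) m i‖ ^ 2) ≤ C := by
        refine le_trans ?_ (le_of_add_le_of_nonneg_right h1 h2)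
        have := hJ (θ n)
        gcongr
      rw [div_mul_eq_mul_div, div_le_iff₀ hp] at h4
      simp only [Function.comp]
      rw [div_mul_eq_mul_div, le_div_iff₀ hc]
      linarith
  have hconv : ∀ᵐ q : ℝ × ℝ, q.1 ∈ Ioo (0 : ℝ) 1 → q.2 ∈ Ioo (0 : ℝ) 1 →
      Tendsto (fun n => rowChir (((fun n => √(2 * δ n)) ∘ θ) n)
        (spinRow (u n) ⌊q.2 / (lam ∘ θ) n⌋₊) ⌊q.1 / (lam ∘ θ) n⌋₊) atTop
        (𝓝 (z (planeEquiv q))) := by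
    have h1 : ∀ᵐ p ∂volume.restrict openUnitSquare,
        Tendsto (fun n => chiralityField (lam (θ n)) (δ (θ n)) (u n) p) atTop (𝓝 (z p)) := by
      refine ae_unitSquare_iff.1 ?_
      filter_upwards [hae, ae_all_iff.2 hzu] with p hp1 hp2
      refine hp1.congr fun n => ?_
      exact hp2 n
    filter_upwards [ae_openUnitSquare_iff.1 h1] with q hq hq1 hq2
    refine (hq hq1 hq2).congr' ?_
    filter_upwards [Hθ.eventually_floor_add_le hq1.1.le hq1.2] with n hn
    simp only [Function.comp] at hn
    rw [chiralityField_eq (H.lam_pos _) (u n) (p := planeEquiv q) hq1.1.le hq2.1.le (by omega),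
      planeEquiv_zero, planeEquiv_one, min_eq_left (by omega)]
    rfl
  have hne : ∀ n, (Q n).Nonempty := fun n => by
    rw [← Finset.card_pos, H.card_eq]; exact H.k_pos n
  obtain ⟨ζ, h1, h2, h3, h4⟩ := A.limit Hθ C.2 (by exact_mod_cast hC'1)
    (fun x hx a ha => mapClusterPt_extend hne hQbar hθm x hx a ha) (measurable_coeFn z) hconv
  rw [limitEnergy_of_ae_eq h1 h2 h4] at hC'2
  refine absurd hC'2 (not_lt.2 ?_)
  have e : (8 / 3 * ((singularSet ζ).ncard : ℝ≥0∞)) =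
      ENNReal.ofReal (8 / 3 * ((singularSet ζ).ncard : ℝ)) := by
    rw [ENNReal.ofReal_mul (by norm_num), ENNReal.ofReal_natCast,
      ENNReal.ofReal_div_of_pos (by norm_num)]
    norm_num
  rw [e, ← ENNReal.ofReal_coe_nnreal]
  exact ENNReal.ofReal_le_ofReal h3


/-! ### The discrete optimal profile -/

/-- The discrete optimal profile, an algebraic substitute for the hyperbolic tangent. -/
def optProfile (h : ℝ) : ℕ → ℝ
  | 0 => 0
  | j + 1 => optProfile h j + h * (1 - optProfile h j ^ 2)

/-- The energy density of two consecutive steps of lengths `h * x` and `h * y` on one circle. -/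
def stepCost (h x y : ℝ) : ℝ := (y - x) ^ 2 / h + h / 4 * (2 - x ^ 2 - y ^ 2) ^ 2

theorem stepCost_comm (h x y : ℝ) : stepCost h x y = stepCost h y x := by
  unfold stepCost; ring

/-- With X = 2 - x² - y² ≥ 0 the well term contains a²X - 2(a² - 1), and the cross term of its
square has a favourable sign. -/
theorem stepCost_mul_le {h a x y : ℝ} (hh : 0 < h) (ha : 1 ≤ a) (hx : x ∈ Icc (0 : ℝ) 1)
    (hy : y ∈ Icc (0 : ℝ) 1) :
    stepCost h (a * x) (a * y) ≤ a ^ 4 * stepCost h x y + h * (a ^ 2 - 1) ^ 2 := by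
  have ha2 : 1 ≤ a ^ 2 := one_le_pow₀ ha
  have hX : 0 ≤ 2 - x ^ 2 - y ^ 2 := by nlinarith [hx.1, hx.2, hy.1, hy.2]
  have e1 : (2 - (a * x) ^ 2 - (a * y) ^ 2) ^ 2 ≤
      a ^ 4 * (2 - x ^ 2 - y ^ 2) ^ 2 + 4 * (a ^ 2 - 1) ^ 2 := by
    have : 0 ≤ a ^ 2 * (2 - x ^ 2 - y ^ 2) * (a ^ 2 - 1) :=
      mul_nonneg (mul_nonneg (by positivity) hX) (by linarith)
    nlinarith
  have e2 : (a * y - a * x) ^ 2 / h ≤ a ^ 4 * ((y - x) ^ 2 / h) := by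
    have h1 : (a * y - a * x) ^ 2 / h = a ^ 2 * ((y - x) ^ 2 / h) := by ring
    rw [h1]
    have : 0 ≤ (y - x) ^ 2 / h := by positivity
    have h4 : a ^ 2 ≤ a ^ 4 := pow_le_pow_right₀ ha (by norm_num)
    gcongr
  unfold stepCost
  calc _ ≤ a ^ 4 * ((y - x) ^ 2 / h) +
        h / 4 * (a ^ 4 * (2 - x ^ 2 - y ^ 2) ^ 2 + 4 * (a ^ 2 - 1) ^ 2) := by gcongr
    _ = _ := by ring

section OptProfile

variable {h : ℝ}

/-- One has 1 - x_{j+1} = (1 - x_j)(1 - h(1 + x_j)), which stays positive for h ≤ 1/2. -/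
theorem optProfile_mem (hh : 0 < h) (hh2 : h ≤ 1 / 2) (j : ℕ) : optProfile h j ∈ Ico (0 : ℝ) 1 := by
  induction j with
  | zero => simp [optProfile]
  | succ j ih =>
    obtain ⟨h0, h1⟩ := ih
    rw [optProfile]
    constructor
    · have : 0 ≤ h * (1 - optProfile h j ^ 2) := mul_nonneg hh.le (by nlinarith)
      linarith
    · nlinarith [mul_pos hh (sub_pos.2 h1), mul_nonneg hh.le h0]

theorem optProfile_mono (hh : 0 < h) (hh2 : h ≤ 1 / 2) : Monotone (optProfile h) := by
  refine monotone_nat_of_le_succ fun j => ?_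
  obtain ⟨h0, h1⟩ := optProfile_mem hh hh2 j
  rw [optProfile]
  have : 0 ≤ h * (1 - optProfile h j ^ 2) := mul_nonneg hh.le (by nlinarith)
  linarith

theorem sum_one_sub_sq (m : ℕ) :
    ∑ j ∈ Finset.range m, h * (1 - optProfile h j ^ 2) = optProfile h m := by
  induction m with
  | zero => simp [optProfile]
  | succ m ih => rw [Finset.sum_range_succ, ih, optProfile]

/-- By monotonicity the j increments, whose sum is less than 1, are each at least h(1 - x_j). This
rate suffices, although the true one is exponential. -/
theorem one_sub_optProfile_le (hh : 0 < h) (hh2 : h ≤ 1 / 2) {j : ℕ} (hj : 0 < j) :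
    1 - optProfile h j ≤ 1 / (h * j) := by
  have hj' : (0 : ℝ) < j := by exact_mod_cast hj
  have h1 := sum_one_sub_sq (h := h) j
  have h2 : (j : ℝ) * (h * (1 - optProfile h j)) ≤
      ∑ i ∈ Finset.range j, h * (1 - optProfile h i ^ 2) := by
    have : ∀ i ∈ Finset.range j, h * (1 - optProfile h j) ≤ h * (1 - optProfile h i ^ 2) := by
      intro i hi
      have hm := optProfile_mono hh hh2 (Finset.mem_range.1 hi).le
      obtain ⟨a, b⟩ := optProfile_mem hh hh2 i
      gcongr
      nlinarith
    have := Finset.card_nsmul_le_sum _ _ _ this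
    simpa using this
  have h3 := (optProfile_mem hh hh2 j).2
  rw [le_div_iff₀ (by positivity)]
  linarith

theorem sum_one_sub_le (hh : 0 < h) (hh2 : h ≤ 1 / 2) (m : ℕ) :
    ∑ j ∈ Finset.range m, (1 - optProfile h j) ≤ 1 / h := by
  rw [le_div_iff₀ hh, Finset.sum_mul]
  refine (Finset.sum_le_sum fun j _ => ?_).trans
    ((sum_one_sub_sq (h := h) m).le.trans (optProfile_mem hh hh2 m).2.le)
  obtain ⟨a, b⟩ := optProfile_mem hh hh2 j
  rw [mul_comm]
  gcongr
  nlinarith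

/-- Since h(1 - x²) is the increment of x, this is a left Riemann sum of mesh at most h for the
integral of 2(1 - x²) over [0, 1], which is 4/3. -/
theorem sum_one_sub_sq_sq_le (hh : 0 < h) (hh2 : h ≤ 1 / 2) (m : ℕ) :
    ∑ j ∈ Finset.range m, 2 * h * (1 - optProfile h j ^ 2) ^ 2 ≤ 4 / 3 + 4 * h := by
  have key : ∑ j ∈ Finset.range m, h * (1 - optProfile h j ^ 2) ^ 2 ≤
      (optProfile h m - optProfile h m ^ 3 / 3) + 2 * h * optProfile h m := by
    induction m with
    | zero => simp [optProfile]
    | succ m ih =>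
      rw [Finset.sum_range_succ]
      obtain ⟨x0, x1⟩ := optProfile_mem hh hh2 m
      obtain ⟨y0, y1⟩ := optProfile_mem hh hh2 (m + 1)
      have hxy := optProfile_mono hh hh2 (Nat.le_succ m)
      have e : optProfile h (m + 1) = optProfile h m + h * (1 - optProfile h m ^ 2) := rfl
      set x := optProfile h m
      set y := optProfile h (m + 1)
      have e1 : (y - x) * (1 - y ^ 2) ≤ (y - y ^ 3 / 3) - (x - x ^ 3 / 3) := by
        have : 0 ≤ (y - x) * (2 * y ^ 2 - x * y - x ^ 2) :=
          mul_nonneg (by linarith) (by nlinarith)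
        nlinarith
      have e2 : h * (1 - x ^ 2) = y - x := by linarith
      have e3 : h * (1 - x ^ 2) ^ 2 = (y - x) * (1 - x ^ 2) := by rw [← e2]; ring
      have e4 : (y - x) * ((1 - x ^ 2) - (1 - y ^ 2)) ≤ 2 * h * (y - x) := by
        have h5 : (1 - x ^ 2) - (1 - y ^ 2) ≤ 2 * (y - x) := by nlinarith
        have h6 : y - x ≤ h := by rw [← e2]; nlinarith
        calc _ ≤ (y - x) * (2 * h) := by
              refine mul_le_mul_of_nonneg_left (by linarith) (by linarith)
          _ = _ := by ring
      rw [e3]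
      linarith
  obtain ⟨a, b⟩ := optProfile_mem hh hh2 m
  have h2 : ∑ j ∈ Finset.range m, 2 * h * (1 - optProfile h j ^ 2) ^ 2 =
      2 * ∑ j ∈ Finset.range m, h * (1 - optProfile h j ^ 2) ^ 2 := by
    rw [Finset.mul_sum]; exact Finset.sum_congr rfl fun _ _ => by ring
  rw [h2]
  have h3 : optProfile h m - optProfile h m ^ 3 / 3 ≤ 2 / 3 := by
    nlinarith [sq_nonneg (optProfile h m - 1)]
  nlinarith

/-- Equipartition: the gradient part equals h(1 - x²)², and the well part is at most that. -/
theorem stepCost_optProfile_le (hh : 0 < h) (hh2 : h ≤ 1 / 2) (j : ℕ) :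
    stepCost h (optProfile h j) (optProfile h (j + 1)) ≤ 2 * h * (1 - optProfile h j ^ 2) ^ 2 := by
  obtain ⟨x0, x1⟩ := optProfile_mem hh hh2 j
  obtain ⟨y0, y1⟩ := optProfile_mem hh hh2 (j + 1)
  have hxy := optProfile_mono hh hh2 (Nat.le_succ j)
  have e : optProfile h (j + 1) - optProfile h j = h * (1 - optProfile h j ^ 2) := by
    rw [optProfile]; ring
  unfold stepCost
  rw [e]
  have h1 : (2 - optProfile h j ^ 2 - optProfile h (j + 1) ^ 2) ^ 2 ≤
      (2 * (1 - optProfile h j ^ 2)) ^ 2 := by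
    apply pow_le_pow_left₀ <;> nlinarith
  calc _ ≤ (h * (1 - optProfile h j ^ 2)) ^ 2 / h +
        h / 4 * (2 * (1 - optProfile h j ^ 2)) ^ 2 := by gcongr
    _ = _ := by field_simp; ring

/-- The profile of a bridge between two jumps. -/
def bridgeProfile (h : ℝ) (L l : ℕ) : ℝ := optProfile h (min l (L - 1 - l))

theorem sum_stepCost_bridge_le (hh : 0 < h) (hh2 : h ≤ 1 / 2) (L : ℕ) :
    ∑ l ∈ Finset.range (L - 1), stepCost h (bridgeProfile h L l) (bridgeProfile h L (l + 1)) ≤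
      2 * (4 / 3 + 4 * h) := by
  have key : ∀ l ∈ Finset.range (L - 1),
      stepCost h (bridgeProfile h L l) (bridgeProfile h L (l + 1)) ≤
      2 * h * (1 - optProfile h l ^ 2) ^ 2 + 2 * h * (1 - optProfile h (L - 1 - 1 - l) ^ 2) ^ 2 := by
    intro l hl
    rw [Finset.mem_range] at hl
    unfold bridgeProfile
    have p1 : 0 ≤ 2 * h * (1 - optProfile h l ^ 2) ^ 2 := by positivity
    have p2 : 0 ≤ 2 * h * (1 - optProfile h (L - 1 - 1 - l) ^ 2) ^ 2 := by positivity
    -- The rising half, the two equal middle values for even L, and the falling half, which is the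
    -- rising one read backwards.
    rcases lt_trichotomy (2 * l + 2) L with h1 | h1 | h1
    · rw [show min l (L - 1 - l) = l by omega, show min (l + 1) (L - 1 - (l + 1)) = l + 1 by omega]
      have := stepCost_optProfile_le hh hh2 l
      linarith
    · rw [show min l (L - 1 - l) = l by omega, show min (l + 1) (L - 1 - (l + 1)) = l by omega]
      have : stepCost h (optProfile h l) (optProfile h l) = h * (1 - optProfile h l ^ 2) ^ 2 := by
        unfold stepCost; ring
      rw [this]
      nlinarith [sq_nonneg (1 - optProfile h l ^ 2)]
    · rw [show min l (L - 1 - l) = (L - 1 - 1 - l) + 1 by omega,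
        show min (l + 1) (L - 1 - (l + 1)) = L - 1 - 1 - l by omega, stepCost_comm]
      have := stepCost_optProfile_le hh hh2 (L - 1 - 1 - l)
      linarith
  refine (Finset.sum_le_sum key).trans ?_
  rw [Finset.sum_add_distrib,
    Finset.sum_range_reflect (fun l => 2 * h * (1 - optProfile h l ^ 2) ^ 2) (L - 1)]
  have := sum_one_sub_sq_sq_le hh hh2 (L - 1)
  linarith

theorem sum_stepCost_optProfile_le (hh : 0 < h) (hh2 : h ≤ 1 / 2) (L : ℕ) :
    ∑ l ∈ Finset.range (L - 1), stepCost h (optProfile h l) (optProfile h (l + 1)) ≤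
      4 / 3 + 4 * h :=
  (Finset.sum_le_sum fun l _ => stepCost_optProfile_le hh hh2 l).trans
    (sum_one_sub_sq_sq_le hh hh2 (L - 1))

theorem le_sum_bridgeProfile (hh : 0 < h) (hh2 : h ≤ 1 / 2) (L : ℕ) :
    L - 2 / h ≤ ∑ l ∈ Finset.range L, bridgeProfile h L l := by
  have key : ∀ l ∈ Finset.range L, 1 - bridgeProfile h L l ≤
      (1 - optProfile h l) + (1 - optProfile h (L - 1 - l)) := by
    intro l _
    have h1 := (optProfile_mem hh hh2 l).2
    have h2 := (optProfile_mem hh hh2 (L - 1 - l)).2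
    unfold bridgeProfile
    rcases min_choice l (L - 1 - l) with e | e <;> rw [e] <;> linarith
  have h1 := Finset.sum_le_sum key
  rw [Finset.sum_add_distrib, Finset.sum_range_reflect (fun l => 1 - optProfile h l) L,
    Finset.sum_sub_distrib] at h1
  have h2 := sum_one_sub_le hh hh2 L
  simp only [Finset.sum_const, Finset.card_range, nsmul_eq_mul, mul_one] at h1
  have : 2 / h = 1 / h + 1 / h := by ring
  linarith

theorem bridgeProfile_mem (hh : 0 < h) (hh2 : h ≤ 1 / 2) (L l : ℕ) :
    bridgeProfile h L l ∈ Icc (0 : ℝ) 1 := Ico_subset_Icc_self (optProfile_mem hh hh2 _)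

end OptProfile


/-! ### Rows of spins on one circle -/

/-- The point of angle `a` on the circle orthogonal to `q`, starting from `p`. -/
def circlePoint (q p : Space3) (a : ℝ) : Space3 := Real.cos a • p + Real.sin a • cross3 q p

/-- The angle of a step of length `h * w`. -/
def stepAngle (h w : ℝ) : ℝ := 2 * Real.arcsin (h * w / 2)

/-- The signed length of the chirality of a step of length `h * w`. -/
def stepChir (h w : ℝ) : ℝ := w * √(1 - (h * w / 2) ^ 2)

section CirclePoint

variable {q p : Space3} (hq : ‖q‖ = 1) (hp : ‖p‖ = 1) (hpq : inner ℝ p q = 0)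

theorem circlePoint_zero (q p : Space3) : circlePoint q p 0 = p := by simp [circlePoint]

theorem inner_circlePoint (hpq : inner ℝ p q = 0) (a : ℝ) : inner ℝ (circlePoint q p a) q = 0 := by
  rw [circlePoint, inner_add_left, inner_smul_left, inner_smul_left, hpq,
    real_inner_comm, inner_cross3_left]
  simp

include hq hp hpq

theorem inner_circlePoint_circlePoint (a b : ℝ) :
    inner ℝ (circlePoint q p a) (circlePoint q p b) = Real.cos (b - a) := by
  have h1 : inner ℝ (cross3 q p) (cross3 q p) = (1 : ℝ) := by
    rw [real_inner_self_eq_norm_sq, norm_cross3_sq, hq, hp, real_inner_comm, hpq]; norm_num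
  have h2 : inner ℝ p p = (1 : ℝ) := by rw [real_inner_self_eq_norm_sq, hp]; norm_num
  have h3 := inner_cross3_right q p
  have h4 : inner ℝ (cross3 q p) p = (0 : ℝ) := by rw [real_inner_comm]; exact h3
  simp only [circlePoint, inner_add_left, inner_add_right, inner_smul_left, inner_smul_right,
    h1, h2, h3, h4, Real.cos_sub]
  simp

theorem norm_circlePoint (a : ℝ) : ‖circlePoint q p a‖ = 1 := by
  have := inner_circlePoint_circlePoint hq hp hpq a a
  rw [real_inner_self_eq_norm_sq, sub_self, Real.cos_zero] at this
  exact (pow_eq_one_iff_of_nonneg (norm_nonneg _) two_ne_zero).1 this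

omit hq in
theorem cross3_circlePoint (a b : ℝ) :
    cross3 (circlePoint q p a) (circlePoint q p b) = Real.sin (b - a) • q := by
  have h1 : cross3 p (cross3 q p) = q := by
    rw [cross3_comm p, cross3_comm q p]
    have := cross3_cross3_left p q
    rw [hp, hpq] at this
    rw [show -cross3 p q = (-1 : ℝ) • cross3 p q by simp, cross3_smul_left, this]
    simp
  have h2 : cross3 (cross3 q p) p = -q := by rw [cross3_comm, h1]
  simp only [circlePoint, cross3_add_left, cross3_add_right, cross3_smul_left, cross3_smul_right,
    cross3_self, h1, h2, Real.sin_sub]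
  module

/-- In the orthonormal frame p, q × p of the circle's plane the coordinates of p' are ⟨p, p'⟩ and
⟨q, p × p'⟩; the angle is the argument of the corresponding complex number. -/
theorem exists_eq_circlePoint {p' : Space3} (hp' : ‖p'‖ = 1) (hpq' : inner ℝ p' q = 0) :
    ∃ τ, p' = circlePoint q p τ := by
  have h1 := cross3_eq_smul_of_inner_eq_zero hq hpq hpq'
  set c : ℝ := inner ℝ q (cross3 p p')
  have h2 := cross3_cross3_left p p'
  rw [h1, hp, cross3_smul_left] at h2
  set x : ℝ := inner ℝ p p'
  have h3 : x ^ 2 + c ^ 2 = 1 := by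
    have := norm_cross3_sq p p'
    rw [h1, norm_smul, hq, hp, hp', mul_one, Real.norm_eq_abs, sq_abs] at this
    linarith
  have hn : ‖(⟨x, c⟩ : ℂ)‖ = 1 := by
    rw [Complex.norm_def, Complex.normSq_mk, show x * x + c * c = 1 by linarith, Real.sqrt_one]
  refine ⟨Complex.arg ⟨x, c⟩, ?_⟩
  have e1 := Complex.norm_mul_cos_arg ⟨x, c⟩
  have e2 := Complex.norm_mul_sin_arg ⟨x, c⟩
  rw [hn, one_mul] at e1 e2
  rw [circlePoint, e1, e2]
  simp only
  rw [h2]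
  simp

end CirclePoint

/-- Two great circles always meet: a linear map from dimension three to two has a kernel. Such
points are where a recovery row changes its circle. -/
theorem exists_unit_orthogonal (q q' : Space3) :
    ∃ p : Space3, ‖p‖ = 1 ∧ inner ℝ p q = 0 ∧ inner ℝ p q' = 0 := by
  let f : Space3 →ₗ[ℝ] (Fin 2 → ℝ) :=
    LinearMap.pi ![(innerSL ℝ q).toLinearMap, (innerSL ℝ q').toLinearMap]
  have hker : LinearMap.ker f ≠ ⊥ := LinearMap.ker_ne_bot_of_finrank_lt (by simp)
  obtain ⟨x, hx, hx0⟩ := Submodule.exists_mem_ne_zero_of_ne_bot hker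
  rw [LinearMap.mem_ker] at hx
  have h0 : inner ℝ q x = (0 : ℝ) := congrFun hx 0
  have h1 : inner ℝ q' x = (0 : ℝ) := congrFun hx 1
  refine ⟨(‖x‖)⁻¹ • x, ?_, ?_, ?_⟩
  · rw [norm_smul, norm_inv, norm_norm, inv_mul_cancel₀ (norm_ne_zero_iff.2 hx0)]
  · rw [inner_smul_left, real_inner_comm, h0, mul_zero]
  · rw [inner_smul_left, real_inner_comm, h1, mul_zero]

section Step

variable {h w w' : ℝ}

theorem cos_stepAngle (h0 : 0 ≤ h * w) (h1 : h * w ≤ 1) :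
    Real.cos (stepAngle h w) = 1 - h ^ 2 * w ^ 2 / 2 := by
  rw [stepAngle, Real.cos_two_mul, Real.cos_arcsin, Real.sq_sqrt (by nlinarith)]
  ring

theorem sin_stepAngle (h0 : 0 ≤ h * w) (h1 : h * w ≤ 1) :
    Real.sin (stepAngle h w) = h * stepChir h w := by
  rw [stepAngle, Real.sin_two_mul, Real.cos_arcsin, Real.sin_arcsin (by linarith) (by linarith),
    stepChir]
  ring

/-- This allows `stepCost` to use the step lengths in both terms. The difference quotient of x√(1 -
x²) is explicit and lies in [-1, 1] for 0 ≤ x ≤ 1/2. -/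
theorem abs_stepChir_sub_le (hh : 0 < h) (h0 : 0 ≤ h * w) (h1 : h * w ≤ 1) (h0' : 0 ≤ h * w')
    (h1' : h * w' ≤ 1) : |stepChir h w' - stepChir h w| ≤ |w' - w| := by
  set x := h * w / 2 with hx
  set y := h * w' / 2 with hy
  have hc2 : √(1 - x ^ 2) ^ 2 = 1 - x ^ 2 := Real.sq_sqrt (by nlinarith)
  have hd2 : √(1 - y ^ 2) ^ 2 = 1 - y ^ 2 := Real.sq_sqrt (by nlinarith)
  have hc0 := Real.sqrt_nonneg (1 - x ^ 2)
  have hd0 := Real.sqrt_nonneg (1 - y ^ 2)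
  have e : stepChir h w' - stepChir h w = 2 / h * (y * √(1 - y ^ 2) - x * √(1 - x ^ 2)) := by
    rw [stepChir, stepChir, hx, hy]; field_simp
  have e' : w' - w = 2 / h * (y - x) := by rw [hx, hy]; field_simp
  rw [e, e', abs_mul, abs_mul]
  refine mul_le_mul_of_nonneg_left ?_ (abs_nonneg _)
  set c := √(1 - x ^ 2)
  set d := √(1 - y ^ 2)
  have hc1 : c ≤ 1 := by nlinarith
  have hd1 : d ≤ 1 := by nlinarith
  have hc3 : 1 / 2 ≤ c := by nlinarith
  have hd3 : 1 / 2 ≤ d := by nlinarith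
  have hx1 : x ≤ 1 / 2 := by linarith
  have hy1 : y ≤ 1 / 2 := by linarith
  have hx0 : 0 ≤ x := by positivity
  have hy0 : 0 ≤ y := by positivity
  have key : y * d - x * c = (y - x) * ((c + d) / 2 - (x + y) ^ 2 / (2 * (c + d))) := by
    have hcd : c + d ≠ 0 := by linarith
    field_simp
    linear_combination (x + y) * (hd2 - hc2)
  rw [key, abs_mul]
  refine mul_le_of_le_one_right (abs_nonneg _) ?_
  have hq1 : 0 ≤ (x + y) ^ 2 / (2 * (c + d)) := by positivity
  have hq2 : (x + y) ^ 2 / (2 * (c + d)) ≤ 1 := by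
    rw [div_le_one (by linarith)]; nlinarith
  rw [abs_le]
  constructor <;> linarith

/-- The sine is 1-Lipschitz, so its inverse expands distances. -/
theorem sub_le_arcsin_sub {x y : ℝ} (hx : -1 ≤ x) (hxy : x ≤ y) (hy : y ≤ 1) :
    y - x ≤ Real.arcsin y - Real.arcsin x := by
  have h1 := Real.monotone_arcsin hxy
  have h2 : |Real.sin (Real.arcsin y) - Real.sin (Real.arcsin x)| ≤
      |Real.arcsin y - Real.arcsin x| := Real.abs_sin_sub_sin_le _ _
  rw [Real.sin_arcsin (by linarith) hy, Real.sin_arcsin hx (by linarith),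
    abs_of_nonneg (by linarith), abs_of_nonneg (by linarith)] at h2
  exact h2

end Step

/-- A row of spins on the circle orthogonal to `q`, with steps of lengths `h * w l`. -/
structure IsArc (h : ℝ) (q : Space3) (L : ℕ) (w : ℕ → ℝ) (v : ℕ → Space3) : Prop where
  norm_eq : ∀ l, ‖v l‖ = 1
  inner_axis : ∀ l, inner ℝ (v l) q = 0
  inner_succ : ∀ l < L, inner ℝ (v l) (v (l + 1)) = 1 - h ^ 2 * w l ^ 2 / 2
  rowChir_eq : ∀ l < L, rowChir h v l = stepChir h (w l) • q

section Arc

variable {h : ℝ} {q p : Space3} {L : ℕ} {w : ℕ → ℝ} {v : ℕ → Space3}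

theorem isArc_circlePoint (hh : 0 < h) (hq : ‖q‖ = 1) (hp : ‖p‖ = 1) (hpq : inner ℝ p q = 0)
    (hw : ∀ l < L, 0 ≤ h * w l ∧ h * w l ≤ 1) :
    IsArc h q L w
      (fun l => circlePoint q p (∑ m ∈ Finset.range l, stepAngle h (w m))) where
  norm_eq l := norm_circlePoint hq hp hpq _
  inner_axis l := inner_circlePoint hpq _
  inner_succ l hl := by
    rw [inner_circlePoint_circlePoint hq hp hpq, Finset.sum_range_succ, add_sub_cancel_left,
      cos_stepAngle (hw l hl).1 (hw l hl).2]
  rowChir_eq l hl := by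
    rw [rowChir, cross3_circlePoint hp hpq, Finset.sum_range_succ, add_sub_cancel_left,
      sin_stepAngle (hw l hl).1 (hw l hl).2, smul_smul, inv_mul_cancel_left₀ hh.ne']

theorem IsArc.rowEnergy_le (A : IsArc h q L w v) (hh : 0 < h) (hq : ‖q‖ = 1)
    (hw : ∀ l < L, 0 ≤ h * w l ∧ h * w l ≤ 1) :
    rowEnergy h L v ≤ ∑ l ∈ Finset.range (L - 1), stepCost h (w l) (w (l + 1)) := by
  rw [rowEnergy_eq hh fun i _ => A.norm_eq i]
  refine Finset.sum_le_sum fun l hl => ?_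
  rw [Finset.mem_range] at hl
  have hs : ∀ i < L, rowStep h v i ^ 2 = w i ^ 2 := by
    intro i hi
    have h1 := inner_eq_of_rowStep hh (A.norm_eq i) (A.norm_eq (i + 1))
    rw [A.inner_succ i hi] at h1
    have h2 : h ^ 2 * (rowStep h v i ^ 2 - w i ^ 2) = 0 := by linarith
    have h3 : h ^ 2 ≠ 0 := by positivity
    have := (mul_eq_zero.1 h2).resolve_left h3
    linarith
  rw [hs l (by omega), hs (l + 1) (by omega), A.rowChir_eq l (by omega),
    A.rowChir_eq (l + 1) (by omega), ← sub_smul, norm_smul, hq, mul_one, Real.norm_eq_abs, sq_abs,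
    stepCost]
  have h1 := abs_stepChir_sub_le hh (hw l (by omega)).1 (hw l (by omega)).2
    (hw (l + 1) (by omega)).1 (hw (l + 1) (by omega)).2
  have h2 := sq_le_sq.2 h1
  gcongr

theorem IsArc.succ_eq (A : IsArc h q L w v) {l : ℕ} (hl : l < L) (hwl : w l = 0) :
    v (l + 1) = v l := by
  have h1 := norm_sub_sq_of_unit (A.norm_eq l) (A.norm_eq (l + 1))
  rw [A.inner_succ l hl, hwl] at h1
  have h2 : ‖v (l + 1) - v l‖ = 0 := by
    have : ‖v (l + 1) - v l‖ ^ 2 = 0 := by rw [h1]; ring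
    exact pow_eq_zero_iff two_ne_zero |>.1 this
  exact sub_eq_zero.1 (norm_eq_zero.1 h2)

/-- Reversing a row changes the sign of its axis. -/
theorem IsArc.reverse (A : IsArc h (-q) L w v) :
    IsArc h q L (fun l => w (L - 1 - l)) (fun l => v (L - l)) where
  norm_eq l := A.norm_eq _
  inner_axis l := by
    have := A.inner_axis (L - l)
    rw [inner_neg_right, neg_eq_zero] at this
    exact this
  inner_succ l hl := by
    have := A.inner_succ (L - 1 - l) (by omega)
    rw [show L - 1 - l + 1 = L - l by omega] at this
    rw [real_inner_comm, show L - (l + 1) = L - 1 - l by omega, this]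
  rowChir_eq l hl := by
    have := A.rowChir_eq (L - 1 - l) (by omega)
    rw [rowChir, show L - 1 - l + 1 = L - l by omega] at this
    rw [rowChir, show L - (l + 1) = L - 1 - l by omega, cross3_comm, smul_neg, this, smul_neg,
      neg_neg]

end Arc

/-- The bound for the energy of a bridge of length `L`, which is made of `κ` transitions. -/
def arcBound (h κ r : ℝ) : ℝ :=
  (1 + r) ^ 4 * (κ * (4 / 3 + 4 * h)) + 16 * r * (2 + r) ^ 2

/-- The scaling error is at most h(r(2 + r))² per step; over L steps it amounts to 16 r (2 + r)²,
because hLr = 16. -/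
theorem sum_stepCost_scaled_le {h a r κ : ℝ} {L : ℕ} {V : ℕ → ℝ} (hh : 0 < h)
    (hV : ∀ l, V l ∈ Icc (0 : ℝ) 1) (ha : 1 ≤ a) (har : a ≤ 1 + r) (hr : h * L * r = 16)
    (hsum : ∑ l ∈ Finset.range (L - 1), stepCost h (V l) (V (l + 1)) ≤ κ * (4 / 3 + 4 * h)) :
    ∑ l ∈ Finset.range (L - 1), stepCost h (a * V l) (a * V (l + 1)) ≤ arcBound h κ r := by
  have hr0 : 0 ≤ r := by linarith
  have h1 : ∀ l ∈ Finset.range (L - 1), stepCost h (a * V l) (a * V (l + 1)) ≤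
      a ^ 4 * stepCost h (V l) (V (l + 1)) + h * (a ^ 2 - 1) ^ 2 := fun l _ =>
    stepCost_mul_le hh ha (hV l) (hV (l + 1))
  have hs0 : 0 ≤ ∑ l ∈ Finset.range (L - 1), stepCost h (V l) (V (l + 1)) :=
    Finset.sum_nonneg fun l _ => by unfold stepCost; positivity
  refine (Finset.sum_le_sum h1).trans ?_
  rw [Finset.sum_add_distrib, ← Finset.mul_sum, Finset.sum_const, Finset.card_range, nsmul_eq_mul,
    arcBound]
  have h2 : (a ^ 2 - 1) ^ 2 ≤ (r * (2 + r)) ^ 2 := by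
    have h3 : 0 ≤ a ^ 2 - 1 := by nlinarith
    have h4 : a ^ 2 - 1 ≤ r * (2 + r) := by nlinarith
    gcongr
  have h5 : ((L - 1 : ℕ) : ℝ) ≤ L := by exact_mod_cast Nat.sub_le _ _
  have ha0 : 0 ≤ a := by linarith
  calc _ ≤ (1 + r) ^ 4 * (κ * (4 / 3 + 4 * h)) + (L : ℝ) * (h * (r * (2 + r)) ^ 2) := by gcongr
    _ = (1 + r) ^ 4 * (κ * (4 / 3 + 4 * h)) + (h * L * r) * r * (2 + r) ^ 2 := by ring
    _ = _ := by rw [hr]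

/-! ### Half transitions and bridges with prescribed ends -/

section Pieces

variable {h r : ℝ} {q p p' : Space3} {L : ℕ}

/-- A transition from a jump to the boundary. -/
theorem exists_half_arc (hh : 0 < h) (hh2 : h ≤ 1 / 2) (hr : h * L * r = 16) (hr1 : r ≤ 1)
    (hq : ‖q‖ = 1) (hp : ‖p‖ = 1) (hpq : inner ℝ p q = 0) :
    ∃ (a : ℝ) (v : ℕ → Space3), 1 ≤ a ∧ a ≤ 1 + r ∧ IsArc h q L (fun l => a * optProfile h l) v ∧
      v 0 = p ∧ v 1 = p ∧ inner ℝ (v (L - 1)) (v L) = 1 - h ^ 2 / 2 ∧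
      rowEnergy h L v ≤ arcBound h 1 r := by
  have hL0 : 0 < L := by
    rcases Nat.eq_zero_or_pos L with e | e
    · rw [e] at hr; norm_num at hr
    · exact e
  have hL : (0 : ℝ) < L := by exact_mod_cast hL0
  have hr0 : 0 < r := by
    by_contra! hc
    nlinarith [mul_nonneg (mul_pos hh hL).le (neg_nonneg.2 hc)]
  have hhL : 16 ≤ h * L := by nlinarith [mul_pos hh hL]
  have hL32 : (32 : ℝ) ≤ L := by nlinarith
  have hL32' : 32 ≤ L := by exact_mod_cast hL32
  -- The scale 1/W makes the last step have length exactly h, so that both ends of a row meet the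
  -- boundary condition with the same value 1 - h²/2.
  set W := optProfile h (L - 1) with hW
  obtain ⟨hW0, hW1⟩ := optProfile_mem hh hh2 (L - 1)
  have hWl : 1 - W ≤ r / 8 := by
    refine (one_sub_optProfile_le hh hh2 (show 0 < L - 1 by omega)).trans ?_
    rw [Nat.cast_sub (by omega), Nat.cast_one, div_le_iff₀ (mul_pos hh (by linarith))]
    nlinarith [mul_pos hh hr0]
  have hW7 : 7 / 8 ≤ W := by linarith
  have haW : W⁻¹ * W = 1 := inv_mul_cancel₀ (by linarith)
  have ha1 : 1 ≤ W⁻¹ := (one_le_inv₀ (by linarith)).2 hW1.le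
  have har : W⁻¹ ≤ 1 + r := by
    rw [inv_le_iff_one_le_mul₀ (by linarith)]
    nlinarith
  have hw : ∀ l < L, 0 ≤ h * (W⁻¹ * optProfile h l) ∧ h * (W⁻¹ * optProfile h l) ≤ 1 := by
    intro l _
    obtain ⟨a, b⟩ := optProfile_mem hh hh2 l
    constructor
    · positivity
    · have h1 : W⁻¹ * optProfile h l ≤ 2 * 1 := by gcongr; linarith
      nlinarith
  have A := isArc_circlePoint hh hq hp hpq hw
  refine ⟨W⁻¹, _, ha1, har, A, ?_, ?_, ?_, ?_⟩
  · simp [circlePoint_zero]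
  · simp [circlePoint_zero, optProfile, stepAngle]
  · have := A.inner_succ (L - 1) (by omega)
    rw [show L - 1 + 1 = L by omega] at this
    rw [this, ← hW, haW]
    ring
  · refine (A.rowEnergy_le hh hq hw).trans ?_
    refine sum_stepCost_scaled_le hh (fun l => Ico_subset_Icc_self (optProfile_mem hh hh2 l)) ha1
      har hr ?_
    rw [one_mul]
    exact sum_stepCost_optProfile_le hh hh2 L

/-- A bridge between two jumps. -/
theorem exists_bridge (hh : 0 < h) (hh2 : h ≤ 1 / 2) (hr : h * L * r = 16) (hr1 : r ≤ 1)
    (hq : ‖q‖ = 1) (hp : ‖p‖ = 1) (hpq : inner ℝ p q = 0) (hp' : ‖p'‖ = 1)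
    (hpq' : inner ℝ p' q = 0) :
    ∃ (a : ℝ) (v : ℕ → Space3), 1 ≤ a ∧ a ≤ 1 + r ∧
      IsArc h q L (fun l => a * bridgeProfile h L l) v ∧
      v 0 = p ∧ v 1 = p ∧ v (L - 1) = p' ∧ v L = p' ∧ rowEnergy h L v ≤ arcBound h 2 r := by
  have hL0 : 0 < L := by
    rcases Nat.eq_zero_or_pos L with e | e
    · rw [e] at hr; norm_num at hr
    · exact e
  have hL : (0 : ℝ) < L := by exact_mod_cast hL0
  have hr0 : 0 < r := by
    by_contra! hc
    nlinarith [mul_nonneg (mul_pos hh hL).le (neg_nonneg.2 hc)]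
  have hhL : 16 ≤ h * L := by nlinarith [mul_pos hh hL]
  obtain ⟨τ, hτ⟩ := exists_eq_circlePoint hq hp hpq hp' hpq'
  -- The total angle at scale a. From a = 1 to 1 + r it grows by at least hr · L/2 = 8 > 2π, the
  -- profile having mean at least 1/2; so it passes through the angle of p' modulo 2π.
  set T : ℝ → ℝ := fun a => ∑ l ∈ Finset.range L, stepAngle h (a * bridgeProfile h L l) with hT
  have hTc : Continuous T := by
    refine continuous_finsetSum _ fun l _ => ?_
    unfold stepAngle
    exact continuous_const.mul (Real.continuous_arcsin.comp (by fun_prop))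
  have hTd : T 1 + 2 * Real.pi ≤ T (1 + r) := by
    have h1 : ∀ l ∈ Finset.range L, h * r * bridgeProfile h L l ≤
        stepAngle h ((1 + r) * bridgeProfile h L l) - stepAngle h (1 * bridgeProfile h L l) := by
      intro l _
      obtain ⟨b0, b1⟩ := bridgeProfile_mem hh hh2 L l
      have := sub_le_arcsin_sub (x := h * (1 * bridgeProfile h L l) / 2)
        (y := h * ((1 + r) * bridgeProfile h L l) / 2)
        (by have : 0 ≤ h * (1 * bridgeProfile h L l) := by positivity
            linarith)
        (by have : 0 ≤ h * (r * bridgeProfile h L l) := by positivity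
            linarith)
        (by have : (1 + r) * bridgeProfile h L l ≤ 2 * 1 := by gcongr; linarith
            nlinarith)
      unfold stepAngle
      linarith
    have h2 := Finset.sum_le_sum h1
    rw [← Finset.mul_sum, Finset.sum_sub_distrib] at h2
    have h3 := le_sum_bridgeProfile hh hh2 L
    have h4 : (L : ℝ) / 2 ≤ L - 2 / h := by
      have : 2 / h ≤ L / 2 := by rw [div_le_iff₀ hh]; linarith
      linarith
    have h5 : h * r * (L / 2) ≤ h * r * ∑ l ∈ Finset.range L, bridgeProfile h L l := by
      have := h4.trans h3
      gcongr
    have h6 : h * r * (L / 2) = 8 := by linarith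
    have := Real.pi_lt_d2
    simp only [hT]
    linarith
  obtain ⟨m, ⟨hm1, hm2⟩, -⟩ := existsUnique_add_zsmul_mem_Ico Real.two_pi_pos τ (T 1)
  obtain ⟨a, ⟨ha1, har⟩, ha⟩ := intermediate_value_Icc (show (1 : ℝ) ≤ 1 + r by linarith)
    hTc.continuousOn ⟨hm1, hm2.le.trans hTd⟩
  have hw : ∀ l < L, 0 ≤ h * (a * bridgeProfile h L l) ∧ h * (a * bridgeProfile h L l) ≤ 1 := by
    intro l _
    obtain ⟨b0, b1⟩ := bridgeProfile_mem hh hh2 L l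
    constructor
    · positivity
    · have h1 : a * bridgeProfile h L l ≤ 2 * 1 := by gcongr; linarith
      nlinarith
  have A := isArc_circlePoint hh hq hp hpq hw
  have hend : circlePoint q p (∑ m ∈ Finset.range L, stepAngle h (a * bridgeProfile h L m)) = p' := by
    have : (∑ m ∈ Finset.range L, stepAngle h (a * bridgeProfile h L m)) = τ + m • (2 * Real.pi) := ha
    rw [this, hτ, circlePoint, circlePoint, zsmul_eq_mul, Real.cos_add_int_mul_two_pi,
      Real.sin_add_int_mul_two_pi]
  refine ⟨a, _, ha1, har, A, ?_, ?_, ?_, hend, ?_⟩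
  · simp [circlePoint_zero]
  · simp [circlePoint_zero, optProfile, stepAngle, bridgeProfile]
  · have := A.succ_eq (l := L - 1) (by omega) (by simp [bridgeProfile, optProfile])
    rw [show L - 1 + 1 = L by omega] at this
    rw [← this]
    exact hend
  · refine (A.rowEnergy_le hh hq hw).trans ?_
    exact sum_stepCost_scaled_le hh (fun l => bridgeProfile_mem hh hh2 L l) ha1 har hr
      (sum_stepCost_bridge_le hh hh2 L)

end Pieces


/-! ### Recovery sequences of rows -/

theorem tendsto_optProfile {h : ℕ → ℝ} {m : ℕ → ℕ} (hh : ∀ n, 0 < h n)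
    (hh0 : Tendsto h atTop (𝓝 0)) (hm : Tendsto (fun n => h n * m n) atTop atTop) :
    Tendsto (fun n => optProfile (h n) (m n)) atTop (𝓝 1) := by
  have h1 : Tendsto (fun n => 1 - 1 / (h n * m n)) atTop (𝓝 1) := by
    have := (tendsto_const_nhds (x := (1 : ℝ))).sub hm.inv_tendsto_atTop
    simpa using this
  have hhalf : ∀ᶠ n in atTop, h n ≤ 1 / 2 :=
    (hh0.eventually_lt_const (show (0 : ℝ) < 1 / 2 by norm_num)).mono fun n hn => hn.le
  refine tendsto_of_tendsto_of_tendsto_of_le_of_le' h1 tendsto_const_nhds ?_ ?_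
  · filter_upwards [hhalf, hm.eventually_gt_atTop 0] with n h2 h3
    have : 0 < m n := by
      rcases Nat.eq_zero_or_pos (m n) with e | e
      · rw [e] at h3; simp at h3
      · exact e
    linarith [one_sub_optProfile_le (hh n) h2 this]
  · filter_upwards [hhalf] with n h2 using (optProfile_mem (hh n) h2 _).2.le

section Scaling

variable {h lam : ℕ → ℝ} {k : ℕ → ℕ} {Q : ℕ → Finset Space3}

/-- Intervals of fixed length hold many more than 1/h indices. The subtracted 1 matches the argument
`L - 1 - l` in `bridgeProfile`. -/
theorem IsScaling.tendsto_mul_floor_sub (H : IsScaling h lam k Q) {x y : ℝ} (hx : 0 ≤ x)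
    (hxy : x < y) :
    Tendsto (fun n => h n * ((⌊y / lam n⌋₊ - ⌊x / lam n⌋₊ - 1 : ℕ) : ℝ)) atTop atTop := by
  have h1 : Tendsto (fun n => h n / lam n) atTop atTop := by
    have : Tendsto (fun n => lam n / h n) atTop (𝓝[>] 0) :=
      tendsto_nhdsWithin_iff.2 ⟨H.ratio_tendsto, Eventually.of_forall fun n =>
        div_pos (H.lam_pos n) (H.h_pos n)⟩
    refine this.inv_tendsto_nhdsGT_zero.congr fun n => ?_
    simp
  have h2 : Tendsto (fun n => (y - x) * (h n / lam n) - 2 * h n) atTop atTop := by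
    have h3 := (h1.const_mul_atTop (sub_pos.2 hxy)).atTop_add (H.h_tendsto.const_mul (-2))
    refine h3.congr fun n => by ring
  refine tendsto_atTop_mono (fun n => ?_) h2
  have e1 := Nat.lt_floor_add_one (y / lam n)
  have e2 := Nat.floor_le (div_nonneg hx (H.lam_pos n).le)
  have e3 : (⌊y / lam n⌋₊ : ℝ) - ⌊x / lam n⌋₊ - 1 ≤
      ((⌊y / lam n⌋₊ - ⌊x / lam n⌋₊ - 1 : ℕ) : ℝ) := by
    have : (⌊y / lam n⌋₊ : ℝ) ≤
        ((⌊y / lam n⌋₊ - ⌊x / lam n⌋₊ - 1 : ℕ) : ℝ) + ⌊x / lam n⌋₊ + 1 := by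
      exact_mod_cast (by omega)
    linarith
  have e4 : (y - x) * (h n / lam n) - 2 * h n = h n * (y / lam n - x / lam n - 2) := by ring
  rw [e4]
  have := (H.h_pos n).le
  gcongr
  linarith

theorem IsScaling.eventually_floor_lt (H : IsScaling h lam k Q) {x y : ℝ} (hx : 0 ≤ x)
    (hxy : x < y) : ∀ᶠ n in atTop, ⌊x / lam n⌋₊ + 1 < ⌊y / lam n⌋₊ := by
  filter_upwards [(H.tendsto_mul_floor_sub hx hxy).eventually_gt_atTop 0] with n hn
  by_contra! hc
  rw [show ⌊y / lam n⌋₊ - ⌊x / lam n⌋₊ - 1 = 0 by omega] at hn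
  simp at hn

theorem IsScaling.tendsto_mul_length (H : IsScaling h lam k Q) {x y : ℝ} (hx : 0 ≤ x)
    (hxy : x < y) :
    Tendsto (fun n => h n * ((⌊y / lam n⌋₊ - ⌊x / lam n⌋₊ : ℕ) : ℝ)) atTop atTop := by
  refine tendsto_atTop_mono (fun n => ?_) (H.tendsto_mul_floor_sub hx hxy)
  exact mul_le_mul_of_nonneg_left (by exact_mod_cast Nat.sub_le _ _) (H.h_pos n).le

end Scaling

/-- The energy density of a triple of neighbouring spins. -/
def tripleEnergy (h : ℝ) (v : ℕ → Space3) (i : ℕ) : ℝ :=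
  ‖v i - (2 - h ^ 2) • v (i + 1) + v (i + 2)‖ ^ 2 / h ^ 3

/-- Rows over the interval `[s, t]` that recover the profile `ζ` with the energy of `κ` half
transitions. -/
structure IsRecovery (h lam : ℕ → ℝ) (Q : ℕ → Finset Space3) (s t : ℝ) (κ : ℝ) (S : Set ℝ)
    (ζ : ℝ → Space3) (v : ℕ → ℕ → Space3) : Prop where
  mem : ∀ᶠ n in atTop, ∀ i, ⌊s / lam n⌋₊ ≤ i → i ≤ ⌊t / lam n⌋₊ →
    ‖v n i‖ = 1 ∧ ∃ q ∈ Q n, inner ℝ (v n i) q = 0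
  energy : ∀ ε > 0, ∀ᶠ n in atTop,
    ∑ i ∈ Finset.Ico ⌊s / lam n⌋₊ (⌊t / lam n⌋₊ - 1), tripleEnergy (h n) (v n) i ≤ κ * (4 / 3) + ε
  tendsto : ∀ x ∈ Ioo s t, x ∉ S →
    Tendsto (fun n => rowChir (h n) (v n) ⌊x / lam n⌋₊) atTop (𝓝 (ζ x))

/-- A sequence of axes. -/
structure IsAxis (Q : ℕ → Finset Space3) (q : ℕ → Space3) (c : Space3) : Prop where
  mem : ∀ n, q n ∈ Q n ∨ -q n ∈ Q n
  tendsto : Tendsto q atTop (𝓝 c)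

section Recovery

variable {h lam : ℕ → ℝ} {k : ℕ → ℕ} {Q : ℕ → Finset Space3}

theorem IsAxis.norm_eq {q : ℕ → Space3} {c : Space3} (H : IsScaling h lam k Q)
    (hq : IsAxis Q q c) (n : ℕ) : ‖q n‖ = 1 := by
  rcases hq.mem n with h1 | h1
  · exact H.norm_eq n _ h1
  · rw [← norm_neg]; exact H.norm_eq n _ h1

theorem IsAxis.exists_inner_eq_zero {q : ℕ → Space3} {c : Space3} (hq : IsAxis Q q c) {n : ℕ}
    {v : Space3} (hv : inner ℝ v (q n) = 0) : ∃ q ∈ Q n, inner ℝ v q = 0 := by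
  rcases hq.mem n with h1 | h1
  · exact ⟨_, h1, hv⟩
  · exact ⟨_, h1, by rw [inner_neg_right, hv, neg_zero]⟩

theorem tendsto_arcBound {r : ℕ → ℝ} (hh0 : Tendsto h atTop (𝓝 0)) (hr : Tendsto r atTop (𝓝 0))
    (κ : ℝ) : Tendsto (fun n => arcBound (h n) κ (r n)) atTop (𝓝 (κ * (4 / 3))) := by
  have h1 : Continuous fun p : ℝ × ℝ => arcBound p.1 κ p.2 := by unfold arcBound; fun_prop
  have h2 := (h1.tendsto (0, 0)).comp (hh0.prodMk_nhds hr)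
  have e : arcBound (0 : ℝ) κ 0 = κ * (4 / 3) := by unfold arcBound; ring
  simp only [e] at h2
  exact h2

/-- The scale and the profile at an interior point both tend to 1, so the chirality tends to the
limit of the axes. The arc is shifted to start at ⌊s/λ⌋. -/
theorem isRecovery_of_isArc (H : IsScaling h lam k Q) {q : ℕ → Space3} {c : Space3}
    (hq : IsAxis Q q c) {s t κ : ℝ} (hs : 0 ≤ s) {S : Set ℝ} {ζ : ℝ → Space3}
    (hζ : ∀ x ∈ Ioo s t, ζ x = c) {α B : ℕ → ℝ} {V : ℕ → ℕ → ℝ} {v : ℕ → ℕ → Space3}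
    (hA : ∀ᶠ n in atTop, IsArc (h n) (q n) (⌊t / lam n⌋₊ - ⌊s / lam n⌋₊)
      (fun l => α n * V n l) (v n))
    (hα : Tendsto α atTop (𝓝 1))
    (hV : ∀ x ∈ Ioo s t, Tendsto (fun n => V n (⌊x / lam n⌋₊ - ⌊s / lam n⌋₊)) atTop (𝓝 1))
    (hE : ∀ᶠ n in atTop, rowEnergy (h n) (⌊t / lam n⌋₊ - ⌊s / lam n⌋₊) (v n) ≤ B n)
    (hB : Tendsto B atTop (𝓝 (κ * (4 / 3)))) :
    IsRecovery h lam Q s t κ S ζ (fun n i => v n (i - ⌊s / lam n⌋₊)) where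
  mem := by
    filter_upwards [hA] with n hn i _ _
    exact ⟨hn.norm_eq _, hq.exists_inner_eq_zero (hn.inner_axis _)⟩
  energy ε hε := by
    filter_upwards [hE, hB.eventually_lt_const (show κ * (4 / 3) < κ * (4 / 3) + ε by linarith)]
      with n h1 h2
    refine le_trans (le_of_eq ?_) (h1.trans h2.le)
    rw [Finset.sum_Ico_eq_sum_range, rowEnergy,
      show ⌊t / lam n⌋₊ - 1 - ⌊s / lam n⌋₊ = ⌊t / lam n⌋₊ - ⌊s / lam n⌋₊ - 1 by omega]
    refine Finset.sum_congr rfl fun i _ => ?_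
    rw [tripleEnergy, Nat.add_sub_cancel_left,
      show ⌊s / lam n⌋₊ + i + 1 - ⌊s / lam n⌋₊ = i + 1 by omega,
      show ⌊s / lam n⌋₊ + i + 2 - ⌊s / lam n⌋₊ = i + 2 by omega]
  tendsto x hx _ := by
    rw [hζ x hx]
    have hw : Tendsto (fun n => α n * V n (⌊x / lam n⌋₊ - ⌊s / lam n⌋₊)) atTop (𝓝 1) := by
      simpa using hα.mul (hV x hx)
    have hsc : Tendsto (fun n => stepChir (h n) (α n * V n (⌊x / lam n⌋₊ - ⌊s / lam n⌋₊)))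
        atTop (𝓝 1) := by
      have hc : Continuous fun p : ℝ × ℝ => stepChir p.1 p.2 := by unfold stepChir; fun_prop
      have h2 := (hc.tendsto (0, 1)).comp (H.h_tendsto.prodMk_nhds hw)
      have e : stepChir 0 1 = 1 := by simp [stepChir]
      simp only [e] at h2
      exact h2
    have h3 := hsc.smul hq.tendsto
    rw [one_smul] at h3
    refine h3.congr' ?_
    filter_upwards [hA, H.eventually_floor_lt hs hx.1,
      H.eventually_floor_lt (hs.trans hx.1.le) hx.2] with n h4 h5 h6
    rw [← h4.rowChir_eq _ (show ⌊x / lam n⌋₊ - ⌊s / lam n⌋₊ < ⌊t / lam n⌋₊ - ⌊s / lam n⌋₊ by omega)]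
    rw [rowChir, rowChir,
      show ⌊x / lam n⌋₊ + 1 - ⌊s / lam n⌋₊ = ⌊x / lam n⌋₊ - ⌊s / lam n⌋₊ + 1 by omega]

/-- Two recovery sequences that are locally constant near their common end can be joined. -/
theorem IsRecovery.glue (H : IsScaling h lam k Q) {s t r κ κ' : ℝ} (hs : 0 ≤ s) (hst : s < t)
    (htr : t < r) {S S' : Set ℝ} {ζ : ℝ → Space3} {v v' : ℕ → ℕ → Space3} {p : ℕ → Space3}
    (A : IsRecovery h lam Q s t κ S ζ v) (A' : IsRecovery h lam Q t r κ' S' ζ v')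
    (hv : ∀ᶠ n in atTop, v n ⌊t / lam n⌋₊ = p n ∧ v n (⌊t / lam n⌋₊ - 1) = p n)
    (hv' : ∀ᶠ n in atTop, v' n ⌊t / lam n⌋₊ = p n ∧ v' n (⌊t / lam n⌋₊ + 1) = p n) :
    IsRecovery h lam Q s r (κ + κ') (insert t (S ∪ S')) ζ
      (fun n i => if i ≤ ⌊t / lam n⌋₊ then v n i else v' n i) where
  mem := by
    filter_upwards [A.mem, A'.mem] with n h1 h2 i hi hi'
    split_ifs with hc
    · exact h1 i hi hc
    · exact h2 i (by omega) hi'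
  energy ε hε := by
    have hhε : ∀ᶠ n in atTop, h n < ε / 3 := H.h_tendsto.eventually_lt_const (by positivity)
    filter_upwards [A.energy (ε / 3) (by positivity), A'.energy (ε / 3) (by positivity), hhε, hv,
      hv', A.mem, H.eventually_floor_lt hs hst, H.eventually_floor_lt (hs.trans hst.le) htr]
      with n e1 e2 e3 ⟨p1, p2⟩ ⟨p3, p4⟩ hm l1 l2
    set a := ⌊s / lam n⌋₊
    set b := ⌊t / lam n⌋₊
    set d := ⌊r / lam n⌋₊
    set w : ℕ → Space3 := fun i => if i ≤ b then v n i else v' n i with hw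
    have w1 : ∀ i ≤ b, w i = v n i := fun i hi => if_pos hi
    have w2 : ∀ i, b ≤ i → w i = v' n i := by
      intro i hi
      rcases hi.eq_or_lt with e | e
      · rw [← e, w1 b le_rfl, p1, p3]
      · exact if_neg (not_le.2 e)
    have s1 : ∑ i ∈ Finset.Ico a (b - 1), tripleEnergy (h n) w i =
        ∑ i ∈ Finset.Ico a (b - 1), tripleEnergy (h n) (v n) i := by
      refine Finset.sum_congr rfl fun i hi => ?_
      rw [Finset.mem_Ico] at hi
      rw [tripleEnergy, tripleEnergy, w1 i (by omega), w1 (i + 1) (by omega), w1 (i + 2) (by omega)]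
    have s2 : ∑ i ∈ Finset.Ico b (d - 1), tripleEnergy (h n) w i =
        ∑ i ∈ Finset.Ico b (d - 1), tripleEnergy (h n) (v' n) i := by
      refine Finset.sum_congr rfl fun i hi => ?_
      rw [Finset.mem_Ico] at hi
      rw [tripleEnergy, tripleEnergy, w2 i (by omega), w2 (i + 1) (by omega), w2 (i + 2) (by omega)]
    -- The only triple that sees both rows consists of three copies of p, with energy |h² p|²/h³.
    have s3 : tripleEnergy (h n) w (b - 1) = h n := by
      have hp : ‖p n‖ = 1 := by rw [← p1]; exact (hm b (by omega) le_rfl).1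
      rw [tripleEnergy, show b - 1 + 1 = b by omega, show b - 1 + 2 = b + 1 by omega,
        w1 (b - 1) (by omega), w1 b le_rfl, w2 (b + 1) (by omega), p1, p2, p4,
        show p n - (2 - h n ^ 2) • p n + p n = (h n ^ 2) • p n by module, norm_smul, hp]
      have := H.h_pos n
      rw [Real.norm_of_nonneg (by positivity)]
      field_simp
    rw [← Finset.sum_Ico_consecutive _ (show a ≤ b - 1 by omega) (show b - 1 ≤ d - 1 by omega),
      Finset.sum_eq_sum_Ico_succ_bot (show b - 1 < d - 1 by omega), show b - 1 + 1 = b by omega,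
      s1, s2, s3]
    linarith
  tendsto x hx hxS := by
    simp only [mem_insert_iff, mem_union, not_or] at hxS
    rcases lt_or_gt_of_ne hxS.1 with hlt | hgt
    · refine (A.tendsto x ⟨hx.1, hlt⟩ hxS.2.1).congr' ?_
      filter_upwards [H.eventually_floor_lt (hs.trans hx.1.le) hlt] with n hn
      rw [rowChir, rowChir, if_pos (by omega), if_pos (by omega)]
    · refine (A'.tendsto x ⟨hgt, hx.2⟩ hxS.2.2).congr' ?_
      filter_upwards [H.eventually_floor_lt (hs.trans hst.le) hgt] with n hn
      rw [rowChir, rowChir, if_neg (by omega), if_neg (by omega)]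

/-- This is the slack r determined by hLr = 16 in `exists_bridge` and `exists_half_arc`. -/
theorem IsScaling.tendsto_slack (H : IsScaling h lam k Q) {s t : ℝ} (hs : 0 ≤ s) (hst : s < t) :
    Tendsto (fun n => 16 / (h n * ((⌊t / lam n⌋₊ - ⌊s / lam n⌋₊ : ℕ) : ℝ))) atTop (𝓝 0) :=
  (H.tendsto_mul_length hs hst).const_div_atTop 16

theorem IsScaling.eventually_slack (H : IsScaling h lam k Q) {s t : ℝ} (hs : 0 ≤ s)
    (hst : s < t) : ∀ᶠ n in atTop, h n ≤ 1 / 2 ∧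
      h n * ((⌊t / lam n⌋₊ - ⌊s / lam n⌋₊ : ℕ) : ℝ) *
        (16 / (h n * ((⌊t / lam n⌋₊ - ⌊s / lam n⌋₊ : ℕ) : ℝ))) = 16 ∧
      16 / (h n * ((⌊t / lam n⌋₊ - ⌊s / lam n⌋₊ : ℕ) : ℝ)) ≤ 1 := by
  filter_upwards [H.h_tendsto.eventually_lt_const (show (0 : ℝ) < 1 / 2 by norm_num),
    (H.tendsto_mul_length hs hst).eventually_gt_atTop 0,
    (H.tendsto_slack hs hst).eventually_lt_const one_pos] with n h1 h2 h3
  exact ⟨h1.le, mul_div_cancel₀ _ h2.ne', h3.le⟩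

theorem IsScaling.tendsto_scale (H : IsScaling h lam k Q) {s t : ℝ} (hs : 0 ≤ s) (hst : s < t)
    {α : ℕ → ℝ} (hα : ∀ᶠ n in atTop, 1 ≤ α n ∧
      α n ≤ 1 + 16 / (h n * ((⌊t / lam n⌋₊ - ⌊s / lam n⌋₊ : ℕ) : ℝ))) :
    Tendsto α atTop (𝓝 1) := by
  have h1 := (tendsto_const_nhds (x := (1 : ℝ))).add (H.tendsto_slack hs hst)
  rw [add_zero] at h1
  exact tendsto_of_tendsto_of_tendsto_of_le_of_le' tendsto_const_nhds h1
    (hα.mono fun n hn => hn.1) (hα.mono fun n hn => hn.2)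

theorem exists_recovery_bridge (H : IsScaling h lam k Q) {q : ℕ → Space3} {c : Space3}
    (hq : IsAxis Q q c) {s t : ℝ} (hs : 0 ≤ s) (hst : s < t) (S : Set ℝ) {ζ : ℝ → Space3}
    (hζ : ∀ x ∈ Ioo s t, ζ x = c) {p p' : ℕ → Space3} (hp : ∀ n, ‖p n‖ = 1)
    (hpq : ∀ n, inner ℝ (p n) (q n) = 0) (hp' : ∀ n, ‖p' n‖ = 1)
    (hpq' : ∀ n, inner ℝ (p' n) (q n) = 0) :
    ∃ v, IsRecovery h lam Q s t 2 S ζ v ∧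
      (∀ᶠ n in atTop, v n ⌊s / lam n⌋₊ = p n ∧ v n (⌊s / lam n⌋₊ + 1) = p n) ∧
      ∀ᶠ n in atTop, v n ⌊t / lam n⌋₊ = p' n ∧ v n (⌊t / lam n⌋₊ - 1) = p' n := by
  have h1 : ∀ᶠ n in atTop, ∃ w : ℝ × (ℕ → Space3), 1 ≤ w.1 ∧
      w.1 ≤ 1 + 16 / (h n * ((⌊t / lam n⌋₊ - ⌊s / lam n⌋₊ : ℕ) : ℝ)) ∧
      IsArc (h n) (q n) (⌊t / lam n⌋₊ - ⌊s / lam n⌋₊)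
        (fun l => w.1 * bridgeProfile (h n) (⌊t / lam n⌋₊ - ⌊s / lam n⌋₊) l) w.2 ∧
      w.2 0 = p n ∧ w.2 1 = p n ∧ w.2 (⌊t / lam n⌋₊ - ⌊s / lam n⌋₊ - 1) = p' n ∧
      w.2 (⌊t / lam n⌋₊ - ⌊s / lam n⌋₊) = p' n ∧
      rowEnergy (h n) (⌊t / lam n⌋₊ - ⌊s / lam n⌋₊) w.2 ≤
        arcBound (h n) 2 (16 / (h n * ((⌊t / lam n⌋₊ - ⌊s / lam n⌋₊ : ℕ) : ℝ))) := by
    filter_upwards [H.eventually_slack hs hst] with n ⟨a, b, d⟩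
    obtain ⟨α, v, hv⟩ := exists_bridge (H.h_pos n) a b d (hq.norm_eq H n) (hp n) (hpq n) (hp' n)
      (hpq' n)
    exact ⟨(α, v), hv⟩
  obtain ⟨w, hw⟩ := h1.choice
  refine ⟨_, isRecovery_of_isArc H hq hs hζ (α := fun n => (w n).1) (v := fun n => (w n).2)
    (hw.mono fun n hn => hn.2.2.1)
    (H.tendsto_scale hs hst (hw.mono fun n hn => ⟨hn.1, hn.2.1⟩)) ?_
    (hw.mono fun n hn => hn.2.2.2.2.2.2.2)
    (tendsto_arcBound H.h_tendsto (H.tendsto_slack hs hst) 2), ?_, ?_⟩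
  · intro x hx
    -- An interior point is far from both ends on the scale 1/h, so both arguments of the minimum
    -- give profiles tending to 1.
    have t1 := tendsto_optProfile H.h_pos H.h_tendsto (H.tendsto_mul_length hs hx.1)
    have t2 := tendsto_optProfile H.h_pos H.h_tendsto
      (H.tendsto_mul_floor_sub (hs.trans hx.1.le) hx.2)
    have t3 := t1.min t2
    rw [min_self] at t3
    refine t3.congr' ?_
    filter_upwards [H.h_tendsto.eventually_lt_const (show (0 : ℝ) < 1 / 2 by norm_num),
      H.eventually_floor_lt hs hx.1, H.eventually_floor_lt (hs.trans hx.1.le) hx.2] with n hn l1 l2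
    rw [bridgeProfile, (optProfile_mono (H.h_pos n) hn.le).map_min]
    congr 2
    omega
  · filter_upwards [hw] with n hn
    rw [Nat.sub_self, Nat.add_sub_cancel_left]
    exact ⟨hn.2.2.2.1, hn.2.2.2.2.1⟩
  · filter_upwards [hw] with n hn
    rw [show ⌊t / lam n⌋₊ - 1 - ⌊s / lam n⌋₊ = ⌊t / lam n⌋₊ - ⌊s / lam n⌋₊ - 1 by omega]
    exact ⟨hn.2.2.2.2.2.2.1, hn.2.2.2.2.2.1⟩

theorem exists_recovery_last (H : IsScaling h lam k Q) {q : ℕ → Space3} {c : Space3}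
    (hq : IsAxis Q q c) {s t : ℝ} (hs : 0 ≤ s) (hst : s < t) (S : Set ℝ) {ζ : ℝ → Space3}
    (hζ : ∀ x ∈ Ioo s t, ζ x = c) {p : ℕ → Space3} (hp : ∀ n, ‖p n‖ = 1)
    (hpq : ∀ n, inner ℝ (p n) (q n) = 0) :
    ∃ v, IsRecovery h lam Q s t 1 S ζ v ∧
      (∀ᶠ n in atTop, v n ⌊s / lam n⌋₊ = p n ∧ v n (⌊s / lam n⌋₊ + 1) = p n) ∧
      ∀ᶠ n in atTop, inner ℝ (v n (⌊t / lam n⌋₊ - 1)) (v n ⌊t / lam n⌋₊) = 1 - h n ^ 2 / 2 := by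
  have h1 : ∀ᶠ n in atTop, ∃ w : ℝ × (ℕ → Space3), 1 ≤ w.1 ∧
      w.1 ≤ 1 + 16 / (h n * ((⌊t / lam n⌋₊ - ⌊s / lam n⌋₊ : ℕ) : ℝ)) ∧
      IsArc (h n) (q n) (⌊t / lam n⌋₊ - ⌊s / lam n⌋₊)
        (fun l => w.1 * optProfile (h n) l) w.2 ∧
      w.2 0 = p n ∧ w.2 1 = p n ∧
      inner ℝ (w.2 (⌊t / lam n⌋₊ - ⌊s / lam n⌋₊ - 1)) (w.2 (⌊t / lam n⌋₊ - ⌊s / lam n⌋₊)) =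
        1 - h n ^ 2 / 2 ∧
      rowEnergy (h n) (⌊t / lam n⌋₊ - ⌊s / lam n⌋₊) w.2 ≤
        arcBound (h n) 1 (16 / (h n * ((⌊t / lam n⌋₊ - ⌊s / lam n⌋₊ : ℕ) : ℝ))) := by
    filter_upwards [H.eventually_slack hs hst] with n ⟨a, b, d⟩
    obtain ⟨α, v, hv⟩ := exists_half_arc (H.h_pos n) a b d (hq.norm_eq H n) (hp n) (hpq n)
    exact ⟨(α, v), hv⟩
  obtain ⟨w, hw⟩ := h1.choice
  refine ⟨_, isRecovery_of_isArc H hq hs hζ (α := fun n => (w n).1) (v := fun n => (w n).2)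
    (V := fun n => optProfile (h n)) (hw.mono fun n hn => hn.2.2.1)
    (H.tendsto_scale hs hst (hw.mono fun n hn => ⟨hn.1, hn.2.1⟩)) ?_
    (hw.mono fun n hn => hn.2.2.2.2.2.2)
    (tendsto_arcBound H.h_tendsto (H.tendsto_slack hs hst) 1), ?_, ?_⟩
  · intro x hx
    exact tendsto_optProfile H.h_pos H.h_tendsto (H.tendsto_mul_length hs hx.1)
  · filter_upwards [hw] with n hn
    rw [Nat.sub_self, Nat.add_sub_cancel_left]
    exact ⟨hn.2.2.2.1, hn.2.2.2.2.1⟩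
  · filter_upwards [hw] with n hn
    rw [show ⌊t / lam n⌋₊ - 1 - ⌊s / lam n⌋₊ = ⌊t / lam n⌋₊ - ⌊s / lam n⌋₊ - 1 by omega]
    exact hn.2.2.2.2.2.1

theorem rowEnergy_reverse (h : ℝ) (L : ℕ) (v : ℕ → Space3) :
    rowEnergy h L (fun l => v (L - l)) = rowEnergy h L v := by
  rw [rowEnergy, rowEnergy, ← Finset.sum_range_reflect]
  refine Finset.sum_congr rfl fun i hi => ?_
  rw [Finset.mem_range] at hi
  rw [show L - (L - 1 - 1 - i) = i + 2 by omega, show L - (L - 1 - 1 - i + 1) = i + 1 by omega,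
    show L - (L - 1 - 1 - i + 2) = i by omega]
  congr 3
  abel

/-- The half arc of `exists_recovery_last` read backwards. Reversal changes the sign of the axis, so
the arc is built on -q. -/
theorem exists_recovery_first (H : IsScaling h lam k Q) {q : ℕ → Space3} {c : Space3}
    (hq : IsAxis Q q c) {t : ℝ} (ht : 0 < t) (S : Set ℝ) {ζ : ℝ → Space3}
    (hζ : ∀ x ∈ Ioo 0 t, ζ x = c) {p : ℕ → Space3} (hp : ∀ n, ‖p n‖ = 1)
    (hpq : ∀ n, inner ℝ (p n) (q n) = 0) :
    ∃ v, IsRecovery h lam Q 0 t 1 S ζ v ∧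
      (∀ᶠ n in atTop, v n ⌊t / lam n⌋₊ = p n ∧ v n (⌊t / lam n⌋₊ - 1) = p n) ∧
      ∀ᶠ n in atTop, inner ℝ (v n 0) (v n 1) = 1 - h n ^ 2 / 2 := by
  have hf : ∀ n, ⌊(0 : ℝ) / lam n⌋₊ = 0 := fun n => by simp
  have h1 : ∀ᶠ n in atTop, ∃ w : ℝ × (ℕ → Space3), 1 ≤ w.1 ∧
      w.1 ≤ 1 + 16 / (h n * ((⌊t / lam n⌋₊ - ⌊(0 : ℝ) / lam n⌋₊ : ℕ) : ℝ)) ∧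
      IsArc (h n) (-q n) (⌊t / lam n⌋₊ - ⌊(0 : ℝ) / lam n⌋₊)
        (fun l => w.1 * optProfile (h n) l) w.2 ∧
      w.2 0 = p n ∧ w.2 1 = p n ∧
      inner ℝ (w.2 (⌊t / lam n⌋₊ - ⌊(0 : ℝ) / lam n⌋₊ - 1))
        (w.2 (⌊t / lam n⌋₊ - ⌊(0 : ℝ) / lam n⌋₊)) = 1 - h n ^ 2 / 2 ∧
      rowEnergy (h n) (⌊t / lam n⌋₊ - ⌊(0 : ℝ) / lam n⌋₊) w.2 ≤
        arcBound (h n) 1 (16 / (h n * ((⌊t / lam n⌋₊ - ⌊(0 : ℝ) / lam n⌋₊ : ℕ) : ℝ))) := by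
    filter_upwards [H.eventually_slack le_rfl ht] with n ⟨a, b, d⟩
    obtain ⟨α, v, hv⟩ := exists_half_arc (H.h_pos n) a b d
      ((norm_neg (q n)).trans (hq.norm_eq H n)) (hp n)
      (by rw [inner_neg_right, hpq n, neg_zero])
    exact ⟨(α, v), hv⟩
  obtain ⟨w, hw⟩ := h1.choice
  refine ⟨_, isRecovery_of_isArc H hq le_rfl hζ (α := fun n => (w n).1)
    (v := fun n l => (w n).2 (⌊t / lam n⌋₊ - ⌊(0 : ℝ) / lam n⌋₊ - l))
    (V := fun n l => optProfile (h n) (⌊t / lam n⌋₊ - ⌊(0 : ℝ) / lam n⌋₊ - 1 - l))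
    (hw.mono fun n hn => hn.2.2.1.reverse)
    (H.tendsto_scale le_rfl ht (hw.mono fun n hn => ⟨hn.1, hn.2.1⟩)) ?_
    (hw.mono fun n hn => (rowEnergy_reverse _ _ _).trans_le hn.2.2.2.2.2.2)
    (tendsto_arcBound H.h_tendsto (H.tendsto_slack le_rfl ht) 1), ?_, ?_⟩
  · intro x hx
    refine (tendsto_optProfile H.h_pos H.h_tendsto
      (H.tendsto_mul_floor_sub hx.1.le hx.2)).congr fun n => ?_
    rw [hf]
    congr 1
    omega
  · filter_upwards [hw, H.eventually_floor_lt le_rfl ht] with n hn hl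
    rw [hf] at hn hl ⊢
    simp only [Nat.sub_zero, Nat.sub_self]
    rw [show ⌊t / lam n⌋₊ - (⌊t / lam n⌋₊ - 1) = 1 by omega]
    exact ⟨hn.2.2.2.1, hn.2.2.2.2.1⟩
  · filter_upwards [hw] with n hn
    rw [hf] at hn ⊢
    simp only [Nat.sub_zero] at hn ⊢
    rw [real_inner_comm]
    exact hn.2.2.2.2.2.1

/-- A uniform rotation with w = 1 has zero energy and meets the boundary values at both ends. -/
theorem exists_recovery_const (H : IsScaling h lam k Q) {q : ℕ → Space3} {c : Space3}
    (hq : IsAxis Q q c) (S : Set ℝ) {ζ : ℝ → Space3} (hζ : ∀ x ∈ Ioo 0 1, ζ x = c) :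
    ∃ v, IsRecovery h lam Q 0 1 0 S ζ v ∧
      ∀ᶠ n in atTop, inner ℝ (v n 0) (v n 1) = 1 - h n ^ 2 / 2 ∧
        inner ℝ (v n (⌊1 / lam n⌋₊ - 1)) (v n ⌊1 / lam n⌋₊) = 1 - h n ^ 2 / 2 := by
  choose p hp hpq _ using fun n => exists_unit_orthogonal (q n) (q n)
  have hw : ∀ᶠ n in atTop, ∀ l < ⌊1 / lam n⌋₊ - ⌊(0 : ℝ) / lam n⌋₊,
      0 ≤ h n * ((1 : ℝ) * 1) ∧ h n * ((1 : ℝ) * 1) ≤ 1 := by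
    filter_upwards [H.h_tendsto.eventually_lt_const one_pos] with n hn l _
    have := H.h_pos n
    constructor <;> linarith
  have hA : ∀ᶠ n in atTop, IsArc (h n) (q n) (⌊1 / lam n⌋₊ - ⌊(0 : ℝ) / lam n⌋₊)
      (fun _ => (1 : ℝ) * 1)
      (fun l => circlePoint (q n) (p n) (∑ m ∈ Finset.range l, stepAngle (h n) (1 * 1))) :=
    hw.mono fun n hn => isArc_circlePoint (H.h_pos n) (hq.norm_eq H n) (hp n) (hpq n) hn
  refine ⟨_, isRecovery_of_isArc H hq le_rfl hζ (α := fun _ => 1) (V := fun _ _ => 1) (B := fun _ => 0)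
    hA tendsto_const_nhds (fun _ _ => tendsto_const_nhds) ?_ (by simp), ?_⟩
  · filter_upwards [hA, hw] with n h1 h2
    refine (h1.rowEnergy_le (H.h_pos n) (hq.norm_eq H n) h2).trans ?_
    simp only [stepCost]
    norm_num
  · filter_upwards [hA, H.eventually_floor_lt le_rfl (zero_lt_one (α := ℝ))] with n h1 h2
    have hf : ⌊(0 : ℝ) / lam n⌋₊ = 0 := by simp
    rw [hf] at h1 h2 ⊢
    have e1 := h1.inner_succ 0 (by omega)
    have e2 := h1.inner_succ (⌊1 / lam n⌋₊ - 1) (by omega)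
    rw [show ⌊1 / lam n⌋₊ - 1 + 1 = ⌊1 / lam n⌋₊ by omega] at e2
    simp only [Nat.sub_zero]
    constructor
    · rw [e1]; ring
    · rw [e2]; ring

end Recovery


/-! ### Chaining the pieces along the jumps -/

/-- `ζ` is constant, and continuous from the left, between the points of `S` in `(s, 1)`. -/
def IsPiecewiseConst (s : ℝ) (S : Finset ℝ) (ζ : ℝ → Space3) : Prop :=
  ∀ x ∈ Ioo s 1, ∀ y ∈ Ioo s 1, x ≤ y → (∀ t ∈ S, t ∉ Ico x y) → ζ x = ζ y

theorem isPiecewiseConst_stepFunction (s : ℝ) (S : Finset ℝ) (c : Space3) (Δ : ℝ → Space3) :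
    IsPiecewiseConst s S (stepFunction S c Δ) := by
  intro x _ y _ hxy hS
  unfold stepFunction
  congr 1
  refine Finset.sum_congr rfl fun t ht => ?_
  have : t < x ↔ t < y := ⟨fun h => h.trans_le hxy, fun h => by
    by_contra! hc; exact hS t ht ⟨hc, h⟩⟩
  simp only [this]

theorem IsPiecewiseConst.exists_right_value {s : ℝ} {S : Finset ℝ} {ζ : ℝ → Space3}
    (hζ : IsPiecewiseConst s S ζ) {a : ℝ} (hsa : s ≤ a) (ha : a < 1) :
    ∃ y ∈ Ioo a 1, ∀ᶠ x in 𝓝[>] a, ζ x = ζ y := by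
  have h1 : ∀ᶠ x in 𝓝[>] a, ∀ t ∈ S, t ≤ a ∨ x < t := by
    refine (S.eventually_all).2 fun t _ => ?_
    rcases le_or_gt t a with h | h
    · exact Eventually.of_forall fun _ => Or.inl h
    · exact ((eventually_lt_nhds h).filter_mono nhdsWithin_le_nhds).mono fun x hx => Or.inr hx
  obtain ⟨y, hy, hyI⟩ := (h1.and (Ioo_mem_nhdsGT ha)).exists
  refine ⟨y, hyI, ?_⟩
  filter_upwards [Ioo_mem_nhdsGT hyI.1] with x hx
  refine hζ x ⟨hsa.trans_lt hx.1, hx.2.trans hyI.2⟩ y ⟨hsa.trans_lt hyI.1, hyI.2⟩ hx.2.le ?_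
  rintro t ht ⟨h2, h3⟩
  rcases hy t ht with h | h
  · linarith [hx.1]
  · linarith

theorem IsPiecewiseConst.eq_right_value {s : ℝ} {S : Finset ℝ} {ζ : ℝ → Space3}
    (hζ : IsPiecewiseConst s S ζ) {c : Space3} (hc : ∀ᶠ x in 𝓝[>] s, ζ x = c) {t : ℝ}
    (ht : t ≤ 1) (hS : ∀ r ∈ S, t ≤ r) {x : ℝ} (hx : x ∈ Ioo s t) : ζ x = c := by
  obtain ⟨y, hy, hyI⟩ := (hc.and (Ioo_mem_nhdsGT hx.1)).exists
  rw [← hy]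
  refine (hζ y ⟨hyI.1, hyI.2.trans (hx.2.trans_le ht)⟩ x ⟨hx.1, hx.2.trans_le ht⟩ hyI.2.le ?_).symm
  rintro r hr ⟨_, h2⟩
  linarith [hS r hr, hx.2]

theorem IsPiecewiseConst.erase {s t : ℝ} {S : Finset ℝ} {ζ : ℝ → Space3}
    (hζ : IsPiecewiseConst s S ζ) (hst : s ≤ t) : IsPiecewiseConst t (S.erase t) ζ := by
  intro x hx y hy hxy hS
  refine hζ x ⟨hst.trans_lt hx.1, hx.2⟩ y ⟨hst.trans_lt hy.1, hy.2⟩ hxy fun r hr hrI => ?_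
  refine hS r (Finset.mem_erase.2 ⟨?_, hr⟩) hrI
  rintro rfl
  exact absurd hrI.1 (not_le.2 hx.1)

section Recovery

variable {h lam : ℕ → ℝ} {k : ℕ → ℕ} {Q : ℕ → Finset Space3} {ζ : ℝ → Space3}

/-- Induction on the number of jumps right of `s`: a bridge leads to the first of them and ends in a
common point p' of the old and the new circle, where the remaining row starts. A bridge counts as
two half transitions and the final piece as one, hence 2m + 1. -/
theorem exists_recovery_tail (H : IsScaling h lam k Q)
    (hQ : ∀ x ∈ Ioo (0 : ℝ) 1, ∃ q, IsAxis Q q (ζ x)) (m : ℕ) :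
    ∀ (s : ℝ) (S : Finset ℝ) (q p : ℕ → Space3) (c : Space3), 0 ≤ s → s < 1 →
      (∀ t ∈ S, t ∈ Ioo s 1) → S.card = m → IsPiecewiseConst s S ζ →
      IsAxis Q q c → (∀ᶠ x in 𝓝[>] s, ζ x = c) → (∀ n, ‖p n‖ = 1) →
      (∀ n, inner ℝ (p n) (q n) = 0) →
    ∃ v, IsRecovery h lam Q s 1 (2 * m + 1) S ζ v ∧
      (∀ᶠ n in atTop, v n ⌊s / lam n⌋₊ = p n ∧ v n (⌊s / lam n⌋₊ + 1) = p n) ∧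
      ∀ᶠ n in atTop, inner ℝ (v n (⌊1 / lam n⌋₊ - 1)) (v n ⌊1 / lam n⌋₊) = 1 - h n ^ 2 / 2 := by
  induction m with
  | zero =>
    intro s S q p c hs hs1 hS hm hζ hq hc hp hpq
    have hS0 := Finset.card_eq_zero.1 hm
    subst hS0
    have := exists_recovery_last H hq hs hs1 (∅ : Finset ℝ)
      (fun x hx => hζ.eq_right_value hc le_rfl (by simp) hx) hp hpq
    simpa using this
  | succ m ih =>
    intro s S q p c hs hs1 hS hm hζ hq hc hp hpq
    have hne : S.Nonempty := by rw [← Finset.card_pos]; omega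
    set t := S.min' hne with ht
    have htS : t ∈ S := S.min'_mem hne
    have htI := hS t htS
    have hmin : ∀ r ∈ S, t ≤ r := fun r hr => S.min'_le r hr
    obtain ⟨y, hyI, hy⟩ := hζ.exists_right_value htI.1.le htI.2
    obtain ⟨q', hq'⟩ := hQ y ⟨hs.trans_lt (htI.1.trans hyI.1), hyI.2⟩
    choose p' hp' hpq' hpq'' using fun n => exists_unit_orthogonal (q n) (q' n)
    obtain ⟨v, hv, hvs, hve⟩ := exists_recovery_bridge H hq hs htI.1 ∅
      (fun x hx => hζ.eq_right_value hc htI.2.le hmin hx) hp hpq hp' hpq'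
    obtain ⟨v', hv', hvs', hve'⟩ := ih t (S.erase t) q' p' (ζ y) (hs.trans htI.1.le) htI.2
      (fun r hr => ⟨lt_of_le_of_ne (hmin r (Finset.mem_of_mem_erase hr))
        (Finset.ne_of_mem_erase hr).symm, (hS r (Finset.mem_of_mem_erase hr)).2⟩)
      (by rw [Finset.card_erase_of_mem htS, hm]; omega) (hζ.erase htI.1.le) hq' hy hp' hpq''
    refine ⟨fun n i => if i ≤ ⌊t / lam n⌋₊ then v n i else v' n i, ?_, ?_, ?_⟩
    · have := hv.glue H hs htI.1 htI.2 hv' hve hvs'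
      have e : insert t (∅ ∪ ((S.erase t : Finset ℝ) : Set ℝ)) = S := by
        rw [empty_union, ← Finset.coe_insert, Finset.insert_erase htS]
      rw [e] at this
      have e2 : (2 : ℝ) + (2 * m + 1) = 2 * ((m + 1 : ℕ) : ℝ) + 1 := by push_cast; ring
      rwa [e2] at this
    · filter_upwards [hvs, H.eventually_floor_lt hs htI.1] with n h1 h2
      rw [if_pos (by omega), if_pos (by omega)]
      exact h1
    · filter_upwards [hve', H.eventually_floor_lt (hs.trans htI.1.le) htI.2] with n h1 h2
      rw [if_neg (by omega), if_neg (by omega)]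
      exact h1

/-- Recovery sequences for piecewise constant profiles. -/
theorem exists_recovery_row (H : IsScaling h lam k Q)
    (hQ : ∀ x ∈ Ioo (0 : ℝ) 1, ∃ q, IsAxis Q q (ζ x)) {S : Finset ℝ}
    (hS : ∀ t ∈ S, t ∈ Ioo (0 : ℝ) 1) (hζ : IsPiecewiseConst 0 S ζ) :
    ∃ v, IsRecovery h lam Q 0 1 (2 * S.card) S ζ v ∧
      ∀ᶠ n in atTop, inner ℝ (v n 0) (v n 1) = 1 - h n ^ 2 / 2 ∧
        inner ℝ (v n (⌊1 / lam n⌋₊ - 1)) (v n ⌊1 / lam n⌋₊) = 1 - h n ^ 2 / 2 := by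
  obtain ⟨x, hxI, hx⟩ := hζ.exists_right_value le_rfl one_pos
  obtain ⟨q, hq⟩ := hQ x hxI
  -- With jumps, a half arc comes first and the tail contributes 2(card - 1) + 1, so there are 2
  -- card half transitions in all.
  rcases S.eq_empty_or_nonempty with hS0 | hne
  · subst hS0
    have := exists_recovery_const H hq (∅ : Finset ℝ)
      (fun y hy => hζ.eq_right_value hx le_rfl (by simp) hy)
    simpa using this
  · set t := S.min' hne with ht
    have htS : t ∈ S := S.min'_mem hne
    have htI := hS t htS
    have hmin : ∀ r ∈ S, t ≤ r := fun r hr => S.min'_le r hr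
    obtain ⟨y, hyI, hy⟩ := hζ.exists_right_value htI.1.le htI.2
    obtain ⟨q', hq'⟩ := hQ y ⟨htI.1.trans hyI.1, hyI.2⟩
    choose p' hp' hpq' hpq'' using fun n => exists_unit_orthogonal (q n) (q' n)
    obtain ⟨v, hv, hve, hvs⟩ := exists_recovery_first H hq htI.1 ∅
      (fun x hx' => hζ.eq_right_value hx htI.2.le hmin hx') hp' hpq'
    obtain ⟨v', hv', hvs', hve'⟩ := exists_recovery_tail H hQ (S.erase t).card t (S.erase t) q' p'
      (ζ y) htI.1.le htI.2
      (fun r hr => ⟨lt_of_le_of_ne (hmin r (Finset.mem_of_mem_erase hr))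
        (Finset.ne_of_mem_erase hr).symm, (hS r (Finset.mem_of_mem_erase hr)).2⟩)
      rfl (hζ.erase htI.1.le) hq' hy hp' hpq''
    refine ⟨fun n i => if i ≤ ⌊t / lam n⌋₊ then v n i else v' n i, ?_, ?_⟩
    · have := hv.glue H le_rfl htI.1 htI.2 hv' hve hvs'
      have e : insert t (∅ ∪ ((S.erase t : Finset ℝ) : Set ℝ)) = S := by
        rw [empty_union, ← Finset.coe_insert, Finset.insert_erase htS]
      rw [e] at this
      have e2 : (1 : ℝ) + (2 * (S.erase t).card + 1) = 2 * (S.card : ℝ) := by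
        have : (S.erase t).card + 1 = S.card := Finset.card_erase_add_one htS
        rw [← this]; push_cast; ring
      rwa [e2] at this
    · filter_upwards [hvs, hve', H.eventually_floor_lt le_rfl htI.1,
        H.eventually_floor_lt htI.1.le htI.2] with n h1 h2 h3 h4
      rw [if_pos (by omega), if_pos (by omega), if_neg (by omega), if_neg (by omega)]
      exact ⟨h1, h2⟩

end Recovery


/-! ### The upper bound and the theorem -/

instance isFiniteMeasure_unitSquare :
    IsFiniteMeasure (volume.restrict unitSquare : Measure Plane) := by
  refine ⟨?_⟩
  rw [Measure.restrict_apply_univ, ← measurePreserving_planeEquiv.measure_preimage_equiv,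
    preimage_unitSquare, Measure.volume_eq_prod, Measure.prod_prod]
  simp

theorem measurable_chiralityField (lam δ : ℝ) (u : ℤ × ℤ → Space3) :
    Measurable (chiralityField lam δ u) := by
  have h1 : Measurable fun p : Plane => (⌊p 0 / lam⌋, ⌊p 1 / lam⌋) := by
    refine (Int.measurable_floor.comp ?_).prodMk (Int.measurable_floor.comp ?_) <;> fun_prop
  exact (measurable_of_countable (chirality lam δ u)).comp h1

/-- The field all of whose rows are equal to a given row. -/
def constField (v : ℕ → Space3) (i : ℤ × ℤ) : Space3 := v i.1.toNat

theorem spinRow_constField (v : ℕ → Space3) (m : ℕ) : spinRow (constField v) m = v := by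
  funext i; simp [spinRow, constField]

theorem isAdmissibleSpin_constField {lam : ℝ} (hl : 0 < lam) {Q : Set Space3} {v : ℕ → Space3}
    (hN : 1 ≤ ⌊1 / lam⌋₊) (hv : ∀ i ≤ ⌊1 / lam⌋₊, ‖v i‖ = 1 ∧ ∃ q ∈ Q, inner ℝ (v i) q = 0)
    (hb : inner ℝ (v 0) (v 1) = inner ℝ (v (⌊1 / lam⌋₊ - 1)) (v ⌊1 / lam⌋₊)) :
    IsAdmissibleSpin lam (circleUnion Q) (constField v) where
  mem i hi := by
    rw [lattice, floor_eq_natFloor hl, Finset.mem_product, Finset.mem_Icc] at hi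
    exact hv i.1.toNat (by omega)
  boundary m _ _ := by
    rw [floor_eq_natFloor hl]
    have e : ((⌊1 / lam⌋₊ : ℤ) - 1).toNat = ⌊1 / lam⌋₊ - 1 := by omega
    simp only [constField, e, Int.toNat_natCast, Int.toNat_one, Int.toNat_zero]
    rw [real_inner_comm, hb, real_inner_comm]

/-- Equal rows have no vertical energy, so `J` drops out and may be arbitrarily large. -/
theorem spinEnergy_constField_div {lam δ J : ℝ} (hl : 0 < lam) (hδ : 0 < δ) (v : ℕ → Space3) :
    spinEnergy lam δ J (constField v) / (√2 * lam * δ ^ (3 / 2 : ℝ)) =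
      lam * (⌊1 / lam⌋₊ + 1) * rowEnergy √(2 * δ) ⌊1 / lam⌋₊ v := by
  rw [spinEnergy_div hl hδ]
  simp only [spinRow_constField, Finset.sum_const, Finset.card_range, sub_self, norm_zero]
  simp
  ring

theorem isAxis_of_mem {Q : ℕ → Finset Space3} {Qbar : Set Space3}
    (hQbar : ∀ a ∈ Qbar, ∃ x : ℕ → Space3, (∀ n, x n ∈ Q n) ∧ Tendsto x atTop (𝓝 a))
    {c : Space3} (hc : c ∈ Qbar ∪ {q | -q ∈ Qbar}) : ∃ q, IsAxis Q q c := by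
  rcases hc with h1 | h1
  · obtain ⟨x, hx, hx'⟩ := hQbar c h1
    exact ⟨x, fun n => Or.inl (hx n), hx'⟩
  · obtain ⟨x, hx, hx'⟩ := hQbar (-c) h1
    refine ⟨fun n => -x n, fun n => Or.inr (by simpa using hx n), ?_⟩
    simpa using hx'.neg

/-- By continuity from the left the value at `x` is taken on a whole interval to the left of `x`,
which contains points of the set of full measure. -/
theorem stepFunction_mem_of_ae {S : Finset ℝ} {c : Space3} {Δ : ℝ → Space3} {K : Set Space3}
    (hK : ∀ᵐ x : ℝ, x ∈ Ioo (0 : ℝ) 1 → stepFunction S c Δ x ∈ K) {x : ℝ}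
    (hx : x ∈ Ioo (0 : ℝ) 1) : stepFunction S c Δ x ∈ K := by
  obtain ⟨ε, hε, h1, -⟩ := stepFunction_eventually S c Δ x
  have hpos : volume (Ioo (max 0 (x - ε)) x) ≠ 0 := by
    rw [Real.volume_Ioo]
    have : max 0 (x - ε) < x := max_lt hx.1 (by linarith)
    simpa using this
  obtain ⟨y, hyI, hyc⟩ := ((frequently_ae_mem_iff.2 hpos).and_eventually hK).exists
  rw [← h1 y ⟨(le_max_right _ _).trans_lt hyI.1, hyI.2⟩]
  exact hyc ⟨(le_max_left _ _).trans_lt hyI.1, hyI.2.trans hx.2⟩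

theorem IsRecovery.eventually_bound {h lam : ℕ → ℝ} {k : ℕ → ℕ} {Q : ℕ → Finset Space3}
    (H : IsScaling h lam k Q) {κ : ℝ} (hκ : 0 ≤ κ) {S : Set ℝ} {ζ : ℝ → Space3}
    {v : ℕ → ℕ → Space3} (A : IsRecovery h lam Q 0 1 κ S ζ v) {ε : ℝ} (hε : 0 < ε) :
    ∀ᶠ n in atTop, rowEnergy (h n) ⌊1 / lam n⌋₊ (v n) ≤ κ * (4 / 3) + ε ∧
      ∀ i < ⌊1 / lam n⌋₊, ‖rowChir (h n) (v n) i‖ ≤ κ * (4 / 3) + ε + 3 := by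
  obtain ⟨h₀, h₀pos, hstep⟩ := exists_rowStep_le (B := κ * (4 / 3) + ε) (by positivity)
  filter_upwards [A.mem, A.energy ε hε, H.h_tendsto.eventually_lt_const h₀pos,
    (H.tendsto_mul_floor_sub le_rfl one_pos).eventually_gt_atTop (4 * (κ * (4 / 3) + ε))]
    with n h1 h2 h3 h4
  have hf : ⌊(0 : ℝ) / lam n⌋₊ = 0 := by simp
  rw [hf] at h1 h2 h4
  rw [Nat.sub_zero, mul_comm (h n)] at h4
  have hE : rowEnergy (h n) ⌊1 / lam n⌋₊ (v n) ≤ κ * (4 / 3) + ε := by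
    rw [← Finset.range_eq_Ico] at h2
    exact h2
  have hu : ∀ i ≤ ⌊1 / lam n⌋₊, ‖v n i‖ = 1 := fun i hi => (h1 i (Nat.zero_le _) hi).1
  refine ⟨hE, fun i hi => ?_⟩
  exact (norm_rowChir_le (H.h_pos n) (hu i hi.le) (hu (i + 1) hi)).trans
    (hstep (h n) (H.h_pos n) h3 _ (v n) hu hE h4 i hi)

/-- The upper bound. -/
theorem exists_recovery_sequence {lam δ : ℕ → ℝ} (J₂ : ℕ → ℝ) {k : ℕ → ℕ} {Q : ℕ → Finset Space3}
    {Qbar : Set Space3} (hδ : ∀ n, 0 < δ n) (H : IsScaling (fun n => √(2 * δ n)) lam k Q)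
    (hQbar : ∀ a ∈ Qbar, ∃ x : ℕ → Space3, (∀ n, x n ∈ Q n) ∧ Tendsto x atTop (𝓝 a))
    (z : L1Square) :
    ∃ zs : ℕ → L1Square, Tendsto zs atTop (𝓝 z) ∧
      limsup (fun n => constrainedEnergy (lam n) (δ n) (J₂ n) (Q n) (zs n) /
          ENNReal.ofReal (√2 * lam n * δ n ^ (3 / 2 : ℝ))) atTop ≤
        limitEnergy (Qbar ∪ {q | -q ∈ Qbar}) z := by
  classical
  by_cases hz : IsBVpc openUnitSquare (Qbar ∪ {q | -q ∈ Qbar}) z ∧ IndependentOfY z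
  swap
  · refine ⟨fun _ => z, tendsto_const_nhds, ?_⟩
    rw [limitEnergy, if_neg hz]
    exact le_top
  obtain ⟨ζ, hzζ, hfin, hK⟩ := exists_profile hz.1 hz.2
  obtain ⟨c, Δ, -, hσ⟩ := exists_ae_eq_stepFunction hfin
  set S := hfin.toFinset with hSdef
  set σ := stepFunction S c Δ with hσdef
  have hS : ∀ t ∈ S, t ∈ Ioo (0 : ℝ) 1 := fun t ht => (hfin.mem_toFinset.1 ht).1
  have hKσ : ∀ᵐ x : ℝ, x ∈ Ioo (0 : ℝ) 1 → σ x ∈ Qbar ∪ {q | -q ∈ Qbar} := by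
    filter_upwards [hK, hσ] with x h1 h2 hx
    rw [← h2 hx]; exact h1 hx
  have hzσ : ∀ᵐ p ∂volume.restrict openUnitSquare, z p = σ (p 0) := by
    filter_upwards [hzζ, (ae_openUnitSquare_iff_zero (P := fun x => ζ x = σ x)).2 hσ] with p h1 h2
    rw [h1, h2]
  obtain ⟨v, hv, hbd⟩ := exists_recovery_row H
    (fun x hx => isAxis_of_mem hQbar (stepFunction_mem_of_ae hKσ hx)) hS
    (isPiecewiseConst_stepFunction 0 S c Δ)
  set μ : Measure Plane := volume.restrict unitSquare with hμ
  set f : ℕ → Plane → Space3 := fun n => chiralityField (lam n) (δ n) (constField (v n)) with hf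
  have hN : ∀ᶠ n in atTop, 1 ≤ ⌊1 / lam n⌋₊ :=
    (H.eventually_floor_lt le_rfl one_pos).mono fun n hn => by omega
  obtain ⟨R, hR⟩ : ∃ R : ℝ, ∀ᶠ n in atTop, ∀ᵐ p ∂μ, ‖f n p‖ ≤ R := by
    refine ⟨2 * S.card * (4 / 3) + 1 + 3, (((hv.eventually_bound H (by positivity) one_pos).and hN).mono ?_)⟩
    rintro n ⟨⟨-, h2⟩, h3⟩
    refine ae_unitSquare_iff.2 ?_
    filter_upwards [ae_restrict_mem measurableSet_openUnitSquare] with p hp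
    rw [hf]
    simp only
    rw [chiralityField_eq (H.lam_pos n) _ (hp 0).1.le (hp 1).1.le h3, spinRow_constField]
    exact h2 _ (by omega)
  have hmem : ∀ᶠ n in atTop, MemLp (f n) 1 μ := by
    filter_upwards [hR] with n hn
    exact MemLp.of_bound (measurable_chiralityField _ _ _).aestronglyMeasurable R hn
  -- The default value `z` can matter for finitely many n only.
  set zs : ℕ → L1Square := fun n => if hm : MemLp (f n) 1 μ then hm.toLp (f n) else z with hzs
  have hzsf : ∀ n, MemLp (f n) 1 μ → zs n =ᵐ[μ] f n := by
    intro n hm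
    simp only [hzs, dif_pos hm]
    exact hm.coeFn_toLp
  refine ⟨zs, ?_, ?_⟩
  · rw [Lp.tendsto_Lp_iff_tendsto_eLpNorm']
    simp only [eLpNorm_one_eq_lintegral_enorm]
    have hlim : ∀ᵐ p ∂μ, Tendsto (fun n => ‖(zs n - z : Plane → Space3) p‖ₑ) atTop (𝓝 0) := by
      have hP : ∀ᵐ x : ℝ, x ∈ Ioo (0 : ℝ) 1 → Tendsto
          (fun n => rowChir √(2 * δ n) (v n) ⌊x / lam n⌋₊) atTop (𝓝 (σ x)) := by
        have : ∀ᵐ x : ℝ, x ∉ (S : Set ℝ) := measure_eq_zero_iff_ae_notMem.1 (S.finite_toSet.measure_zero _)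
        filter_upwards [this] with x hx hxI using hv.tendsto x hxI hx
      have hall : ∀ᵐ p ∂μ, ∀ n, MemLp (f n) 1 μ → zs n p = f n p :=
        ae_all_iff.2 fun n => eventually_imp_distrib_left.2 (hzsf n)
      filter_upwards [ae_unitSquare_iff.2 hzσ, hall,
        ae_unitSquare_iff.2 ((ae_openUnitSquare_iff_zero (P := fun x => Tendsto
          (fun n => rowChir √(2 * δ n) (v n) ⌊x / lam n⌋₊) atTop (𝓝 (σ x)))).2 hP),
        ae_unitSquare_iff.2 (ae_restrict_mem measurableSet_openUnitSquare)]
        with p h1 h2 h4 hp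
      have h5 : Tendsto (fun n => (zs n - z : Plane → Space3) p) atTop (𝓝 0) := by
        have h6 := h4.sub_const (σ (p 0))
        rw [sub_self] at h6
        refine h6.congr' ?_
        filter_upwards [hmem, H.eventually_floor_add_le (hp 0).1.le (hp 0).2] with n h7 h8
        rw [Pi.sub_apply, h1, h2 n h7, hf]
        simp only
        rw [chiralityField_eq (H.lam_pos n) _ (hp 0).1.le (hp 1).1.le (by omega),
          spinRow_constField, min_eq_left (by omega)]
      have h9 := h5.enorm
      simpa using h9
    have := tendsto_lintegral_filter_of_dominated_convergence'
      (F := fun n p => ‖(zs n - z : Plane → Space3) p‖ₑ) (f := fun _ => 0) (μ := μ) (l := atTop)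
      (fun _ => ENNReal.ofReal (R + (‖c‖ + ∑ t ∈ S, ‖Δ t‖))) ?_ ?_ ?_ hlim
    · simpa using this
    · exact Eventually.of_forall fun n =>
        ((measurable_coeFn (zs n)).sub (measurable_coeFn z)).enorm.aemeasurable
    · filter_upwards [hR, hmem] with n h1 h2
      filter_upwards [h1, hzsf n h2, ae_unitSquare_iff.2 hzσ] with p h3 h4 h5
      rw [Pi.sub_apply, h4, h5, ← ofReal_norm]
      refine ENNReal.ofReal_le_ofReal ((norm_sub_le _ _).trans ?_)
      exact add_le_add h3 (norm_stepFunction_le S c Δ _)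
    · rw [lintegral_const]
      exact ENNReal.mul_ne_top ENNReal.ofReal_ne_top (measure_ne_top _ _)
  · rw [limitEnergy_of_ae_eq hzζ hfin hK]
    have hcard : (singularSet ζ).ncard = S.card := Set.ncard_eq_toFinset_card _ hfin
    set B : ℝ := (2 * S.card : ℝ) * (4 / 3) with hB
    have hBe : (8 / 3 * ((singularSet ζ).ncard : ℝ≥0∞)) = ENNReal.ofReal B := by
      rw [hcard, hB, show (2 * S.card : ℝ) * (4 / 3) = 8 / 3 * S.card by ring,
        ENNReal.ofReal_mul (by norm_num), ENNReal.ofReal_natCast,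
        ENNReal.ofReal_div_of_pos (by norm_num)]
      norm_num
    have hB0 : 0 ≤ B := by positivity
    rw [hBe]
    refine ENNReal.le_of_forall_pos_le_add fun ε hε _ => ?_
    have hε' : (0 : ℝ) < ε := hε
    refine limsup_le_of_le (by isBoundedDefault) ?_
    -- There are N + 1 rows of weight λ each, with λ(N + 1) ≤ 1 + λ.
    have hl1 : ∀ᶠ n in atTop, (1 + lam n) * (B + ε / 2) < B + ε := by
      have : Tendsto (fun n => (1 + lam n) * (B + ε / 2)) atTop (𝓝 ((1 + 0) * (B + ε / 2))) :=
        (H.lam_tendsto.const_add 1).mul_const _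
      refine this.eventually_lt_const ?_
      linarith
    filter_upwards [hl1, hv.eventually_bound H (by positivity) (half_pos hε'), hmem, hv.mem, hbd, hN]
      with n h1 h2 h3 h4 h5 h6
    have hl := H.lam_pos n
    have hf0 : ⌊(0 : ℝ) / lam n⌋₊ = 0 := by simp
    rw [hf0] at h4
    have hadm : IsAdmissibleSpin (lam n) (circleUnion (Q n)) (constField (v n)) :=
      isAdmissibleSpin_constField hl h6 (fun i hi => h4 i (Nat.zero_le _) hi) (h5.1.trans h5.2.symm)
    have hce : constrainedEnergy (lam n) (δ n) (J₂ n) (Q n) (zs n) ≤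
        ENNReal.ofReal (spinEnergy (lam n) (δ n) (J₂ n) (constField (v n))) :=
      iInf_le_of_le _ (iInf_le_of_le hadm (iInf_le _ (hzsf n h3)))
    have hpos : 0 < √2 * lam n * δ n ^ (3 / 2 : ℝ) := by
      have := hδ n; positivity
    refine (ENNReal.div_le_div_right hce _).trans ?_
    rw [← ENNReal.ofReal_div_of_pos hpos, spinEnergy_constField_div hl (hδ n),
      ← ENNReal.ofReal_coe_nnreal, ← ENNReal.ofReal_add hB0 hε'.le]
    refine ENNReal.ofReal_le_ofReal (le_trans ?_ h1.le)
    have h7 : lam n * (⌊1 / lam n⌋₊ + 1) ≤ 1 + lam n := by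
      have := Nat.floor_le (show 0 ≤ 1 / lam n by positivity)
      rw [le_div_iff₀ hl] at this
      linarith
    have h8 := rowEnergy_nonneg (N := ⌊1 / lam n⌋₊) (v := v n) (H.h_pos n)
    exact mul_le_mul h7 h2.1 h8 (by positivity)

theorem mainTheorem4
    (lam δ J₂ : ℕ → ℝ) (k : ℕ → ℕ) (Q : ℕ → Finset (EuclideanSpace ℝ (Fin 3)))
    (Qbar : Set (EuclideanSpace ℝ (Fin 3)))
    (hlam : ∀ n, 0 < lam n) (hδ : ∀ n, 0 < δ n)
    (hlam0 : Tendsto lam atTop (𝓝 0)) (hδ0 : Tendsto δ atTop (𝓝 0))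
    (hk : ∀ n, 0 < k n) (hQk : ∀ n, (Q n).card = k n) (hQ : ∀ n, ∀ q ∈ Q n, ‖q‖ = 1)
    (hQbar : KuratowskiConverges (fun n => (Q n : Set (EuclideanSpace ℝ (Fin 3)))) Qbar)
    (hkδ : Tendsto (fun n => (k n : ℝ) * δ n ^ (1 / 4 : ℝ)) atTop (𝓝 0))
    (hlamδ : Tendsto (fun n => lam n / √(δ n)) atTop (𝓝 0))
    (hJ₂ : ∃ c : ℝ, 0 < c ∧ ∀ n, c ≤ J₂ n * (lam n / √(δ n))) :
    GammaConverges
        (fun n z => constrainedEnergy (lam n) (δ n) (J₂ n) (Q n) z /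
          ENNReal.ofReal (√2 * lam n * δ n ^ (3 / 2 : ℝ)))
        (limitEnergy (Qbar ∪ {q | -q ∈ Qbar})) ∧
      ∀ z : L1Square, limitEnergy (Qbar ∪ {q | -q ∈ Qbar}) z < ⊤ ↔
        IsBVpc openUnitSquare (Qbar ∪ {q | -q ∈ Qbar}) z ∧ IndependentOfY z := by
  have H := isScaling_of_tendsto hlam hδ hlam0 hδ0 hk hQk hQ hkδ hlamδ
  obtain ⟨c, hc, hJ⟩ := hJ₂
  exact ⟨⟨limitEnergy_le_liminf hδ H hQbar.1 hc hJ,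
    exists_recovery_sequence J₂ hδ H hQbar.2⟩, fun z => limitEnergy_lt_top_iff⟩

end
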